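/- Let $d\in\mathbb N$, $H_i\in(0,1)\setminus\{1/2\}$, $\alpha_i>0$, $\nu_i>0$ for $i=1,\dots,d$. Let $B=(B^{1}_t,\dots,B^{d}_t)_{t\in\mathbb R}$ be a $d$-variate fractional Brownian motion: a centered Gaussian process in $\mathbb R^d$ such that each $B^{i}$ is a fractional Brownian motion with Hurst index $H_i$, almost surely continuous and with $\operatorname{Var}(B^i_1)=1$; $(B^i_{\lambda t})_{i,t}$ and $(\lambda^{H_i}B^i_t)_{i,t}$ have the same finite-dimensional distributions for every $\lambda>0$; and $B$ has stationary increments. Write $H_{ij}=H_i+H_j$. Then: (a) There are real numbers $\rho_{ij},\eta_{ij}$ ($i\ne j$) with $\rho_{ij}=\rho_{ji}=\operatorname{Corr}(B^i_1,B^j_1)\in[-1,1]$ and $\eta_{ij}=-\eta_{ji}$, such that for all $i\neq j$ and $t,s\in\mathbb R$, if $H_{ij}\ne1$, $$\operatorname{Cov}(B^i_t,B^j_s)=\tfrac12\big((\rho_{ij}+\operatorname{sign}(t)\eta_{ij})|t|^{H_{ij}}+(\rho_{ij}-\operatorname{sign}(s)\eta_{ij})|s|^{H_{ij}}-(\rho_{ij}-\operatorname{sign}(s-t)\eta_{ij})|s-t|^{H_{ij}}\big),$$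 where $\operatorname{sign}(x)=1$ for $x\ge0$ and $\operatorname{sign}(x)=-1$ for $x<0$, and, if $H_{ij}=1$ (with $0\log0=0$), $$\operatorname{Cov}(B^i_t,B^j_s)=\tfrac12\big(\rho_{ij}(|s|+|t|-|s-t|)+\eta_{ij}(s\log|s|-t\log|t|-(s-t)\log|s-t|)\big).$$ (b) Almost surely, for all $t\in\mathbb R$ and all $i$, the integral $\int_{-\infty}^te^{-\alpha_i(t-s)}\,dB^i_s$ exists as a pathwise improper Riemann–Stieltjes integral. Let $Y=(Y^1_t,\dots,Y^d_t)_{t\in\mathbb R}$ be the multivariate fractional Ornstein–Uhlenbeck process, i.e. $Y^i_t=\nu_i\int_{-\infty}^te^{-\alpha_i(t-s)}\,dB^i_s$ almost surely, for every $t$ and $i$. (c) $Y$ is a Gaussian process, it is strongly stationary (its finite-dimensional distributions are invariant under time shifts), and $\mathbb E[Y^i_t]=0$ and $\operatorname{Var}(Y^i_t)>0$ for all $t$ and $i$. (d) For all $i$ and all $t>s$, the following integral is absolutely convergent, and $$\operatorname{Cov}(Y^i_t,Y^i_s)=\nu_i^2\,\frac{\Gamma(2H_i+1)\sin(\pi H_i)}{2\pi}\int_{-\infty}^{\infty}e^{\mathbf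 i(t-s)x}\frac{|x|^{1-2H_i}}{\alpha_i^2+x^2}\,dx .$$ (e) For $i\ne j$ and $\tau>0$, the double integral $$I_{ij}(\tau)=\int_0^{\tau}e^{\alpha_iu}\Big(\int_{-\infty}^0e^{\alpha_jv}(u-v)^{H_{ij}-2}\,dv\Big)du$$ converges absolutely. With the numbers $\rho_{ij},\eta_{ij}$ of (a), the following hold for all $i\ne j$. If $H_{ij}\ne1$, then for all $t>s$ $$\operatorname{Cov}(Y^i_t,Y^j_s)=e^{-\alpha_i(t-s)}\operatorname{Cov}(Y^i_0,Y^j_0)+\nu_i\nu_je^{-\alpha_i(t-s)}H_{ij}(H_{ij}-1)\frac{\rho_{ij}+\eta_{ij}}2\,I_{ij}(t-s),$$ where $$\operatorname{Cov}(Y^i_0,Y^j_0)=\frac{\Gamma(H_{ij}+1)\nu_i\nu_j}{2(\alpha_i+\alpha_j)}\Big((\alpha_i^{1-H_{ij}}+\alpha_j^{1-H_{ij}})\rho_{ij}+(\alpha_j^{1-H_{ij}}-\alpha_i^{1-H_{ij}})\eta_{ij}\Big),$$ and for all $t$ $$\operatorname{Corr}(Y^i_t,Y^j_t)=\frac{\Gamma(H_{ij}+1)}{\sqrt{\Gamma(2H_i+1)\Gamma(2H_j+1)}}\,\frac{\alpha_i^{H_i}\alpha_j^{H_j}}{\alpha_i+\alpha_j}\Big((\alpha_i^{1-H_{ij}}+\alpha_j^{1-H_{ij}})\rho_{ij}+(\alpha_j^{1-H_{ij}}-\alpha_i^{1-H_{ij}})\eta_{ij}\Big).$$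 If $H_{ij}=1$, then for all $t>s$ $$\operatorname{Cov}(Y^i_t,Y^j_s)=e^{-\alpha_i(t-s)}\operatorname{Cov}(Y^i_0,Y^j_0)-\nu_i\nu_je^{-\alpha_i(t-s)}\frac{\eta_{ij}}2\,I_{ij}(t-s),$$ where $$\operatorname{Cov}(Y^i_0,Y^j_0)=\frac{\nu_i\nu_j}{\alpha_i+\alpha_j}\Big(\rho_{ij}+\frac{\eta_{ij}}2(\log\alpha_j-\log\alpha_i)\Big),$$ and for all $t$ $$\operatorname{Corr}(Y^i_t,Y^j_t)=\frac1{\sqrt{\Gamma(2H_i+1)\Gamma(2H_j+1)}}\,\frac{2\alpha_i^{H_i}\alpha_j^{H_j}}{\alpha_i+\alpha_j}\Big(\rho_{ij}+\frac{\eta_{ij}}2(\log\alpha_j-\log\alpha_i)\Big).$$ -/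

import Mathlib

open MeasureTheory ProbabilityTheory Filter Topology

/-! ### Pathwise Riemann-Stieltjes integrals -/

/-- `HasRSIntegral f g a b J`: the Riemann-Stieltjes integral of `f` against `g` over `[a, b]`
exists and equals `J`, i.e. the sums `∑ f (ξ k) * (g (x (k+1)) - g (x k))` over the tagged
partitions `a = x 0 ≤ ⋯ ≤ x n = b`, `ξ k ∈ [x k, x (k+1)]`, tend to `J` as the mesh tends to `0`.
Only the values `x 0, …, x n` and `ξ 0, …, ξ (n-1)` matter. -/
def HasRSIntegral (f g : ℝ → ℝ) (a b J : ℝ) : Prop :=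
  ∀ ε : ℝ, 0 < ε → ∃ δ : ℝ, 0 < δ ∧ ∀ (n : ℕ) (x ξ : ℕ → ℝ),
    x 0 = a → x n = b →
    (∀ k < n, x k ≤ x (k + 1) ∧ x (k + 1) - x k < δ) →
    (∀ k < n, ξ k ∈ Set.Icc (x k) (x (k + 1))) →
    |∑ k ∈ Finset.range n, f (ξ k) * (g (x (k + 1)) - g (x k)) - J| < ε

/-- `HasImproperRSIntegral f g t J`: the improper Riemann-Stieltjes integral of `f` against `g`
over `(-∞, t]` exists and equals `J`. -/
def HasImproperRSIntegral (f g : ℝ → ℝ) (t J : ℝ) : Prop :=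
  ∃ F : ℝ → ℝ, (∀ a < t, HasRSIntegral f g a t (F a)) ∧ Tendsto F atBot (𝓝 J)

/-! ### Processes indexed by the real line -/

/-- Two processes on the same probability space have the same finite-dimensional distributions. -/
def SameFDD {Ω E : Type*} [MeasurableSpace Ω] [MeasurableSpace E] (X Z : ℝ → Ω → E)
    (μ : Measure Ω) : Prop :=
  ∀ S : Finset ℝ, IdentDistrib (fun ω => S.restrict (X · ω)) (fun ω => S.restrict (Z · ω)) μ μ

/-- Strong (strict) stationarity: the finite-dimensional distributions are invariant under all
time shifts. -/
def IsStronglyStationary {Ω E : Type*} [MeasurableSpace Ω] [MeasurableSpace E] (X : ℝ → Ω → E)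
    (μ : Measure Ω) : Prop :=
  ∀ h : ℝ, SameFDD (fun t => X (t + h)) X μ

/-- Two-sided (standard) fractional Brownian motion with Hurst index `H`, with variance `1` at
time `1` and almost surely continuous paths. -/
structure IsFBM {Ω : Type*} [MeasurableSpace Ω] (H : ℝ) (X : ℝ → Ω → ℝ) (μ : Measure Ω) :
    Prop where
  gaussian : IsGaussianProcess X μ
  centered : ∀ t, ∫ ω, X t ω ∂μ = 0
  cov_eq : ∀ t s, cov[X t, X s; μ] =
    (|t| ^ (2 * H) + |s| ^ (2 * H) - |t - s| ^ (2 * H)) / 2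
  continuous_paths : ∀ᵐ ω ∂μ, Continuous fun t => X t ω

/-- `d`-variate fractional Brownian motion with Hurst indices `H 0, …, H (d-1)` (each component
normalised to variance `1` at time `1`): a centered Gaussian process in `ℝ^d` whose components are
fractional Brownian motions, which is jointly self-similar with exponents `H i` and has (jointly)
stationary increments. -/
structure IsMultivariateFBM {Ω : Type*} [MeasurableSpace Ω] {d : ℕ} (H : Fin d → ℝ)
    (B : ℝ → Ω → Fin d → ℝ) (μ : Measure Ω) : Prop where
  gaussian : IsGaussianProcess B μ
  centered : ∀ t i, ∫ ω, B t ω i ∂μ = 0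
  component : ∀ i, IsFBM (H i) (fun t ω => B t ω i) μ
  self_similar : ∀ c : ℝ, 0 < c →
    SameFDD (fun t => B (c * t)) (fun t ω i => c ^ H i * B t ω i) μ
  stationary_increments : ∀ h : ℝ,
    SameFDD (fun t ω i => B (t + h) ω i - B h ω i) (fun t ω i => B t ω i - B 0 ω i) μ

/-- `Y` is the multivariate fractional Ornstein-Uhlenbeck process driven by `B`:
`Y_t^i = ν_i ∫_{-∞}^t exp (-α_i (t - s)) dB_s^i`, almost surely for every `t`, as a pathwise
improper Riemann-Stieltjes integral. -/
def IsMultivariateFOU {Ω : Type*} [MeasurableSpace Ω] {d : ℕ} (α ν : Fin d → ℝ)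
    (B Y : ℝ → Ω → Fin d → ℝ) (μ : Measure Ω) : Prop :=
  ∀ t i, ∀ᵐ ω ∂μ, ∃ J : ℝ,
    HasImproperRSIntegral (fun s => Real.exp (-α i * (t - s))) (fun s => B s ω i) t J ∧
      Y t ω i = ν i * J

/-- Pearson correlation of two real random variables. -/
noncomputable def corr {Ω : Type*} [MeasurableSpace Ω] (X Z : Ω → ℝ) (μ : Measure Ω) : ℝ :=
  cov[X, Z; μ] / √(Var[X; μ] * Var[Z; μ])

/-! ### Cross-covariance parameters of the multivariate fractional Brownian motion -/

/-- The sign function with values in `{-1, 1}`, equal to `1` at `0`. -/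
noncomputable def sgn (x : ℝ) : ℝ := if 0 ≤ x then 1 else -1

/-- `ρ` and `η` are the cross-covariance parameters of the `d`-variate fractional Brownian motion
`B`: off the diagonal, `ρ` is the (symmetric) correlation matrix of `B_1`, `η` is antisymmetric,
and the cross-covariance functions of `B` are the displayed expressions in `ρ` and `η`.
The diagonal entries of `ρ` and `η` play no role. -/
structure IsCrossParam {Ω : Type*} [MeasurableSpace Ω] {d : ℕ} (H : Fin d → ℝ)
    (B : ℝ → Ω → Fin d → ℝ) (μ : Measure Ω) (ρ η : Fin d → Fin d → ℝ) : Prop where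
  rho_symm : ∀ i j, i ≠ j → ρ i j = ρ j i
  rho_mem : ∀ i j, i ≠ j → ρ i j ∈ Set.Icc (-1 : ℝ) 1
  rho_eq : ∀ i j, i ≠ j → ρ i j = corr (fun ω => B 1 ω i) (fun ω => B 1 ω j) μ
  eta_antisymm : ∀ i j, i ≠ j → η i j = -η j i
  cov_of_ne : ∀ i j, i ≠ j → H i + H j ≠ 1 → ∀ t s : ℝ,
    cov[fun ω => B t ω i, fun ω => B s ω j; μ] =
      ((ρ i j + sgn t * η i j) * |t| ^ (H i + H j) + (ρ i j - sgn s * η i j) * |s| ^ (H i + H j)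
        - (ρ i j - sgn (s - t) * η i j) * |s - t| ^ (H i + H j)) / 2
  cov_of_eq : ∀ i j, i ≠ j → H i + H j = 1 → ∀ t s : ℝ,
    cov[fun ω => B t ω i, fun ω => B s ω j; μ] =
      (ρ i j * (|s| + |t| - |s - t|)
        + η i j * (s * Real.log |s| - t * Real.log |t| - (s - t) * Real.log |s - t|)) / 2

/-! ### The double integral in the cross-covariance -/

/-- The inner integrand `v ↦ e^{b v} (u - v)^{h - 2}` on `(-∞, 0]`. -/
noncomputable def innerIntegrand (b h u v : ℝ) : ℝ := Real.exp (b * v) * (u - v) ^ (h - 2)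

/-- The outer integrand `u ↦ e^{a u} ∫_{-∞}^0 e^{b v} (u - v)^{h - 2} dv`. -/
noncomputable def outerIntegrand (a b h u : ℝ) : ℝ :=
  Real.exp (a * u) * ∫ v in Set.Iic (0 : ℝ), innerIntegrand b h u v

/-- `∫_0^τ e^{a u} (∫_{-∞}^0 e^{b v} (u - v)^{h - 2} dv) du`. For the process this is used with
`a = α_i`, `b = α_j`, `h = H_i + H_j`, and is then the quantity `I_{ij}(τ)`. -/
noncomputable def crossI (a b h τ : ℝ) : ℝ := ∫ u in (0 : ℝ)..τ, outerIntegrand a b h u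

/-- The integrand `e^{i τ x} |x|^{1 - 2H} / (a² + x²)` of the spectral representation of the
autocovariance function. -/
noncomputable def spectralIntegrand (a H τ x : ℝ) : ℂ :=
  Complex.exp (Complex.I * (τ * x : ℝ)) * ((|x| ^ (1 - 2 * H) / (a ^ 2 + x ^ 2) : ℝ) : ℂ)

/-!
The processes are handled through covariances of Gaussian variables; randomness enters only through
a path bound and one limit argument.

*Cross-covariances of the driver.* For two components put `C t s = Cov (B^i_t, B^j_s)`. Stationary
increments and self-similarity determine the symmetric part of `C` by its diagonal
`C t t = C 1 1 * |t| ^ h`, where `h = H_i + H_j`. The antisymmetric part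
`F a b = C (a + b) b - C b (a + b)` is a symmetric 2-cocycle on `(ℝ, +)`, homogeneous of degree `h`
(`IsSelfSimilarCov.isHomCocycle`). For `h ≠ 1` such a cocycle is a multiple of the coboundary of
`sgn x * |x| ^ h` (`IsHomCocycle.eq_coboundary`). For `h = 1` it is a multiple of the coboundary of
`x log |x|` (`IsHomCocycle.eq_coboundary_log`); here continuity of `C` is needed, and it comes from
the continuity of the paths.

*Pathwise integrals.* By time inversion almost every path of a fractional Brownian motion grows at
most quadratically (`IsFBM.ae_quadGrowth`). For a continuous integrator `g` of quadratic growth,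
integration by parts shows that `∫_{-∞}^t e^{-a (t - s)} dg(s)` exists and equals the linear
functional `ouFunctional a t g = g t - a ∫_0^∞ e^{-a y} g (t - y) dy`, which is a limit of finite
linear combinations of values of `g` (`QuadGrowth.tendsto_ouApprox`). Hence every `Y^i_t` is an
almost sure limit of elements of the Gaussian space spanned by `B`. Almost sure limits of centered
Gaussian variables are Gaussian and covariances pass to the limit, so `Y` is a centered Gaussian
process whose covariances are obtained by applying `ouFunctional` to both arguments of those of `B`.

*Stationarity.* The covariances of `B` have the form `p u + q v - k (v - u)`. The functional kills
constants, so only the kernel `k` contributes, and the double functional of `k (v - u)` depends on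
the lag alone: it is the combination `ouCov` of the exponential averages of `k`
(`QuadGrowth.ouFunctional_ouFunctional`, `IsMultivariateFOU.covariance_eq_ouCov`). For Gaussian
processes this gives strong stationarity.

*Explicit formulas.* At lag `0` the averages of the power and logarithmic kernels are Gamma
integrals. For positive lags `R = ouCov a b k` satisfies
`R' + a R = c ∫_{-∞}^0 e^{b v} (τ - v)^{h - 2} dv`, whose integrated form is the cross-covariance
formula (`QuadGrowth.ouCov_eq_of_hasDerivAt`). The spectral formula (`ouCov_eq_spectral`) follows by
inserting `|w|^{2H} D = ∫_0^∞ (1 - cos (w x)) x^{-1 - 2H} dx` into the averages and exchanging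
integrals; the constant `D` is evaluated through the reflection formula for the Gamma function.
-/

/-! ### Homogeneous symmetric two-cocycles on the real line -/

/-- Symmetric normalised 2-cocycles `F` on `(ℝ, +)` that vanish on the pairs `(a, -a)` and are
positively homogeneous of degree `h`. -/
structure IsHomCocycle (h : ℝ) (F : ℝ → ℝ → ℝ) : Prop where
  symm : ∀ a b, F a b = F b a
  cocycle : ∀ a b c, F a b + F (a + b) c = F a (b + c) + F b c
  hom : ∀ c a b, 0 < c → F (c * a) (c * b) = c ^ h * F a b
  zero_right : ∀ a, F a 0 = 0
  neg_right : ∀ a, F a (-a) = 0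

/-- Off degree `1` a homogeneous cocycle is the coboundary of `a ↦ F a a / (2 ^ h - 2)`: by the
cocycle identity, the coboundary of `a ↦ F a a` is `F (2 a) (2 b) - 2 F a b`. -/
lemma IsHomCocycle.eq_coboundary {h : ℝ} {F : ℝ → ℝ → ℝ} (hF : IsHomCocycle h F) (h0 : 0 < h)
    (h1 : h ≠ 1) (a b : ℝ) :
    F a b = F 1 1 / (2 ^ h - 2) *
      (sgn (a + b) * |a + b| ^ h - sgn a * |a| ^ h - sgn b * |b| ^ h) := by
  have h2 : (2 : ℝ) ^ h - 2 ≠ 0 := by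
    intro H
    have : (2 : ℝ) ^ h = 2 ^ (1 : ℝ) := by rw [Real.rpow_one]; linarith
    apply h1
    have h3 := congrArg Real.log this
    rw [Real.log_rpow (by norm_num), Real.log_rpow (by norm_num)] at h3
    exact mul_right_cancel₀ (Real.log_pos (by norm_num)).ne' h3
  have key : F (a + b) (a + b) - F a a - F b b = (2 ^ h - 2) * F a b := by
    have e1 := hF.cocycle a b (a + b)
    have e2 := hF.cocycle a a (2 * b)
    have e3 := hF.cocycle b b a
    have e4 := hF.hom 2 a b (by norm_num)
    have e5 := hF.symm a b
    have e6 := hF.symm (2 * b) a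
    rw [show a + a = 2 * a by ring, e4] at e2
    rw [show b + b = 2 * b by ring, show b + a = a + b by ring] at e3
    rw [show b + (a + b) = a + 2 * b by ring] at e1
    linarith
  have hz : F 0 0 = 0 := hF.zero_right 0
  have hval : ∀ x : ℝ, F x x = sgn x * |x| ^ h * F 1 1 := by
    intro x
    rcases lt_trichotomy x 0 with hx | hx | hx
    · have e1 := hF.hom (-x) 1 1 (by linarith)
      have e2 := hF.hom (-x) (-1) (-1) (by linarith)
      have e3 : F (-1) (-1) = - F 1 1 := by
        have c1 := hF.cocycle 1 1 (-1)
        have c2 := hF.cocycle 2 (-1) (-1)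
        have c3 := hF.neg_right 2
        have c4 := hF.neg_right 1
        have c5 := hF.zero_right 1
        norm_num at c1 c2
        linarith
      rw [sgn, if_neg (by linarith), abs_of_neg hx]
      norm_num at e2
      rw [e2, e3]; ring
    · subst hx
      simp [hz, Real.zero_rpow h0.ne']
    · have e1 := hF.hom x 1 1 hx
      rw [sgn, if_pos hx.le, abs_of_pos hx]
      norm_num at e1
      rw [e1]; ring
  rw [hval (a + b), hval a, hval b] at key
  field_simp
  linarith

lemma IsHomCocycle.neg_neg {h : ℝ} {F : ℝ → ℝ → ℝ} (hF : IsHomCocycle h F) (a b : ℝ) :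
    F (-a) (-b) = -F a b := by
  have e1 := hF.cocycle a b (-b)
  have e2 := hF.cocycle (-b) (a + b) (-a - b)
  have e3 := hF.cocycle a (-a - b) b
  have s1 := hF.symm (-b) (a + b)
  have s2 := hF.symm a (-a - b)
  have s3 := hF.neg_right b
  have s4 := hF.neg_right a
  have s5 := hF.neg_right (a + b)
  have s6 := hF.symm (-b) (-a)
  have s7 := hF.zero_right a
  have s8 := hF.zero_right (-b)
  have s9 := hF.symm (-a - b) b
  have e4 := hF.cocycle (-a) (-b) b
  have s10 := hF.zero_right (-a)
  have s11 := hF.neg_right (-b)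
  have e5 := hF.cocycle b a (-a - b)
  have e6 := hF.cocycle (-a - b) a b
  ring_nf at *
  linarith

/-- A degree one homogeneous cocycle with `F 1 1 = 0` and `F 1` continuous vanishes. On the natural
numbers `F` is the coboundary of `f n = ∑ k < n, F 1 k`. Splitting off the leading binary digit
bounds `f n / n`, while homogeneity makes `n ↦ f n / n` completely additive; hence `f = 0`. -/
lemma IsHomCocycle.eq_zero_of_one {F : ℝ → ℝ → ℝ} (hF : IsHomCocycle 1 F)
    (hc : Continuous (F 1)) (h11 : F 1 1 = 0) (a b : ℝ) : F a b = 0 := by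
  have hom : ∀ c a b, 0 < c → F (c * a) (c * b) = c * F a b := fun c a b h => by
    rw [hF.hom c a b h, Real.rpow_one]
  obtain ⟨f, hf⟩ : ∃ f : ℕ → ℝ, ∀ n, f n = ∑ k ∈ Finset.range n, F 1 k := ⟨_, fun _ => rfl⟩
  have f0 : f 0 = 0 := by simp [hf]
  have fs : ∀ n, f (n + 1) = f n + F 1 n := fun n => by
    rw [hf, hf, Finset.sum_range_succ]
  have f1 : f 1 = 0 := by rw [fs, f0]; simp [hF.zero_right]
  -- `f` is a primitive of `F` on the natural numbers.
  have fadd : ∀ m n : ℕ, f (m + n) = f m + f n + F m n := by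
    intro m n
    induction n with
    | zero => simp [f0, hF.zero_right]
    | succ n ih =>
      rw [← add_assoc, fs, ih, fs]
      have e := hF.cocycle m n 1
      rw [hF.symm _ 1, hF.symm _ 1] at e
      push_cast
      linarith
  -- Homogeneity turns `f n / n` into a completely additive function.
  have fmul : ∀ m n : ℕ, f (m * n) = m * f n + n * f m := by
    intro m n
    rcases Nat.eq_zero_or_pos n with rfl | hn
    · simp [f0]
    induction m with
    | zero => simp [f0]
    | succ m ih =>
      rw [add_mul, one_mul, fadd, ih, fs]
      have e := hom n m 1 (by exact_mod_cast hn)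
      rw [hF.symm m 1, mul_one] at e
      push_cast
      rw [mul_comm (m : ℝ) n, e]
      ring
  have fpow : ∀ n k : ℕ, 0 < n → f (n ^ k) * n = k * (n : ℝ) ^ k * f n := by
    intro n k hn
    induction k with
    | zero => simp [f1]
    | succ k ih =>
      rw [pow_succ, fmul, add_mul]
      push_cast
      have : (n : ℝ) * f (n ^ k) * n = n * (k * (n : ℝ) ^ k * f n) := by rw [← ih]; ring
      rw [this]; ring
  have f2 : ∀ k : ℕ, f (2 ^ k) = 0 := by
    intro k
    have h := fpow 2 k (by norm_num)
    have : f 2 = 0 := by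
      have e := fs 1
      push_cast at e
      rw [f1, h11] at e
      simpa using e
    rw [this] at h
    simpa using h
  obtain ⟨M, hM⟩ : ∃ M, ∀ x ∈ Set.Icc (0 : ℝ) 1, |F 1 x| ≤ M := by
    obtain ⟨M, hM⟩ := isCompact_Icc.exists_bound_of_continuousOn hc.continuousOn
    exact ⟨M, fun x hx => by simpa using hM x hx⟩
  have M0 : 0 ≤ M := (abs_nonneg _).trans (hM 0 (by simp))
  -- Splitting off the leading binary digit, where `f` vanishes, costs at most `2 ^ k * M`.
  have fbd : ∀ n : ℕ, |f n| ≤ 2 * M * n := by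
    intro n
    induction n using Nat.strong_induction_on with
    | _ n ih =>
      rcases Nat.eq_zero_or_pos n with rfl | hn
      · simp [f0]
      obtain ⟨k, m, hk, hm⟩ : ∃ k m : ℕ, n = 2 ^ k + m ∧ m < 2 ^ k := by
        refine ⟨Nat.log 2 n, n - 2 ^ Nat.log 2 n, ?_, ?_⟩
        · have := Nat.pow_log_le_self 2 hn.ne'
          omega
        · have := Nat.lt_pow_succ_log_self (b := 2) (by norm_num) n
          rw [pow_succ] at this
          omega
      have e := ih m (by omega)
      have hp : (0 : ℝ) < 2 ^ k := by positivity
      have e2 : F ((2 ^ k : ℕ) : ℝ) m = 2 ^ k * F 1 (m / 2 ^ k) := by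
        rw [← hom _ _ _ hp]
        congr 1
        · push_cast; ring
        · field_simp
      have hm' : (m : ℝ) < 2 ^ k := by exact_mod_cast hm
      have e3 := hM (m / 2 ^ k) ⟨by positivity, by rw [div_le_one hp]; exact hm'.le⟩
      rw [hk, fadd, f2, e2, zero_add]
      push_cast
      calc |f m + 2 ^ k * F 1 (m / 2 ^ k)| ≤ |f m| + |2 ^ k * F 1 (m / 2 ^ k)| := abs_add_le _ _
        _ ≤ 2 * M * m + 2 ^ k * M := by
            rw [abs_mul, abs_of_pos hp]
            gcongr
        _ ≤ 2 * M * (2 ^ k + m) := by nlinarith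
  -- `f (n ^ k) / n ^ k = k * (f n / n)` stays bounded in `k`, which forces `f n = 0`.
  have fz : ∀ n : ℕ, f n = 0 := by
    intro n
    rcases Nat.eq_zero_or_pos n with rfl | hn
    · exact f0
    by_contra hne
    obtain ⟨k, hk⟩ := exists_nat_gt (2 * M * n / |f n|)
    rw [div_lt_iff₀ (abs_pos.2 hne)] at hk
    have hn' : (0 : ℝ) < n := by exact_mod_cast hn
    have e := congrArg abs (fpow n k hn)
    rw [abs_mul, abs_mul, abs_of_pos hn', abs_of_nonneg (by positivity : (0 : ℝ) ≤ k * n ^ k)] at e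
    have e2 := fbd (n ^ k)
    push_cast at e2
    have hp : (0 : ℝ) < n ^ k := by positivity
    have : (n : ℝ) ^ k * (k * |f n|) ≤ n ^ k * (2 * M * n) := by nlinarith
    exact absurd (le_of_mul_le_mul_left this hp) (not_le.2 hk)
  have hrat : ∀ q : ℚ, 0 ≤ q → F 1 q = 0 := by
    intro q hq
    have e := fadd q.den q.num.toNat
    rw [fz, fz, fz] at e
    have hd : (0 : ℝ) < q.den := by exact_mod_cast q.den_pos
    have e2 := hom q.den 1 q hd
    have e3 : (q.den : ℝ) * q = (q.num.toNat : ℝ) := by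
      have h1 : ((q.num.toNat : ℤ) : ℝ) = (q.num : ℝ) := by
        rw [Int.toNat_of_nonneg (Rat.num_nonneg.2 hq)]
      rw [Int.cast_natCast] at h1
      rw [h1, mul_comm]
      exact_mod_cast Rat.mul_den_eq_num q
    rw [mul_one, e3] at e2
    have : (q.den : ℝ) * F 1 q = 0 := by linarith
    exact (mul_eq_zero.1 this).resolve_left hd.ne'
  have hreal : ∀ x : ℝ, 0 ≤ x → F 1 x = 0 := by
    intro x hx
    have : (fun y : ℝ => F 1 |y|) = fun _ => 0 := by
      refine Continuous.ext_on Rat.denseRange_cast (by fun_prop) continuous_const ?_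
      rintro _ ⟨q, rfl⟩
      have := hrat |q| (abs_nonneg q)
      push_cast at this
      exact this
    have := congrFun this x
    simpa [abs_of_nonneg hx] using this
  have hpos : ∀ a b : ℝ, 0 ≤ a → 0 ≤ b → F a b = 0 := by
    intro a b ha hb
    rcases ha.eq_or_lt with rfl | ha
    · rw [hF.symm, hF.zero_right]
    · have e := hom a 1 (b / a) ha
      rw [hreal _ (by positivity), mul_one, mul_div_cancel₀ _ ha.ne'] at e
      simpa using e
  have hmix : ∀ a b : ℝ, 0 ≤ a → b ≤ 0 → 0 ≤ a + b → F a b = 0 := by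
    intro a b ha hb hab
    have e := hF.cocycle a b (-b)
    rw [hpos (a + b) (-b) hab (by linarith), hF.neg_right, add_neg_cancel, hF.zero_right] at e
    linarith
  have hgen : ∀ a b : ℝ, 0 ≤ a + b → F a b = 0 := by
    intro a b hab
    rcases le_total 0 a with ha | ha <;> rcases le_total 0 b with hb | hb
    · exact hpos a b ha hb
    · exact hmix a b ha hb hab
    · rw [hF.symm]; exact hmix b a hb ha (by linarith)
    · rw [show a = 0 by linarith, show b = 0 by linarith, hF.zero_right]
  rcases le_total 0 (a + b) with hab | hab
  · exact hgen a b hab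
  · have e := hF.neg_neg (-a) (-b)
    rw [_root_.neg_neg, _root_.neg_neg, hgen (-a) (-b) (by linarith)] at e
    simpa using e

/-- In degree `1` a homogeneous cocycle that is continuous along `F 1` is a multiple of the
coboundary of `x ↦ x log |x|`. -/
lemma IsHomCocycle.eq_coboundary_log {F : ℝ → ℝ → ℝ} (hF : IsHomCocycle 1 F)
    (hc : Continuous (F 1)) (a b : ℝ) :
    F a b = F 1 1 / (2 * Real.log 2) *
      ((a + b) * Real.log |a + b| - a * Real.log |a| - b * Real.log |b|) := by
  have hl : Real.log 2 ≠ 0 := (Real.log_pos (by norm_num)).ne'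
  obtain ⟨κ, hκ⟩ : ∃ κ, κ = F 1 1 / (2 * Real.log 2) := ⟨_, rfl⟩
  have hG : IsHomCocycle 1 (fun a b => F a b - κ *
      ((a + b) * Real.log |a + b| - a * Real.log |a| - b * Real.log |b|)) := by
    refine ⟨fun a b => ?_, fun a b c => ?_, fun c a b hc => ?_, fun a => ?_, fun a => ?_⟩
    · rw [hF.symm, add_comm a b]; ring
    · have := hF.cocycle a b c
      rw [add_assoc]; linarith
    · have hlog : ∀ x : ℝ, c * x * Real.log |c * x| = c * (x * Real.log |x| + x * Real.log c) := by
        intro x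
        rcases eq_or_ne x 0 with rfl | hx
        · simp
        · rw [abs_mul, abs_of_pos hc, Real.log_mul hc.ne' (abs_ne_zero.2 hx)]; ring
      rw [hF.hom c a b hc, Real.rpow_one, ← mul_add, hlog, hlog, hlog]
      ring
    · simp [hF.zero_right]
    · simp [hF.neg_right]
  have := hG.eq_zero_of_one ?_ ?_ a b
  · rw [← hκ]; linarith
  · simp only [Real.log_abs]
    have h1 : Continuous fun b : ℝ => (1 + b) * Real.log (1 + b) :=
      Real.continuous_mul_log.comp (continuous_const.add continuous_id)
    have h2 := Real.continuous_mul_log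
    exact hc.sub (continuous_const.mul ((h1.sub continuous_const).sub h2))
  · rw [hκ]; norm_num

/-! ### Covariances of self-similar processes with stationary increments -/

/-- The identities satisfied by `C t s = Cov (X t) (Z s)` when `(X, Z)` vanishes at time `0`, is
jointly self-similar with exponents of sum `h`, and has jointly stationary increments. -/
structure IsSelfSimilarCov (h : ℝ) (C : ℝ → ℝ → ℝ) : Prop where
  zero_left : ∀ s, C 0 s = 0
  zero_right : ∀ t, C t 0 = 0
  incr : ∀ r t s, C (t + r) (s + r) - C (t + r) r - C r (s + r) + C r r = C t s
  hom : ∀ c t s, 0 < c → C (c * t) (c * s) = c ^ h * C t s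

lemma IsSelfSimilarCov.diag {h : ℝ} {C : ℝ → ℝ → ℝ} (hC : IsSelfSimilarCov h C) (h0 : 0 < h)
    (t : ℝ) : C t t = C 1 1 * |t| ^ h := by
  rcases lt_trichotomy t 0 with ht | rfl | ht
  · have e := hC.hom (-t) (-1) (-1) (by linarith)
    have e2 := hC.incr 1 (-1) (-1)
    norm_num at e e2
    rw [hC.zero_left, hC.zero_left, hC.zero_right] at e2
    rw [abs_of_neg ht, e, ← e2]; ring
  · simp [hC.zero_left, Real.zero_rpow h0.ne']
  · have e := hC.hom t 1 1 ht
    norm_num at e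
    rw [abs_of_pos ht, e]; ring

/-- The symmetric part of the covariance is determined by the diagonal. -/
lemma IsSelfSimilarCov.add_swap {h : ℝ} {C : ℝ → ℝ → ℝ} (hC : IsSelfSimilarCov h C) (h0 : 0 < h)
    (t s : ℝ) : C t s + C s t = C 1 1 * (|t| ^ h + |s| ^ h - |t - s| ^ h) := by
  have e := hC.incr s (t - s) (t - s)
  rw [sub_add_cancel, hC.diag h0 t, hC.diag h0 s, hC.diag h0 (t - s)] at e
  linarith

/-- The antisymmetric part of the covariance is a homogeneous cocycle. Its symmetry follows from
homogeneity: the antisymmetrisation of a 2-cocycle is biadditive, hence scales by `4 ≠ 2 ^ h`. -/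
lemma IsSelfSimilarCov.isHomCocycle {h : ℝ} {C : ℝ → ℝ → ℝ} (hC : IsSelfSimilarCov h C)
    (h2 : h < 2) : IsHomCocycle h (fun a b => C (a + b) b - C b (a + b)) := by
  obtain ⟨F, hF⟩ : ∃ F : ℝ → ℝ → ℝ, ∀ a b, F a b = C (a + b) b - C b (a + b) :=
    ⟨_, fun _ _ => rfl⟩
  have hco : ∀ a b c, F a b + F (a + b) c = F a (b + c) + F b c := by
    intro a b c
    have e1 := hC.incr c (a + b) b
    have e2 := hC.incr c b (a + b)
    simp only [hF]
    rw [← add_assoc]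
    linarith
  have hhom : ∀ c a b, 0 < c → F (c * a) (c * b) = c ^ h * F a b := by
    intro c a b hc
    simp only [hF]
    rw [← mul_add, hC.hom _ _ _ hc, hC.hom _ _ _ hc]; ring
  -- The antisymmetrisation of a 2-cocycle on an abelian group is biadditive.
  have hadd : ∀ a b c, F (a + b) c - F c (a + b) = (F a c - F c a) + (F b c - F c b) := by
    intro a b c
    have e1 := hco a b c
    have e2 := hco c a b
    have e3 := hco a c b
    rw [add_comm c b] at e3
    rw [add_comm c a] at e2
    linarith
  have hsymm : ∀ a b, F a b = F b a := by
    intro a b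
    have e1 := hadd a a (b + b)
    have e2 := hadd b b a
    have e3 := hhom 2 a b (by norm_num)
    have e4 := hhom 2 b a (by norm_num)
    rw [two_mul, two_mul] at e3 e4
    have h4 : (2 : ℝ) ^ h < 4 := by
      have : (2 : ℝ) ^ h < 2 ^ (2 : ℝ) := Real.rpow_lt_rpow_of_exponent_lt (by norm_num) h2
      norm_num at this
      exact this
    have : (4 - (2 : ℝ) ^ h) * (F a b - F b a) = 0 := by linarith
    rcases mul_eq_zero.1 this with h | h <;> linarith
  simp only [← hF]
  refine ⟨hsymm, hco, hhom, fun a => ?_, fun a => ?_⟩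
  · simp [hF, hC.zero_left, hC.zero_right]
  · simp [hF, hC.zero_left, hC.zero_right]

lemma sgn_mul_rpow_neg {h : ℝ} (h0 : 0 < h) (x : ℝ) :
    sgn (-x) * |-x| ^ h = -(sgn x * |x| ^ h) := by
  rcases lt_trichotomy x 0 with hx | rfl | hx
  · rw [sgn, sgn, if_pos (by linarith), if_neg (by linarith), abs_neg]; ring
  · simp [Real.zero_rpow h0.ne']
  · rw [sgn, sgn, if_neg (by linarith), if_pos (by linarith), abs_neg]; ring

lemma IsSelfSimilarCov.eq_of_ne {h : ℝ} {C : ℝ → ℝ → ℝ} (hC : IsSelfSimilarCov h C) (h0 : 0 < h)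
    (h2 : h < 2) (h1 : h ≠ 1) {ρ η : ℝ} (hρ : ρ = C 1 1)
    (hη : η = (C 2 1 - C 1 2) / (2 ^ h - 2)) (t s : ℝ) :
    C t s = ((ρ + sgn t * η) * |t| ^ h + (ρ - sgn s * η) * |s| ^ h
        - (ρ - sgn (s - t) * η) * |s - t| ^ h) / 2 := by
  have e := (hC.isHomCocycle h2).eq_coboundary h0 h1 (t - s) s
  have e2 := hC.add_swap h0 t s
  have e3 := sgn_mul_rpow_neg h0 (s - t)
  norm_num at e
  rw [← hη] at e
  rw [neg_sub] at e3
  rw [abs_sub_comm t s] at e e2 e3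
  rw [← hρ] at e2
  have : C t s = ((C t s + C s t) + (C t s - C s t)) / 2 := by ring
  rw [this, e, e2, e3]
  ring

lemma IsSelfSimilarCov.eq_of_eq {C : ℝ → ℝ → ℝ} (hC : IsSelfSimilarCov 1 C)
    (hc : Continuous fun b => C (1 + b) b - C b (1 + b)) {ρ η : ℝ} (hρ : ρ = C 1 1)
    (hη : η = -((C 2 1 - C 1 2) / (2 * Real.log 2))) (t s : ℝ) :
    C t s = (ρ * (|s| + |t| - |s - t|)
        + η * (s * Real.log |s| - t * Real.log |t| - (s - t) * Real.log |s - t|)) / 2 := by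
  have e := (hC.isHomCocycle (by norm_num)).eq_coboundary_log hc (t - s) s
  have e2 := hC.add_swap (by norm_num) t s
  norm_num at e
  simp only [Real.rpow_one] at e2
  rw [show Real.log (t - s) = Real.log (s - t) by rw [← Real.log_abs, abs_sub_comm, Real.log_abs],
    show (C 2 1 - C 1 2) / (2 * Real.log 2) = -η by rw [hη]; ring] at e
  rw [abs_sub_comm t s, ← hρ] at e2
  simp only [Real.log_abs]
  linarith

/-! ### Almost sure limits of centered Gaussian variables -/

section GaussianLimits

variable {Ω : Type*} [MeasurableSpace Ω] {μ : Measure Ω}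

/-- A real random variable with a (possibly degenerate) centered Gaussian law. -/
structure IsCenteredGaussian (X : Ω → ℝ) (μ : Measure Ω) : Prop where
  gaussian : HasGaussianLaw X μ
  mean : ∫ ω, X ω ∂μ = 0

lemma IsCenteredGaussian.memLp {X : Ω → ℝ} (hX : IsCenteredGaussian X μ) : MemLp X 2 μ :=
  hX.gaussian.memLp_two

lemma IsCenteredGaussian.integral_exp {X : Ω → ℝ} (hX : IsCenteredGaussian X μ) (t : ℝ) :
    ∫ ω, Complex.exp (t * X ω * Complex.I) ∂μ = (Real.exp (-(Var[X; μ] * t ^ 2 / 2)) : ℝ) := by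
  have h := charFun_gaussianReal (μ := 0) (v := Var[X; μ].toNNReal) t
  have h2 := hX.gaussian.map_eq_gaussianReal
  rw [hX.mean] at h2
  rw [← h2, charFun_apply_real, integral_map hX.gaussian.aemeasurable
    (by fun_prop : Continuous _).aestronglyMeasurable] at h
  rw [h, Real.coe_toNNReal _ (variance_nonneg _ _)]
  push_cast
  congr 1
  simp

/-- The almost sure limits of sequences from a linear space `V` of random variables. -/
def gaussianClosure (V : Submodule ℝ (Ω → ℝ)) (μ : Measure Ω) : Submodule ℝ (Ω → ℝ) where
  carrier := {X | ∃ L : ℕ → Ω → ℝ, (∀ n, L n ∈ V) ∧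
    ∀ᵐ ω ∂μ, Tendsto (fun n => L n ω) atTop (𝓝 (X ω))}
  add_mem' := by
    rintro X Z ⟨L, hL, h⟩ ⟨L', hL', h'⟩
    refine ⟨fun n => L n + L' n, fun n => V.add_mem (hL n) (hL' n), ?_⟩
    filter_upwards [h, h'] with ω hω hω' using hω.add hω'
  zero_mem' := ⟨fun _ => 0, fun _ => V.zero_mem, by simp⟩
  smul_mem' := by
    rintro c X ⟨L, hL, h⟩
    refine ⟨fun n => c • L n, fun n => V.smul_mem c (hL n), ?_⟩
    filter_upwards [h] with ω hω using hω.const_mul c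

lemma le_gaussianClosure (V : Submodule ℝ (Ω → ℝ)) : V ≤ gaussianClosure V μ :=
  fun X hX => ⟨fun _ => X, fun _ => hX, by simp⟩

variable [IsProbabilityMeasure μ]

/-- An almost sure limit of centered Gaussian variables is centered Gaussian, and the variances
converge: by dominated convergence the characteristic functions converge pointwise, and a nonzero
value of the limit near `0` pins the limit of the variances. -/
lemma IsCenteredGaussian.of_tendsto {Z : ℕ → Ω → ℝ} {W : Ω → ℝ}
    (hZ : ∀ n, IsCenteredGaussian (Z n) μ)
    (hlim : ∀ᵐ ω ∂μ, Tendsto (fun n => Z n ω) atTop (𝓝 (W ω))) :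
    IsCenteredGaussian W μ ∧ Tendsto (fun n => Var[Z n; μ]) atTop (𝓝 Var[W; μ]) := by
  have hm : ∀ n, AEMeasurable (Z n) μ := fun n => (hZ n).gaussian.aemeasurable
  have hW : AEMeasurable W μ := aemeasurable_of_tendsto_metrizable_ae atTop hm hlim
  obtain ⟨φ, hφ⟩ : ∃ φ : ℝ → ℂ, ∀ t, φ t = ∫ ω, Complex.exp (t * W ω * Complex.I) ∂μ :=
    ⟨_, fun _ => rfl⟩
  have hnorm : ∀ t x : ℝ, ‖Complex.exp (t * x * Complex.I)‖ ≤ 1 := fun t x => by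
    rw [← Complex.ofReal_mul, Complex.norm_exp_ofReal_mul_I]
  have hconv : ∀ t : ℝ, Tendsto (fun n => ((Real.exp (-(Var[Z n; μ] * t ^ 2 / 2)) : ℝ) : ℂ))
      atTop (𝓝 (φ t)) := by
    intro t
    simp_rw [← fun n => (hZ n).integral_exp t]
    rw [hφ]
    refine tendsto_integral_of_dominated_convergence (fun _ => 1) (fun n => ?_)
      (integrable_const _) (fun n => ae_of_all _ fun ω => hnorm _ _) ?_
    · have := hm n
      exact (by fun_prop : AEMeasurable _ μ).aestronglyMeasurable
    · filter_upwards [hlim] with ω hω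
      exact (Complex.continuous_exp.tendsto _).comp
        ((((Complex.continuous_ofReal.tendsto _).comp hω).const_mul _).mul_const _)
  obtain ⟨t, ht, hφt⟩ : ∃ t : ℝ, t ≠ 0 ∧ φ t ≠ 0 := by
    have h0 : Tendsto (fun m : ℕ => φ (1 / ((m : ℝ) + 1))) atTop (𝓝 1) := by
      have : (1 : ℂ) = ∫ ω, (1 : ℂ) ∂μ := by simp
      rw [this]
      simp_rw [hφ]
      refine tendsto_integral_of_dominated_convergence (fun _ => 1) (fun n => ?_)
        (integrable_const _) (fun n => ae_of_all _ fun ω => hnorm _ _) (ae_of_all _ fun ω => ?_)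
      · exact (by fun_prop : AEMeasurable _ μ).aestronglyMeasurable
      · have h1 : Tendsto (fun m : ℕ => 1 / ((m : ℝ) + 1)) atTop (𝓝 0) :=
          tendsto_one_div_add_atTop_nhds_zero_nat
        have h2 := (Complex.continuous_exp.tendsto _).comp
          ((((Complex.continuous_ofReal.tendsto _).comp h1).mul_const (W ω : ℂ)).mul_const
            Complex.I)
        simpa [Function.comp_def] using h2
    obtain ⟨m, hm⟩ := (h0.eventually_ne one_ne_zero).exists
    exact ⟨_, by positivity, hm⟩
  obtain ⟨v, hv⟩ : ∃ v : ℝ, Tendsto (fun n => Var[Z n; μ]) atTop (𝓝 v) := by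
    have h1 := (continuous_norm.tendsto _).comp (hconv t)
    have h2 := ((Real.continuousAt_log (norm_ne_zero_iff.2 hφt)).tendsto.comp h1).mul_const
      (-2 / t ^ 2)
    refine ⟨_, h2.congr fun n => ?_⟩
    simp only [Function.comp, Complex.norm_real, Real.norm_eq_abs, Real.abs_exp, Real.log_exp]
    field_simp
  have hv0 : 0 ≤ v := ge_of_tendsto' hv fun n => variance_nonneg _ _
  have hlaw : μ.map W = gaussianReal 0 v.toNNReal := by
    have := Measure.isProbabilityMeasure_map (μ := μ) hW
    refine Measure.ext_of_charFun (funext fun s => ?_)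
    rw [charFun_gaussianReal, charFun_apply_real, integral_map hW
      (by fun_prop : Continuous _).aestronglyMeasurable, ← hφ,
      Real.coe_toNNReal _ hv0]
    refine tendsto_nhds_unique (hconv s) ?_
    have h1 : Tendsto (fun n => Real.exp (-(Var[Z n; μ] * s ^ 2 / 2))) atTop
        (𝓝 (Real.exp (-(v * s ^ 2 / 2)))) :=
      (Real.continuous_exp.tendsto _).comp ((hv.mul_const _).div_const _).neg
    have h2 := (Complex.continuous_ofReal.tendsto _).comp h1
    have h3 : Complex.exp (s * ((0 : ℝ) : ℂ) * Complex.I - (v : ℂ) * s ^ 2 / 2) =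
        ((Real.exp (-(v * s ^ 2 / 2)) : ℝ) : ℂ) := by
      push_cast
      congr 1
      simp
    rw [h3]
    exact h2
  have hg : HasGaussianLaw W μ := ⟨by rw [hlaw]; infer_instance⟩
  have hmean : ∫ ω, W ω ∂μ = 0 := by
    have := integral_map (μ := μ) hW (f := fun x : ℝ => x) (by fun_prop)
    rw [← this, hlaw]
    exact integral_id_gaussianReal
  have hvar : Var[W; μ] = v := by
    have := variance_map (μ := μ) (X := fun x : ℝ => x) (by fun_prop) hW
    rw [hlaw] at this
    have h2 := variance_fun_id_gaussianReal (μ := 0) (v := v.toNNReal)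
    rw [this, Real.coe_toNNReal _ hv0] at h2
    exact h2
  exact ⟨⟨hg, hmean⟩, by rw [hvar]; exact hv⟩

variable {V : Submodule ℝ (Ω → ℝ)}

lemma isCenteredGaussian_of_mem_closure (hV : ∀ L ∈ V, IsCenteredGaussian L μ) {X : Ω → ℝ}
    (hX : X ∈ gaussianClosure V μ) : IsCenteredGaussian X μ := by
  obtain ⟨L, hL, h⟩ := hX
  exact (IsCenteredGaussian.of_tendsto (fun n => hV _ (hL n)) h).1

/-- Covariances pass to almost sure limits within the Gaussian closure, by polarisation. -/
lemma tendsto_covariance_of_mem_closure (hV : ∀ L ∈ V, IsCenteredGaussian L μ) {X W : Ω → ℝ}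
    (hX : X ∈ gaussianClosure V μ) {Z : ℕ → Ω → ℝ} (hZ : ∀ n, Z n ∈ gaussianClosure V μ)
    (hlim : ∀ᵐ ω ∂μ, Tendsto (fun n => Z n ω) atTop (𝓝 (W ω))) :
    Tendsto (fun n => cov[X, Z n; μ]) atTop (𝓝 cov[X, W; μ]) := by
  have hG : ∀ {X : Ω → ℝ}, X ∈ gaussianClosure V μ → IsCenteredGaussian X μ :=
    isCenteredGaussian_of_mem_closure hV
  obtain ⟨hW, h1⟩ := IsCenteredGaussian.of_tendsto (fun n => hG (hZ n)) hlim
  have h2 := (IsCenteredGaussian.of_tendsto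
    (fun n => hG ((gaussianClosure V μ).add_mem hX (hZ n))) (W := X + W) (by
      filter_upwards [hlim] with ω hω using hω.const_add _)).2
  have hpol : ∀ U : Ω → ℝ, MemLp U 2 μ →
      cov[X, U; μ] = (Var[X + U; μ] - Var[X; μ] - Var[U; μ]) / 2 := fun U hU => by
    rw [variance_add (hG hX).memLp hU]; ring
  rw [hpol W hW.memLp]
  simp_rw [fun n => hpol (Z n) (hG (hZ n)).memLp]
  exact ((h2.sub_const _).sub h1).div_const _

end GaussianLimits

/-! ### Gaussian vectors and processes -/

/-- The linear span of the coordinates of a vector-valued process. -/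
def processSpan {Ω : Type*} {d : ℕ} (B : ℝ → Ω → Fin d → ℝ) : Submodule ℝ (Ω → ℝ) :=
  Submodule.span ℝ (Set.range fun p : ℝ × Fin d => fun ω => B p.1 ω p.2)

lemma coord_mem_processSpan {Ω : Type*} {d : ℕ} (B : ℝ → Ω → Fin d → ℝ) (t : ℝ) (i : Fin d) :
    (fun ω => B t ω i) ∈ processSpan B := Submodule.subset_span ⟨(t, i), rfl⟩

lemma exists_dual_eq_sum_prod {ι κ : Type*} [Fintype ι] [Fintype κ]
    (L : StrongDual ℝ (ι → κ → ℝ)) :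
    ∃ c : ι × κ → ℝ, ∀ x, L x = ∑ p, c p * x p.1 p.2 := by
  classical
  refine ⟨fun p => L (Pi.single p.1 (Pi.single p.2 1)), fun x => ?_⟩
  have : x = ∑ p : ι × κ, x p.1 p.2 • (Pi.single p.1 (Pi.single p.2 1)) := by
    rw [Fintype.sum_prod_type]
    ext s i
    simp [Finset.sum_apply, Pi.single_apply, apply_ite, ite_apply, Finset.sum_ite_eq]
  conv_lhs => rw [this, map_sum]
  simp [mul_comm]

section GaussianVectors

variable {Ω : Type*} [MeasurableSpace Ω] {μ : Measure Ω}

lemma hasGaussianLaw_of_forall_dual {E : Type*} [NormedAddCommGroup E] [NormedSpace ℝ E]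
    [MeasurableSpace E] [BorelSpace E] {X : Ω → E} (hX : AEMeasurable X μ)
    (h : ∀ L : StrongDual ℝ E, HasGaussianLaw (fun ω => L (X ω)) μ) : HasGaussianLaw X μ := by
  refine ⟨isGaussian_of_isGaussian_map fun L => ?_⟩
  have := (h L).isGaussian_map
  rwa [AEMeasurable.map_map_of_aemeasurable (by fun_prop) hX]

lemma isCenteredGaussian_of_mem_processSpan {d : ℕ} {B : ℝ → Ω → Fin d → ℝ}
    (hB : IsGaussianProcess B μ) (h0 : ∀ t i, ∫ ω, B t ω i ∂μ = 0) {X : Ω → ℝ}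
    (hX : X ∈ processSpan B) : IsCenteredGaussian X μ := by
  obtain ⟨c, rfl⟩ := (Finsupp.mem_span_range_iff_exists_finsupp).1 hX
  have hint : ∀ p : ℝ × Fin d, Integrable (fun ω => B p.1 ω p.2) μ := fun p =>
    ((hB.hasGaussianLaw_eval p.1).map_of_measurable (ContinuousLinearMap.proj (R := ℝ) p.2)
      (measurable_pi_apply p.2)).integrable
  have hsum : ∀ ω, (c.sum fun p a => a • fun ω => B p.1 ω p.2) ω
      = ∑ p ∈ c.support, c p * B p.1 ω p.2 := fun ω => by
    simp [Finsupp.sum, Finset.sum_apply]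
  constructor
  · classical
    obtain ⟨I, hI⟩ : ∃ I : Finset ℝ, I = c.support.image Prod.fst := ⟨_, rfl⟩
    have hmem : ∀ p : c.support, p.1.1 ∈ I := fun p => by
      rw [hI]; exact Finset.mem_image_of_mem _ p.2
    let L : ((I → Fin d → ℝ)) →L[ℝ] ℝ := ∑ p : c.support,
      c p.1 • ((ContinuousLinearMap.proj (R := ℝ) (φ := fun _ : Fin d => ℝ) p.1.2).comp
        (ContinuousLinearMap.proj (R := ℝ) (φ := fun _ : I => Fin d → ℝ) ⟨p.1.1, hmem p⟩))
    have := (hB.hasGaussianLaw I).map_fun L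
    refine this.congr (ae_of_all _ fun ω => ?_)
    rw [hsum, ← Finset.sum_coe_sort]
    simp [L]
  · simp_rw [hsum]
    rw [integral_finsetSum _ fun p _ => (hint p).const_mul _]
    simp [integral_const_mul, h0]

variable [IsProbabilityMeasure μ]

/-- Two Gaussian vectors whose linear functionals have equal means and variances have the same
law. -/
lemma identDistrib_of_hasGaussianLaw {E : Type*} [NormedAddCommGroup E] [NormedSpace ℝ E]
    [MeasurableSpace E] [BorelSpace E] [SecondCountableTopology E] [CompleteSpace E]
    {X Z : Ω → E} (hX : HasGaussianLaw X μ) (hZ : HasGaussianLaw Z μ)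
    (hm : ∀ L : StrongDual ℝ E, ∫ ω, L (X ω) ∂μ = ∫ ω, L (Z ω) ∂μ)
    (hv : ∀ L : StrongDual ℝ E, Var[fun ω => L (X ω); μ] = Var[fun ω => L (Z ω); μ]) :
    IdentDistrib X Z μ μ := by
  refine ⟨hX.aemeasurable, hZ.aemeasurable, ?_⟩
  have := hX.isGaussian_map
  have := hZ.isGaussian_map
  refine Measure.ext_of_charFunDual (funext fun L => ?_)
  rw [hX.charFunDual_map_eq_fun, hZ.charFunDual_map_eq_fun, hm, hv]

end GaussianVectors

/-! ### Riemann-Stieltjes integrals against a continuous function -/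

/-- Integration by parts: a continuously differentiable function is Riemann-Stieltjes integrable
against any continuous function. -/
lemma hasRSIntegral_of_hasDerivAt {f f' g : ℝ → ℝ} (hf : ∀ x, HasDerivAt f (f' x) x)
    (hf' : Continuous f') (hg : Continuous g) {a b : ℝ} (hab : a ≤ b) :
    HasRSIntegral f g a b (f b * g b - f a * g a - ∫ u in a..b, f' u * g u) := by
  intro ε hε
  obtain ⟨M, hM⟩ := (isCompact_Icc (a := a) (b := b)).exists_bound_of_continuousOn hf'.continuousOn
  have hM0 : 0 ≤ M := (norm_nonneg _).trans (hM a ⟨le_rfl, hab⟩)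
  obtain ⟨e, he, heM⟩ : ∃ e : ℝ, 0 < e ∧ M * e * (b - a) < ε := by
    refine ⟨ε / (M * (b - a) + 1), ?_, ?_⟩
    · have : 0 ≤ M * (b - a) := mul_nonneg hM0 (by linarith)
      positivity
    · have h1 : 0 ≤ M * (b - a) := mul_nonneg hM0 (by linarith)
      rw [show M * (ε / (M * (b - a) + 1)) * (b - a) = ε * (M * (b - a)) / (M * (b - a) + 1) by ring,
        div_lt_iff₀ (by linarith)]
      nlinarith
  obtain ⟨δ, hδ, hu⟩ := Metric.uniformContinuousOn_iff.1
    ((isCompact_Icc (a := a) (b := b)).uniformContinuousOn_of_continuous hg.continuousOn) e he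
  refine ⟨δ, hδ, fun n x ξ hx0 hxn hx hξ => ?_⟩
  obtain ⟨Φ, hΦ⟩ : ∃ Φ : ℝ → ℝ, ∀ y, Φ y = f y * g y - f a * g a - ∫ u in a..y, f' u * g u :=
    ⟨_, fun _ => rfl⟩
  have hmono : ∀ k l, k ≤ l → l ≤ n → x k ≤ x l := by
    intro k l hkl
    induction l, hkl using Nat.le_induction with
    | base => exact fun _ => le_rfl
    | succ l _ ih => exact fun h => (ih (by omega)).trans (hx l (by omega)).1
  have hfc : Continuous f := continuous_iff_continuousAt.2 fun y => (hf y).continuousAt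
  have hterm : ∀ k ∈ Finset.range n, |f (ξ k) * (g (x (k + 1)) - g (x k)) -
      (Φ (x (k + 1)) - Φ (x k))| ≤ M * e * (x (k + 1) - x k) := by
    intro k hk
    rw [Finset.mem_range] at hk
    obtain ⟨h1, h2⟩ := hξ k hk
    have ha : a ≤ x k := hx0 ▸ hmono 0 k (by omega) (by omega)
    have hb : x (k + 1) ≤ b := hxn ▸ hmono (k + 1) n (by omega) le_rfl
    have hd := (hx k hk).2
    have hi : ∀ (c : ℝ) (p q : ℝ), IntervalIntegrable (fun u => f' u * (g u - c)) volume p q :=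
      fun c p q => (by fun_prop : Continuous _).intervalIntegrable _ _
    have hi2 : ∀ (p q : ℝ), IntervalIntegrable (fun u => f' u * g u) volume p q :=
      fun p q => (by fun_prop : Continuous _).intervalIntegrable _ _
    have hi3 : ∀ (p q : ℝ), IntervalIntegrable f' volume p q :=
      fun p q => hf'.intervalIntegrable _ _
    have hsplit : ∀ c p q : ℝ, ∫ u in p..q, f' u * (g u - c) =
        (∫ u in p..q, f' u * g u) - (f q - f p) * c := by
      intro c p q
      simp_rw [mul_sub]
      rw [intervalIntegral.integral_sub (hi2 p q) ((hi3 p q).mul_const c),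
        intervalIntegral.integral_mul_const,
        intervalIntegral.integral_eq_sub_of_hasDerivAt (fun y _ => hf y) (hi3 p q)]
    have hid : f (ξ k) * (g (x (k + 1)) - g (x k)) - (Φ (x (k + 1)) - Φ (x k)) =
        (∫ u in (x k)..(ξ k), f' u * (g u - g (x k))) +
          ∫ u in (ξ k)..(x (k + 1)), f' u * (g u - g (x (k + 1))) := by
      have i1 := intervalIntegral.integral_add_adjacent_intervals (hi2 a (x k)) (hi2 (x k) (ξ k))
      have i2 := intervalIntegral.integral_add_adjacent_intervals (hi2 a (ξ k))
        (hi2 (ξ k) (x (k + 1)))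
      rw [hsplit, hsplit, hΦ, hΦ, ← i2, ← i1]
      ring
    have hbd : ∀ c p q : ℝ, p ≤ q → x k ≤ p → q ≤ x (k + 1) → c ∈ Set.Icc (x k) (x (k + 1)) →
        |∫ u in p..q, f' u * (g u - g c)| ≤ M * e * (q - p) := by
      intro c p q hpq hp hq hc
      have := intervalIntegral.norm_integral_le_of_norm_le_const (a := p) (b := q) (C := M * e)
        (f := fun u => f' u * (g u - g c)) (fun u hu' => by
          rw [Set.uIoc_of_le hpq] at hu'
          rw [norm_mul]
          have hu1 : u ∈ Set.Icc a b := ⟨by linarith [hu'.1], by linarith [hu'.2]⟩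
          have hc1 : c ∈ Set.Icc a b := ⟨by linarith [hc.1], by linarith [hc.2]⟩
          have := hu u hu1 c hc1 (by
            rw [Real.dist_eq, abs_lt]
            constructor <;> linarith [hu'.1, hu'.2, hc.1, hc.2])
          rw [dist_eq_norm] at this
          exact mul_le_mul (hM u hu1) this.le (norm_nonneg _) hM0)
      rwa [abs_of_nonneg (by linarith : 0 ≤ q - p)] at this
    rw [hid]
    have b1 := hbd (x k) (x k) (ξ k) h1 le_rfl h2 ⟨le_rfl, h1.trans h2⟩
    have b2 := hbd (x (k + 1)) (ξ k) (x (k + 1)) h2 h1 le_rfl ⟨h1.trans h2, le_rfl⟩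
    calc _ ≤ _ := abs_add_le _ _
      _ ≤ M * e * (ξ k - x k) + M * e * (x (k + 1) - ξ k) := add_le_add b1 b2
      _ = _ := by ring
  have htel : f b * g b - f a * g a - ∫ u in a..b, f' u * g u =
      ∑ k ∈ Finset.range n, (Φ (x (k + 1)) - Φ (x k)) := by
    rw [Finset.sum_range_sub (fun k => Φ (x k)), hxn, hx0, hΦ, hΦ]
    simp
  rw [htel, ← Finset.sum_sub_distrib]
  calc _ ≤ _ := Finset.abs_sum_le_sum_abs _ _
    _ ≤ ∑ k ∈ Finset.range n, M * e * (x (k + 1) - x k) := Finset.sum_le_sum hterm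
    _ = M * e * (b - a) := by
      rw [← Finset.mul_sum, Finset.sum_range_sub, hxn, hx0]
    _ < ε := heM

lemma HasRSIntegral.unique {f g : ℝ → ℝ} {a b J J' : ℝ} (hab : a ≤ b)
    (h : HasRSIntegral f g a b J) (h' : HasRSIntegral f g a b J') : J = J' := by
  refine eq_of_forall_dist_le fun ε hε => ?_
  rw [Real.dist_eq]
  obtain ⟨δ, hδ, h1⟩ := h (ε / 2) (by linarith)
  obtain ⟨δ', hδ', h2⟩ := h' (ε / 2) (by linarith)
  obtain ⟨n, hn⟩ := exists_nat_gt ((b - a) / min δ δ')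
  have hm : 0 < min δ δ' := lt_min hδ hδ'
  have hn0 : (0 : ℝ) < n := lt_of_le_of_lt (div_nonneg (by linarith) hm.le) hn
  rw [div_lt_iff₀ hm] at hn
  have hstep : (b - a) / n < min δ δ' := by
    rw [div_lt_iff₀ hn0]; linarith
  obtain ⟨x, hx⟩ : ∃ x : ℕ → ℝ, ∀ k, x k = a + k * ((b - a) / n) := ⟨_, fun _ => rfl⟩
  have hs : ∀ k, x (k + 1) - x k = (b - a) / n := fun k => by
    rw [hx, hx]; push_cast; ring
  have hle : ∀ k, x k ≤ x (k + 1) := fun k => by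
    have := hs k
    have : 0 ≤ (b - a) / n := div_nonneg (by linarith) hn0.le
    linarith [hs k]
  have x0 : x 0 = a := by rw [hx]; simp
  have xn : x n = b := by rw [hx]; field_simp; ring
  have e1 := h1 n x x x0 xn (fun k _ => ⟨hle k, by rw [hs]; exact hstep.trans_le (min_le_left _ _)⟩)
    (fun k _ => ⟨le_rfl, hle k⟩)
  have e2 := h2 n x x x0 xn (fun k _ => ⟨hle k, by rw [hs]; exact hstep.trans_le (min_le_right _ _)⟩)
    (fun k _ => ⟨le_rfl, hle k⟩)
  rw [abs_lt] at e1 e2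
  rw [abs_le]
  constructor <;> linarith [e1.1, e1.2, e2.1, e2.2]

/-! ### The Ornstein-Uhlenbeck functional -/

/-- Continuous functions of at most quadratic growth: the class of paths and covariance functions
to which the Ornstein-Uhlenbeck functional is applied. -/
structure QuadGrowth (g : ℝ → ℝ) : Prop where
  continuous : Continuous g
  bound : ∃ K : ℝ, ∀ u, |g u| ≤ K * (1 + u ^ 2)

/-- The improper integral `∫_{-∞}^t e^{-a (t - s)} dg(s)`, written after integration by parts and
the substitution `y = t - s` as `g(t) - a ∫_0^∞ e^{-a y} g(t - y) dy`. -/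
noncomputable def ouFunctional (a t : ℝ) (g : ℝ → ℝ) : ℝ :=
  g t - a * ∫ y in Set.Ioi (0 : ℝ), Real.exp (-a * y) * g (t - y)

lemma abs_rpow_le_one_add_sq {h : ℝ} (h0 : 0 ≤ h) (h2 : h ≤ 2) (w : ℝ) : |w| ^ h ≤ 1 + w ^ 2 := by
  rcases le_total |w| 1 with hw | hw
  · have := Real.rpow_le_one (abs_nonneg w) hw h0
    nlinarith [sq_nonneg w]
  · have := Real.rpow_le_rpow_of_exponent_le hw h2
    rw [Real.rpow_two, sq_abs] at this
    linarith

lemma QuadGrowth.exp_bound {g : ℝ → ℝ} (hg : QuadGrowth g) {a : ℝ} (ha : 0 < a) (t : ℝ) :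
    ∃ C : ℝ, ∀ y, 0 ≤ y → |Real.exp (-a * y) * g (t - y)| ≤ C * Real.exp (-(a / 2) * y) := by
  obtain ⟨K, hK⟩ := hg.bound
  have hK0 : 0 ≤ K := by
    have := (abs_nonneg _).trans (hK 0)
    linarith
  refine ⟨K * (2 * (1 + t ^ 2) * (1 + 8 / a ^ 2)), fun y hy => ?_⟩
  have h1 := Real.quadratic_le_exp_of_nonneg (by positivity : 0 ≤ a / 2 * y)
  have h2 : 1 + (t - y) ^ 2 ≤ 2 * (1 + t ^ 2) * (1 + y ^ 2) := by
    nlinarith [sq_nonneg (t + y), sq_nonneg (t * y), sq_nonneg t, sq_nonneg y]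
  have h3 : 1 + y ^ 2 ≤ (1 + 8 / a ^ 2) * Real.exp (a / 2 * y) := by
    have : y ^ 2 = 8 / a ^ 2 * ((a / 2 * y) ^ 2 / 2) := by field_simp; ring
    have h4 : (a / 2 * y) ^ 2 / 2 ≤ Real.exp (a / 2 * y) := by
      have : 0 ≤ a / 2 * y := by positivity
      linarith
    have h5 : 1 ≤ Real.exp (a / 2 * y) := Real.one_le_exp (by positivity)
    have h6 : 0 ≤ 8 / a ^ 2 := by positivity
    rw [this]
    nlinarith
  have h4 : Real.exp (-(a / 2) * y) = Real.exp (-a * y) * Real.exp (a / 2 * y) := by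
    rw [← Real.exp_add]; congr 1; ring
  rw [abs_mul, Real.abs_exp, h4]
  have h5 := hK (t - y)
  have : |g (t - y)| ≤ K * (2 * (1 + t ^ 2) * (1 + 8 / a ^ 2)) * Real.exp (a / 2 * y) := by
    calc |g (t - y)| ≤ K * (1 + (t - y) ^ 2) := h5
      _ ≤ K * (2 * (1 + t ^ 2) * (1 + y ^ 2)) := by gcongr
      _ ≤ K * (2 * (1 + t ^ 2) * ((1 + 8 / a ^ 2) * Real.exp (a / 2 * y))) := by gcongr
      _ = _ := by ring
  calc _ ≤ Real.exp (-a * y) * (K * (2 * (1 + t ^ 2) * (1 + 8 / a ^ 2)) * Real.exp (a / 2 * y)) := by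
        gcongr
    _ = _ := by ring

lemma QuadGrowth.integrableOn {g : ℝ → ℝ} (hg : QuadGrowth g) {a : ℝ} (ha : 0 < a) (t : ℝ) :
    IntegrableOn (fun y => Real.exp (-a * y) * g (t - y)) (Set.Ioi 0) := by
  obtain ⟨C, hC⟩ := hg.exp_bound ha t
  have h := (integrableOn_exp_mul_Ioi (by linarith : -(a / 2) < 0) 0).const_mul C
  have hc := hg.continuous
  refine Integrable.mono' h (by fun_prop : Continuous _).aestronglyMeasurable ?_
  exact (ae_restrict_mem measurableSet_Ioi).mono fun y hy => hC y (le_of_lt hy)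

lemma QuadGrowth.tendsto_exp {g : ℝ → ℝ} (hg : QuadGrowth g) {a : ℝ} (ha : 0 < a) (t : ℝ) :
    Tendsto (fun y => Real.exp (-a * y) * g (t - y)) atTop (𝓝 0) := by
  obtain ⟨C, hC⟩ := hg.exp_bound ha t
  have h : Tendsto (fun y => C * Real.exp (-(a / 2) * y)) atTop (𝓝 (C * 0)) :=
    (Real.tendsto_exp_atBot.comp
      (tendsto_id.const_mul_atTop_of_neg (by linarith : -(a / 2) < 0))).const_mul C
  rw [mul_zero] at h
  exact squeeze_zero_norm' ((eventually_ge_atTop 0).mono fun y hy => hC y hy) h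

/-- For a continuous integrator of quadratic growth the improper Riemann-Stieltjes integral exists
and is given by the Ornstein-Uhlenbeck functional. -/
lemma QuadGrowth.hasImproperRSIntegral {g : ℝ → ℝ} (hg : QuadGrowth g) {a : ℝ} (ha : 0 < a)
    (t : ℝ) : HasImproperRSIntegral (fun s => Real.exp (-a * (t - s))) g t (ouFunctional a t g) := by
  have hc := hg.continuous
  refine ⟨_, fun c hct => hasRSIntegral_of_hasDerivAt
    (f' := fun s => a * Real.exp (-a * (t - s))) (fun s => ?_) (by fun_prop) hc hct.le, ?_⟩
  · have h1 : HasDerivAt (fun s => -a * (t - s)) a s := by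
      simpa using ((hasDerivAt_id s).const_sub t).const_mul (-a)
    have := h1.exp
    rwa [mul_comm] at this
  · have hto : Tendsto (fun c : ℝ => t - c) atBot atTop :=
      tendsto_atTop_add_const_left _ _ tendsto_neg_atBot_atTop
    have h1 := (hg.tendsto_exp ha t).comp hto
    have h2 := intervalIntegral_tendsto_integral_Ioi 0 (hg.integrableOn ha t) hto
    have h3 := ((h1.const_sub (g t)).sub (h2.const_mul a))
    rw [sub_zero] at h3
    refine h3.congr fun c => ?_
    have h4 := intervalIntegral.integral_comp_sub_left (a := c) (b := t)
      (fun y => Real.exp (-a * y) * g (t - y)) t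
    simp only [sub_sub_cancel, sub_self] at h4
    simp only [Function.comp, sub_sub_cancel, sub_self, mul_zero, Real.exp_zero, one_mul]
    rw [← h4, ← intervalIntegral.integral_const_mul]
    simp only [mul_assoc]

lemma HasImproperRSIntegral.unique {f g : ℝ → ℝ} {t J J' : ℝ}
    (h : HasImproperRSIntegral f g t J) (h' : HasImproperRSIntegral f g t J') : J = J' := by
  obtain ⟨F, hF, hJ⟩ := h
  obtain ⟨F', hF', hJ'⟩ := h'
  refine tendsto_nhds_unique (hJ.congr' ?_) hJ'
  filter_upwards [eventually_lt_atBot t] with a ha using (hF a ha).unique ha.le (hF' a ha)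

/-- Riemann sums with mesh `1 / N` on `[0, N)` of a continuous exponentially decaying function
converge to its integral over `(0, ∞)`. -/
lemma tendsto_riemannSum_Ioi {f : ℝ → ℝ} (hf : Continuous f) {C c : ℝ} (hc : 0 < c)
    (hbd : ∀ y, 0 ≤ y → |f y| ≤ C * Real.exp (-c * y)) :
    Tendsto (fun n : ℕ => ∑ k ∈ Finset.range ((n + 1) ^ 2),
      1 / ((n : ℝ) + 1) * f (k / ((n : ℝ) + 1))) atTop (𝓝 (∫ y in Set.Ioi (0 : ℝ), f y)) := by
  have hC : 0 ≤ C := by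
    have := (abs_nonneg _).trans (hbd 0 le_rfl)
    simpa using this
  obtain ⟨h, hh⟩ : ∃ h : ℕ → ℝ → ℝ, ∀ n y, h n y = ∑ k ∈ Finset.range ((n + 1) ^ 2),
      Set.indicator (Set.Ico ((k : ℝ) / ((n : ℝ) + 1)) (((k : ℝ) + 1) / ((n : ℝ) + 1)))
        (fun _ => f (k / ((n : ℝ) + 1))) y := ⟨_, fun _ _ => rfl⟩
  have hval : ∀ n y, 0 ≤ y → h n y = if ⌊y * ((n : ℝ) + 1)⌋₊ < (n + 1) ^ 2 then
      f (⌊y * ((n : ℝ) + 1)⌋₊ / ((n : ℝ) + 1)) else 0 := by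
    intro n y hy
    have hn : (0 : ℝ) < n + 1 := by positivity
    have hmem : ∀ k : ℕ, y ∈ Set.Ico ((k : ℝ) / ((n : ℝ) + 1)) (((k : ℝ) + 1) / ((n : ℝ) + 1)) ↔
        ⌊y * ((n : ℝ) + 1)⌋₊ = k := by
      intro k
      rw [Nat.floor_eq_iff (by positivity), Set.mem_Ico, div_le_iff₀ hn, lt_div_iff₀ hn]
    rw [hh]
    simp_rw [Set.indicator_apply, hmem]
    rw [Finset.sum_ite_eq]
    simp only [Finset.mem_range]
  have hint : ∀ n : ℕ, ∑ k ∈ Finset.range ((n + 1) ^ 2),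
      1 / ((n : ℝ) + 1) * f (k / ((n : ℝ) + 1)) = ∫ y in Set.Ioi (0 : ℝ), h n y := by
    intro n
    have hn : (0 : ℝ) < n + 1 := by positivity
    simp_rw [hh]
    rw [← integral_Ici_eq_integral_Ioi, integral_finsetSum _ fun k _ => by
      rw [integrable_indicator_iff measurableSet_Ico]
      exact integrableOn_const (by
        refine ((Measure.restrict_apply_le _ _).trans_lt ?_).ne
        simp)]
    refine Finset.sum_congr rfl fun k _ => ?_
    have hsub : Set.Ico ((k : ℝ) / ((n : ℝ) + 1)) (((k : ℝ) + 1) / ((n : ℝ) + 1)) ⊆ Set.Ici 0 :=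
      fun y hy => (by positivity : (0 : ℝ) ≤ k / ((n : ℝ) + 1)).trans hy.1
    rw [setIntegral_indicator measurableSet_Ico, Set.inter_eq_right.2 hsub, setIntegral_const,
      Measure.real, Real.volume_Ico, ENNReal.toReal_ofReal (by
        rw [← sub_div]; simp; positivity), smul_eq_mul]
    congr 1
    rw [← sub_div]; simp
  simp_rw [hint]
  have hfl : ∀ (n : ℕ) y, 0 ≤ y → y - 1 / ((n : ℝ) + 1) ≤ ⌊y * ((n : ℝ) + 1)⌋₊ / ((n : ℝ) + 1) ∧
      (⌊y * ((n : ℝ) + 1)⌋₊ / ((n : ℝ) + 1) : ℝ) ≤ y := by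
    intro n y hy
    have hn : (0 : ℝ) < n + 1 := by positivity
    refine ⟨?_, ?_⟩
    · rw [le_div_iff₀ hn, sub_mul, one_div, inv_mul_cancel₀ hn.ne']
      linarith [Nat.lt_floor_add_one (y * ((n : ℝ) + 1))]
    · rw [div_le_iff₀ hn]
      exact Nat.floor_le (by positivity)
  refine tendsto_integral_of_dominated_convergence
    (fun y => C * Real.exp c * Real.exp (-c * y)) (fun n => ?_)
    ((integrableOn_exp_mul_Ioi (by linarith : -c < 0) 0).const_mul _) (fun n => ?_) ?_
  · have : h n = fun y => ∑ k ∈ Finset.range ((n + 1) ^ 2),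
      Set.indicator (Set.Ico ((k : ℝ) / ((n : ℝ) + 1)) (((k : ℝ) + 1) / ((n : ℝ) + 1)))
        (fun _ => f (k / ((n : ℝ) + 1))) y := funext fun y => hh n y
    rw [this]
    exact (Finset.measurable_fun_sum _ fun k _ =>
      measurable_const.indicator measurableSet_Ico).aestronglyMeasurable
  · refine (ae_restrict_mem measurableSet_Ioi).mono fun y hy => ?_
    have hy0 : (0 : ℝ) ≤ y := le_of_lt hy
    rw [hval n y hy0]
    split_ifs with hk
    · have h1 := (hfl n y hy0).1
      have h2 : 1 / ((n : ℝ) + 1) ≤ 1 := by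
        rw [div_le_one (by positivity)]
        linarith [(Nat.cast_nonneg n : (0 : ℝ) ≤ n)]
      refine (hbd _ (by positivity)).trans ?_
      rw [mul_assoc, ← Real.exp_add]
      gcongr
      nlinarith
    · rw [norm_zero]; positivity
  · refine (ae_restrict_mem measurableSet_Ioi).mono fun y hy => ?_
    have hy0 : (0 : ℝ) ≤ y := le_of_lt hy
    have hlim : Tendsto (fun n : ℕ => (⌊y * ((n : ℝ) + 1)⌋₊ / ((n : ℝ) + 1) : ℝ)) atTop (𝓝 y) := by
      refine tendsto_of_tendsto_of_tendsto_of_le_of_le (g := fun n : ℕ => y - 1 / ((n : ℝ) + 1))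
        (h := fun _ => y) ?_ tendsto_const_nhds (fun n => (hfl n y hy0).1)
        (fun n => (hfl n y hy0).2)
      simpa using (tendsto_one_div_add_atTop_nhds_zero_nat (𝕜 := ℝ)).const_sub y
    refine ((hf.tendsto y).comp hlim).congr' ?_
    obtain ⟨m, hm⟩ := exists_nat_gt y
    filter_upwards [eventually_ge_atTop m] with n hn
    have hn' : (m : ℝ) ≤ n := by exact_mod_cast hn
    rw [hval n y hy0, if_pos]
    · rfl
    · rw [Nat.floor_lt (by positivity)]
      push_cast
      have : (0 : ℝ) < n + 1 := by positivity
      nlinarith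

/-- Finite linear combinations of the values of `g` approximating `ouFunctional a t g`. -/
noncomputable def ouApprox (a t : ℝ) (n : ℕ) (g : ℝ → ℝ) : ℝ :=
  g t - a * ∑ k ∈ Finset.range ((n + 1) ^ 2),
    1 / ((n : ℝ) + 1) * (Real.exp (-a * (k / ((n : ℝ) + 1))) * g (t - k / ((n : ℝ) + 1)))

lemma QuadGrowth.tendsto_ouApprox {g : ℝ → ℝ} (hg : QuadGrowth g) {a : ℝ} (ha : 0 < a) (t : ℝ) :
    Tendsto (fun n => ouApprox a t n g) atTop (𝓝 (ouFunctional a t g)) := by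
  obtain ⟨C, hC⟩ := hg.exp_bound ha t
  have hc := hg.continuous
  have := tendsto_riemannSum_Ioi (f := fun y => Real.exp (-a * y) * g (t - y)) (by fun_prop)
    (by linarith : 0 < a / 2) hC
  exact (this.const_mul a).const_sub (g t)

/-! ### Growth of fractional Brownian paths -/

section Growth

variable {Ω : Type*} [MeasurableSpace Ω] {μ : Measure Ω} [IsProbabilityMeasure μ]

lemma exists_dual_eq_sum {ι : Type*} [Fintype ι] (L : StrongDual ℝ (ι → ℝ)) :
    ∃ c : ι → ℝ, ∀ x, L x = ∑ p, c p * x p := by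
  classical
  refine ⟨fun p => L (Pi.single p 1), fun x => ?_⟩
  have : x = ∑ p, x p • (Pi.single p (1 : ℝ) : ι → ℝ) := by
    ext s
    simp [Finset.sum_apply, Pi.single_apply]
  conv_lhs => rw [this, map_sum]
  simp [mul_comm]

/-- Centered Gaussian processes with the same covariance function have the same
finite-dimensional distributions. -/
lemma identDistrib_of_covariance_eq {T : Type*} {X Z : T → Ω → ℝ} (hX : IsGaussianProcess X μ)
    (hZ : IsGaussianProcess Z μ) (hX0 : ∀ t, ∫ ω, X t ω ∂μ = 0) (hZ0 : ∀ t, ∫ ω, Z t ω ∂μ = 0)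
    (hcov : ∀ s t, cov[X s, X t; μ] = cov[Z s, Z t; μ]) (I : Finset T) :
    IdentDistrib (fun ω => I.restrict (X · ω)) (fun ω => I.restrict (Z · ω)) μ μ := by
  have hXi : ∀ t, MemLp (X t) 2 μ := fun t => (hX.hasGaussianLaw_eval t).memLp_two
  have hZi : ∀ t, MemLp (Z t) 2 μ := fun t => (hZ.hasGaussianLaw_eval t).memLp_two
  refine identDistrib_of_hasGaussianLaw (hX.hasGaussianLaw I) (hZ.hasGaussianLaw I)
    (fun L => ?_) (fun L => ?_) <;> obtain ⟨c, hc⟩ := exists_dual_eq_sum L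
  · simp_rw [hc, Finset.restrict]
    rw [integral_finsetSum _ fun p _ => ((hXi p.1).integrable (by norm_num)).const_mul _,
      integral_finsetSum _ fun p _ => ((hZi p.1).integrable (by norm_num)).const_mul _]
    simp [integral_const_mul, hX0, hZ0]
  · simp_rw [hc, Finset.restrict]
    rw [variance_fun_sum fun p : I => (hXi p).const_mul (c p),
      variance_fun_sum fun p : I => (hZi p).const_mul (c p)]
    simp only [covariance_const_mul_left, covariance_const_mul_right, hcov]

lemma rpow_inversion {H : ℝ} (hH : 0 < H) (q r : ℝ) :
    |q| ^ (2 * H) * (|r| ^ (2 * H) *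
      ((|1 / q| ^ (2 * H) + |1 / r| ^ (2 * H) - |1 / q - 1 / r| ^ (2 * H)) / 2)) =
    (|q| ^ (2 * H) + |r| ^ (2 * H) - |q - r| ^ (2 * H)) / 2 := by
  have hH' : 2 * H ≠ 0 := by positivity
  rcases eq_or_ne q 0 with rfl | hq
  · simp [Real.zero_rpow hH']
  rcases eq_or_ne r 0 with rfl | hr
  · simp [Real.zero_rpow hH']
  have e1 : |q| ^ (2 * H) * |1 / q| ^ (2 * H) = 1 := by
    rw [← Real.mul_rpow (abs_nonneg _) (abs_nonneg _), ← abs_mul, mul_one_div_cancel hq]; simp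
  have e2 : |r| ^ (2 * H) * |1 / r| ^ (2 * H) = 1 := by
    rw [← Real.mul_rpow (abs_nonneg _) (abs_nonneg _), ← abs_mul, mul_one_div_cancel hr]; simp
  have e3 : |q| ^ (2 * H) * |r| ^ (2 * H) * |1 / q - 1 / r| ^ (2 * H) = |q - r| ^ (2 * H) := by
    rw [← Real.mul_rpow (abs_nonneg _) (abs_nonneg _), ← abs_mul,
      ← Real.mul_rpow (abs_nonneg _) (abs_nonneg _), ← abs_mul, abs_sub_comm q r]
    congr 2
    field_simp
  calc _ = (|r| ^ (2 * H) * (|q| ^ (2 * H) * |1 / q| ^ (2 * H)) +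
      |q| ^ (2 * H) * (|r| ^ (2 * H) * |1 / r| ^ (2 * H)) -
      |q| ^ (2 * H) * |r| ^ (2 * H) * |1 / q - 1 / r| ^ (2 * H)) / 2 := by ring
    _ = _ := by rw [e1, e2, e3]; ring

/-- Almost every path of a fractional Brownian motion is continuous of at most quadratic growth.
The time inversion `|q|^{2H} X_{1/q}` has the law of `X` on the rationals, so it is almost surely
bounded near `0`, which bounds `X` at infinity. -/
lemma IsFBM.ae_quadGrowth {H : ℝ} (hH : H ∈ Set.Ioo (0 : ℝ) 1) {X : ℝ → Ω → ℝ}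
    (hX : IsFBM H X μ) : ∀ᵐ ω ∂μ, QuadGrowth (fun t => X t ω) := by
  have hG1 : IsGaussianProcess (fun q : ℚ => X q) μ := hX.gaussian.comp_right (fun q : ℚ => (q : ℝ))
  have hG2 : IsGaussianProcess (fun (q : ℚ) ω => |(q : ℝ)| ^ (2 * H) * X (1 / q) ω) μ :=
    (hX.gaussian.comp_right (fun q : ℚ => 1 / (q : ℝ))).smul (fun q : ℚ => |(q : ℝ)| ^ (2 * H))
  have hid : IdentDistrib (fun ω (q : ℚ) => X q ω)
      (fun ω (q : ℚ) => |(q : ℝ)| ^ (2 * H) * X (1 / q) ω) μ μ := by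
    refine (identDistrib_iff_forall_finset_identDistrib
      (X := fun (q : ℚ) ω => X q ω) (Y := fun (q : ℚ) ω => |(q : ℝ)| ^ (2 * H) * X (1 / q) ω)
      (aemeasurable_pi_lambda _ fun q => hG1.aemeasurable q)
      (aemeasurable_pi_lambda _ fun q => hG2.aemeasurable q)).2 fun I => ?_
    refine identDistrib_of_covariance_eq hG1 hG2 (fun q => hX.centered q) (fun q => ?_)
      (fun q r => ?_) I
    · rw [integral_const_mul, hX.centered, mul_zero]
    · rw [covariance_const_mul_left, covariance_const_mul_right, hX.cov_eq, hX.cov_eq,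
        rpow_inversion hH.1]
  obtain ⟨S, hS⟩ : ∃ S : Set (ℚ → ℝ), S = {x | ∃ m : ℕ, ∀ q : ℚ, q ≠ 0 →
      |(q : ℝ)| < 1 / ((m : ℝ) + 1) → |x q| ≤ (m : ℝ)} := ⟨_, rfl⟩
  have hSm : MeasurableSet S := by
    rw [hS]
    simp only [Set.ofPred_exists, Set.ofPred_forall]
    refine MeasurableSet.iUnion fun m => MeasurableSet.iInter fun q => MeasurableSet.iInter fun _ =>
      MeasurableSet.iInter fun _ => ?_
    exact measurableSet_le (measurable_pi_apply q).abs measurable_const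
  have hXS : ∀ᵐ ω ∂μ, (fun q : ℚ => X q ω) ∈ S := by
    filter_upwards [hX.continuous_paths] with ω hω
    obtain ⟨M, hM⟩ := (isCompact_Icc (a := (-1 : ℝ)) (b := 1)).exists_bound_of_continuousOn
      hω.continuousOn
    obtain ⟨m, hm⟩ := exists_nat_ge M
    rw [hS]
    refine ⟨m, fun q _ hq => (hM q ?_).trans hm⟩
    have h1 : 1 / ((m : ℝ) + 1) ≤ 1 := by
      rw [div_le_one (by positivity)]
      linarith [(Nat.cast_nonneg m : (0 : ℝ) ≤ m)]
    exact abs_le.1 (hq.le.trans h1)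
  have hZS : ∀ᵐ ω ∂μ, (fun q : ℚ => |(q : ℝ)| ^ (2 * H) * X (1 / q) ω) ∈ S :=
    hid.ae_mem_snd hSm hXS
  filter_upwards [hX.continuous_paths, hZS] with ω hc hω
  refine ⟨hc, ?_⟩
  rw [hS] at hω
  obtain ⟨m, hm⟩ := hω
  obtain ⟨M, hM⟩ := (isCompact_Icc (a := -((m : ℝ) + 1)) (b := (m : ℝ) + 1)).exists_bound_of_continuousOn
    hc.continuousOn
  have hM0 : 0 ≤ M := (norm_nonneg _).trans (hM 0 ⟨by linarith [(Nat.cast_nonneg m : (0 : ℝ) ≤ m)],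
    by positivity⟩)
  refine ⟨M + m, fun u => ?_⟩
  have hclosed : IsClosed {u : ℝ | |X u ω| ≤ (M + m) * (1 + u ^ 2)} :=
    isClosed_le hc.abs (by fun_prop)
  have hrat : ∀ r : ℚ, |X r ω| ≤ (M + m) * (1 + (r : ℝ) ^ 2) := by
    intro r
    have hm0 : (0 : ℝ) ≤ m := Nat.cast_nonneg m
    rcases le_or_gt |(r : ℝ)| (m + 1) with hr | hr
    · have := hM r (abs_le.1 hr)
      rw [Real.norm_eq_abs] at this
      nlinarith [sq_nonneg (r : ℝ)]
    · have hr0 : (r : ℝ) ≠ 0 := by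
        intro h
        rw [h, abs_zero] at hr
        linarith
      have hr1 : 1 ≤ |(r : ℝ)| := by linarith
      have h1 := hm (1 / r) (by
        have : r ≠ 0 := by exact_mod_cast hr0
        positivity) (by
          push_cast
          rw [abs_div, abs_one]
          exact one_div_lt_one_div_of_lt (by positivity) hr)
      push_cast at h1
      rw [one_div_one_div, abs_mul, abs_of_nonneg (by positivity), abs_div, abs_one,
        Real.div_rpow zero_le_one (abs_nonneg _), Real.one_rpow, div_mul_eq_mul_div, one_mul,
        div_le_iff₀ (by positivity)] at h1
      have h2 : |(r : ℝ)| ^ (2 * H) ≤ (r : ℝ) ^ 2 := by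
        have h3 := Real.rpow_le_rpow_of_exponent_le hr1 (by linarith [hH.2] : 2 * H ≤ 2)
        have h4 : |(r : ℝ)| ^ (2 : ℝ) = (r : ℝ) ^ 2 := by
          rw [Real.rpow_two, sq_abs]
        rwa [h4] at h3
      have h3 : (m : ℝ) * |(r : ℝ)| ^ (2 * H) ≤ m * (r : ℝ) ^ 2 := by gcongr
      nlinarith [sq_nonneg (r : ℝ)]
  -- The bound holds at rational times, hence everywhere by continuity.
  have hsub : Set.range ((↑) : ℚ → ℝ) ⊆ {u : ℝ | |X u ω| ≤ (M + m) * (1 + u ^ 2)} := by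
    rintro _ ⟨r, rfl⟩
    exact hrat r
  exact hclosed.closure_subset_iff.2 hsub (Rat.denseRange_cast u)

end Growth

/-! ### The covariance kernel of the Ornstein-Uhlenbeck functional -/

lemma QuadGrowth.const (c : ℝ) : QuadGrowth fun _ => c :=
  ⟨continuous_const, |c|, fun u => by nlinarith [abs_nonneg c, sq_nonneg u]⟩

lemma QuadGrowth.add {f g : ℝ → ℝ} (hf : QuadGrowth f) (hg : QuadGrowth g) :
    QuadGrowth fun u => f u + g u := by
  obtain ⟨K, hK⟩ := hf.bound
  obtain ⟨K', hK'⟩ := hg.bound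
  exact ⟨hf.continuous.add hg.continuous, K + K', fun u => by
    rw [add_mul]; exact (abs_add_le _ _).trans (add_le_add (hK u) (hK' u))⟩

lemma QuadGrowth.const_mul {f : ℝ → ℝ} (hf : QuadGrowth f) (c : ℝ) :
    QuadGrowth fun u => c * f u := by
  obtain ⟨K, hK⟩ := hf.bound
  exact ⟨hf.continuous.const_mul c, |c| * K, fun u => by
    rw [abs_mul, mul_assoc]; exact mul_le_mul_of_nonneg_left (hK u) (abs_nonneg c)⟩

lemma QuadGrowth.sub {f g : ℝ → ℝ} (hf : QuadGrowth f) (hg : QuadGrowth g) :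
    QuadGrowth fun u => f u - g u := by
  simpa [sub_eq_add_neg] using hf.add (hg.const_mul (-1))

lemma QuadGrowth.comp_sub_left {f : ℝ → ℝ} (hf : QuadGrowth f) (c : ℝ) :
    QuadGrowth fun u => f (c - u) := by
  obtain ⟨K, hK⟩ := hf.bound
  have hK0 : 0 ≤ K := by
    have := (abs_nonneg _).trans (hK 0)
    linarith
  have hc := hf.continuous
  refine ⟨by fun_prop, K * (2 * (1 + c ^ 2)), fun u => (hK (c - u)).trans ?_⟩
  rw [mul_assoc]
  refine mul_le_mul_of_nonneg_left ?_ hK0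
  nlinarith [sq_nonneg (c + u), sq_nonneg (c * u), sq_nonneg c, sq_nonneg u]

lemma QuadGrowth.comp_neg {f : ℝ → ℝ} (hf : QuadGrowth f) : QuadGrowth fun u => f (-u) := by
  simpa using hf.comp_sub_left 0

lemma QuadGrowth.comp_sub_right {f : ℝ → ℝ} (hf : QuadGrowth f) (c : ℝ) :
    QuadGrowth fun u => f (u - c) := by
  have := (hf.comp_sub_left (-c)).comp_neg
  simpa [sub_eq_add_neg, add_comm] using this

lemma ouFunctional_const {a : ℝ} (ha : 0 < a) (t c : ℝ) : ouFunctional a t (fun _ => c) = 0 := by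
  have h : ∫ y in Set.Ioi (0 : ℝ), Real.exp (-a * y) = 1 / a := by
    rw [integral_exp_mul_Ioi (by linarith)]
    simp
  rw [ouFunctional, integral_mul_const, h]
  field_simp
  ring

lemma ouFunctional_sub {a : ℝ} (ha : 0 < a) (t : ℝ) {f g : ℝ → ℝ} (hf : QuadGrowth f)
    (hg : QuadGrowth g) :
    ouFunctional a t (fun u => f u - g u) = ouFunctional a t f - ouFunctional a t g := by
  simp only [ouFunctional, mul_sub]
  rw [integral_sub (hf.integrableOn ha t) (hg.integrableOn ha t)]
  ring

lemma ouFunctional_const_mul (a t c : ℝ) (f : ℝ → ℝ) :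
    ouFunctional a t (fun u => c * f u) = c * ouFunctional a t f := by
  simp only [ouFunctional]
  simp_rw [mul_left_comm _ c, integral_const_mul]
  ring

/-- The exponentially weighted forward average `∫_0^∞ e^{-a x} k(z + x) dx`. -/
noncomputable def expForward (a z : ℝ) (k : ℝ → ℝ) : ℝ :=
  ∫ x in Set.Ioi (0 : ℝ), Real.exp (-a * x) * k (z + x)

/-- The exponentially weighted backward average `∫_0^∞ e^{-b y} k(z - y) dy`. -/
noncomputable def expBackward (b z : ℝ) (k : ℝ → ℝ) : ℝ :=
  ∫ y in Set.Ioi (0 : ℝ), Real.exp (-b * y) * k (z - y)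

/-- The stationary covariance at lag `τ` of two unit Ornstein-Uhlenbeck functionals with rates `a`
and `b`, when the cross-covariance of the integrators is `-k (s - t)` up to summands depending on
one of the times only. -/
noncomputable def ouCov (a b : ℝ) (k : ℝ → ℝ) (τ : ℝ) : ℝ :=
  -k (-τ) + (a ^ 2 * expForward a (-τ) k + b ^ 2 * expBackward b (-τ) k) / (a + b)

lemma expForward_eq (a z : ℝ) (k : ℝ → ℝ) :
    expForward a z k = expBackward a (-z) (fun u => k (-u)) := by
  simp only [expForward, expBackward]
  congr with x
  congr 2
  ring

lemma QuadGrowth.integrableOn_forward {k : ℝ → ℝ} (hk : QuadGrowth k) {a : ℝ} (ha : 0 < a)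
    (z : ℝ) : IntegrableOn (fun x => Real.exp (-a * x) * k (z + x)) (Set.Ioi 0) := by
  have := hk.comp_neg.integrableOn ha (-z)
  simpa [sub_eq_add_neg, add_comm] using this

/-- After the substitution `x ↦ z + x` the forward average is `e^{a z} ∫_z^∞ e^{-a x} k(x) dx`. -/
lemma expForward_eq_tail (a z : ℝ) (k : ℝ → ℝ) :
    expForward a z k = Real.exp (a * z) * ∫ x in Set.Ioi z, Real.exp (-a * x) * k x := by
  have h := (measurePreserving_add_left volume z).setIntegral_preimage_emb
    (measurableEmbedding_addLeft z) (fun x => Real.exp (-a * x) * k x) (Set.Ioi z)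
  rw [Set.preimage_const_add_Ioi, sub_self] at h
  rw [← h, ← integral_const_mul, expForward]
  congr with x
  rw [← mul_assoc, ← Real.exp_add]
  congr 2
  ring

lemma QuadGrowth.integrableOn_tail {k : ℝ → ℝ} (hk : QuadGrowth k) {a : ℝ} (ha : 0 < a)
    (z : ℝ) : IntegrableOn (fun x => Real.exp (-a * x) * k x) (Set.Ioi z) := by
  have h := hk.integrableOn_forward ha 0
  simp only [zero_add] at h
  have hc := hk.continuous
  rcases le_total 0 z with hz | hz
  · exact h.mono_set (Set.Ioi_subset_Ioi hz)
  · rw [← Set.Ioc_union_Ioi_eq_Ioi hz]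
    exact ((by fun_prop : Continuous fun x => Real.exp (-a * x) * k x).integrableOn_Icc.mono_set
      Set.Ioc_subset_Icc_self).union h

/-- A tail integral is differentiable in its lower limit. -/
lemma hasDerivAt_integral_Ioi {f : ℝ → ℝ} {c z : ℝ} (hcz : c < z)
    (hi : IntegrableOn f (Set.Ioi c)) (hf : ContinuousOn f (Set.Ioi c)) :
    HasDerivAt (fun y => ∫ x in Set.Ioi y, f x) (-f z) z := by
  have hz : Set.Ioi c ∈ 𝓝 z := Ioi_mem_nhds hcz
  have h1 : HasDerivAt (fun y => ∫ x in z..y, f x) (f z) z :=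
    intervalIntegral.integral_hasDerivAt_right (by simp)
      (hf.stronglyMeasurableAtFilter isOpen_Ioi z hcz) (hf.continuousAt hz)
  have h2 := h1.const_sub (∫ x in Set.Ioi z, f x)
  refine h2.congr_of_eventuallyEq ?_
  filter_upwards [hz] with y hy
  have h3 := intervalIntegral.integral_interval_add_Ioi
    (hi.mono_set (Set.Ioi_subset_Ioi hcz.le)) (hi.mono_set (Set.Ioi_subset_Ioi (le_of_lt hy)))
  linarith

lemma QuadGrowth.hasDerivAt_expForward {k : ℝ → ℝ} (hk : QuadGrowth k) {a : ℝ} (ha : 0 < a)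
    (z : ℝ) : HasDerivAt (fun z => expForward a z k) (a * expForward a z k - k z) z := by
  have hc := hk.continuous
  have h := hasDerivAt_integral_Ioi (sub_one_lt z) (hk.integrableOn_tail ha (z - 1))
    (by fun_prop)
  have h1 : HasDerivAt (fun z => Real.exp (a * z)) (Real.exp (a * z) * a) z := by
    simpa using ((hasDerivAt_id z).const_mul a).exp
  have h2 := h1.fun_mul h
  simp_rw [expForward_eq_tail]
  refine h2.congr_deriv ?_
  have : Real.exp (a * z) * Real.exp (-a * z) = 1 := by rw [← Real.exp_add]; simp
  linear_combination (-k z) * this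

lemma QuadGrowth.expForward {k : ℝ → ℝ} (hk : QuadGrowth k) {a : ℝ} (ha : 0 < a) :
    QuadGrowth fun z => expForward a z k := by
  obtain ⟨K, hK⟩ := hk.bound
  have hK0 : 0 ≤ K := by
    have := (abs_nonneg _).trans (hK 0)
    linarith
  have hq : QuadGrowth fun x : ℝ => 1 + x ^ 2 := ⟨by fun_prop, 1, fun u => by
    rw [one_mul, abs_of_nonneg (by positivity)]⟩
  have hi := hq.integrableOn_forward ha 0
  simp only [zero_add] at hi
  refine ⟨continuous_iff_continuousAt.2 fun z => (hk.hasDerivAt_expForward ha z).continuousAt,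
    K * 2 * ∫ x in Set.Ioi (0 : ℝ), Real.exp (-a * x) * (1 + x ^ 2), fun z => ?_⟩
  rw [_root_.expForward, ← Real.norm_eq_abs, mul_right_comm, ← integral_const_mul]
  refine norm_integral_le_of_norm_le (hi.const_mul _) (ae_of_all _ fun x => ?_)
  rw [norm_mul, Real.norm_of_nonneg (Real.exp_pos _).le, Real.norm_eq_abs]
  have h1 : 1 + (z + x) ^ 2 ≤ 2 * (1 + z ^ 2) * (1 + x ^ 2) := by
    nlinarith [sq_nonneg (z - x), sq_nonneg (z * x), sq_nonneg z, sq_nonneg x]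
  calc Real.exp (-a * x) * |k (z + x)| ≤ Real.exp (-a * x) * (K * (2 * (1 + z ^ 2) * (1 + x ^ 2))) := by
        gcongr
        exact (hK _).trans (mul_le_mul_of_nonneg_left h1 hK0)
    _ = _ := by ring

/-- The backward average of a forward average: integrate the derivative of
`y ↦ e^{-b y} expForward a (z - y) k`. -/
lemma QuadGrowth.expBackward_expForward {k : ℝ → ℝ} (hk : QuadGrowth k) {a b : ℝ} (ha : 0 < a)
    (hb : 0 < b) (z : ℝ) :
    expBackward b z (fun z => _root_.expForward a z k) =
      (_root_.expForward a z k + expBackward b z k) / (a + b) := by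
  have hF := hk.expForward ha
  obtain ⟨F, hFdef⟩ : ∃ F : ℝ → ℝ, ∀ z, F z = _root_.expForward a z k := ⟨_, fun _ => rfl⟩
  have hder : ∀ z, HasDerivAt F (a * F z - k z) z := fun z => by
    have := hk.hasDerivAt_expForward ha z
    simp_rw [← hFdef] at this
    exact this
  simp_rw [← hFdef] at hF ⊢
  have hd : ∀ y, HasDerivAt (fun y => Real.exp (-b * y) * F (z - y))
      (-(a + b) * (Real.exp (-b * y) * F (z - y)) + Real.exp (-b * y) * k (z - y)) y := by
    intro y
    have h1 : HasDerivAt (fun y => Real.exp (-b * y)) (Real.exp (-b * y) * (-b)) y := by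
      simpa using ((hasDerivAt_id y).const_mul (-b)).exp
    have h2 : HasDerivAt (fun y => F (z - y)) (-(a * F (z - y) - k (z - y))) y := by
      have := (hder (z - y)).scomp y ((hasDerivAt_id y).const_sub z)
      rwa [neg_smul, one_smul] at this
    exact (h1.fun_mul h2).congr_deriv (by ring)
  have i1 := hF.integrableOn hb z
  have i2 := hk.integrableOn hb z
  have h := integral_Ioi_of_hasDerivAt_of_tendsto' (a := 0) (fun y _ => hd y)
    ((i1.const_mul _).add i2) (hF.tendsto_exp hb z)
  rw [integral_add (i1.const_mul _) i2, integral_const_mul] at h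
  simp only [expBackward]
  rw [eq_div_iff (by positivity)]
  simp only [mul_zero, Real.exp_zero, sub_zero, one_mul, zero_sub] at h
  linarith

/-- The iterated Ornstein-Uhlenbeck functional of a kernel `k (v - u)` is stationary. -/
lemma QuadGrowth.ouFunctional_ouFunctional {k : ℝ → ℝ} (hk : QuadGrowth k) {a b : ℝ} (ha : 0 < a)
    (hb : 0 < b) (t s : ℝ) :
    ouFunctional b s (fun v => ouFunctional a t (fun u => k (v - u))) = -ouCov a b k (t - s) := by
  have hF := hk.expForward ha
  have h1 : ∀ v, ouFunctional a t (fun u => k (v - u)) =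
      k (v - t) - a * _root_.expForward a (v - t) k := by
    intro v
    simp only [ouFunctional, _root_.expForward]
    congr 2
    congr with y
    congr 2
    ring
  simp_rw [h1]
  have h2 := hk.comp_sub_right t
  have h3 := (hF.comp_sub_right t).const_mul a
  rw [ouFunctional_sub hb s h2 h3, ouFunctional_const_mul]
  have h4 : ∀ g : ℝ → ℝ, ouFunctional b s (fun v => g (v - t)) =
      g (s - t) - b * expBackward b (s - t) g := by
    intro g
    simp only [ouFunctional, expBackward]
    congr 2
    congr with y
    congr 2
    ring
  have h5 := h4 (fun z => _root_.expForward a z k)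
  rw [h4, h5, hk.expBackward_expForward ha hb, ouCov, neg_sub]
  field_simp
  ring

/-! ### The multivariate fractional Ornstein-Uhlenbeck process -/

section FOU

variable {Ω : Type*} [MeasurableSpace Ω] {μ : Measure Ω} {d : ℕ}
  {H α ν : Fin d → ℝ} {B Y : ℝ → Ω → Fin d → ℝ}

lemma IsMultivariateFBM.isCenteredGaussian (hB : IsMultivariateFBM H B μ) {X : Ω → ℝ}
    (hX : X ∈ processSpan B) : IsCenteredGaussian X μ :=
  isCenteredGaussian_of_mem_processSpan hB.gaussian hB.centered hX

lemma IsMultivariateFBM.memLp (hB : IsMultivariateFBM H B μ) (t : ℝ) (i : Fin d) :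
    MemLp (fun ω => B t ω i) 2 μ :=
  (hB.isCenteredGaussian (coord_mem_processSpan B t i)).memLp

lemma ouApprox_mem_processSpan {Ω : Type*} (B : ℝ → Ω → Fin d → ℝ) (a t : ℝ) (n : ℕ) (i : Fin d) :
    (fun ω => ouApprox a t n (fun s => B s ω i)) ∈ processSpan B := by
  have h : (fun ω => ouApprox a t n (fun s => B s ω i)) = (fun ω => B t ω i) -
      a • ∑ k ∈ Finset.range ((n + 1) ^ 2), (1 / ((n : ℝ) + 1) *
        Real.exp (-a * (k / ((n : ℝ) + 1)))) • fun ω => B (t - k / ((n : ℝ) + 1)) ω i := by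
    funext ω
    simp [ouApprox, Finset.sum_apply, mul_assoc]
  rw [h]
  exact Submodule.sub_mem _ (coord_mem_processSpan B t i) (Submodule.smul_mem _ _
    (Submodule.sum_mem _ fun k _ => Submodule.smul_mem _ _ (coord_mem_processSpan B _ i)))

lemma covariance_congr_ae_right {X Z Z' : Ω → ℝ} (h : Z =ᵐ[μ] Z') :
    cov[X, Z; μ] = cov[X, Z'; μ] := by
  rw [covariance, covariance, integral_congr_ae h]
  refine integral_congr_ae ?_
  filter_upwards [h] with ω hω
  rw [hω]

lemma covariance_eq_of_identDistrib {X Z X' Z' : Ω → ℝ}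
    (h : IdentDistrib (fun ω => (X ω, Z ω)) (fun ω => (X' ω, Z' ω)) μ μ) :
    cov[X, Z; μ] = cov[X', Z'; μ] := by
  have h1 : ∫ ω, X ω ∂μ = ∫ ω, X' ω ∂μ := (h.comp measurable_fst).integral_eq
  have h2 : ∫ ω, Z ω ∂μ = ∫ ω, Z' ω ∂μ := (h.comp measurable_snd).integral_eq
  rw [covariance, covariance, h1, h2]
  have hm : Measurable fun p : ℝ × ℝ => (p.1 - ∫ ω, X' ω ∂μ) * (p.2 - ∫ ω, Z' ω ∂μ) := by
    fun_prop
  exact (h.comp hm).integral_eq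

lemma SameFDD.covariance_eq {X Z : ℝ → Ω → Fin d → ℝ} (h : SameFDD X Z μ) (t s : ℝ)
    (i j : Fin d) : cov[fun ω => X t ω i, fun ω => X s ω j; μ] =
      cov[fun ω => Z t ω i, fun ω => Z s ω j; μ] := by
  classical
  have h1 := h {t, s}
  have ht : t ∈ ({t, s} : Finset ℝ) := by simp
  have hs : s ∈ ({t, s} : Finset ℝ) := by simp
  exact covariance_eq_of_identDistrib (h1.comp
    (u := fun x : ({t, s} : Finset ℝ) → Fin d → ℝ => (x ⟨t, ht⟩ i, x ⟨s, hs⟩ j)) (by fun_prop))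

variable [IsProbabilityMeasure μ]

lemma IsMultivariateFBM.ae_quadGrowth (hH : ∀ i, H i ∈ Set.Ioo (0 : ℝ) 1)
    (hB : IsMultivariateFBM H B μ) : ∀ᵐ ω ∂μ, ∀ i, QuadGrowth (fun t => B t ω i) :=
  ae_all_iff.2 fun i => (hB.component i).ae_quadGrowth (hH i)

lemma IsMultivariateFOU.ae_eq (hH : ∀ i, H i ∈ Set.Ioo (0 : ℝ) 1) (hα : ∀ i, 0 < α i)
    (hB : IsMultivariateFBM H B μ) (hY : IsMultivariateFOU α ν B Y μ) (t : ℝ) (i : Fin d) :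
    ∀ᵐ ω ∂μ, Y t ω i = ν i * ouFunctional (α i) t (fun s => B s ω i) := by
  filter_upwards [hB.ae_quadGrowth hH, hY t i] with ω h1 h2
  obtain ⟨J, hJ, h3⟩ := h2
  rw [h3, hJ.unique ((h1 i).hasImproperRSIntegral (hα i) t)]

lemma IsMultivariateFBM.ae_tendsto_ouApprox (hH : ∀ i, H i ∈ Set.Ioo (0 : ℝ) 1)
    (hα : ∀ i, 0 < α i) (hB : IsMultivariateFBM H B μ) (t : ℝ) (i : Fin d) :
    ∀ᵐ ω ∂μ, Tendsto (fun n => ouApprox (α i) t n (fun s => B s ω i)) atTop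
      (𝓝 (ouFunctional (α i) t (fun s => B s ω i))) := by
  filter_upwards [hB.ae_quadGrowth hH] with ω h1 using (h1 i).tendsto_ouApprox (hα i) t

lemma IsMultivariateFOU.mem_closure (hH : ∀ i, H i ∈ Set.Ioo (0 : ℝ) 1) (hα : ∀ i, 0 < α i)
    (hB : IsMultivariateFBM H B μ) (hY : IsMultivariateFOU α ν B Y μ) (t : ℝ) (i : Fin d) :
    (fun ω => Y t ω i) ∈ gaussianClosure (processSpan B) μ := by
  refine ⟨fun n => ν i • fun ω => ouApprox (α i) t n (fun s => B s ω i),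
    fun n => Submodule.smul_mem _ _ (ouApprox_mem_processSpan B _ t n i), ?_⟩
  filter_upwards [hY.ae_eq hH hα hB t i, hB.ae_tendsto_ouApprox hH hα t i] with ω h1 h2
  rw [h1]
  exact h2.const_mul _

lemma IsMultivariateFOU.isCenteredGaussian (hH : ∀ i, H i ∈ Set.Ioo (0 : ℝ) 1)
    (hα : ∀ i, 0 < α i) (hB : IsMultivariateFBM H B μ) (hY : IsMultivariateFOU α ν B Y μ) (t : ℝ)
    (i : Fin d) : IsCenteredGaussian (fun ω => Y t ω i) μ :=
  isCenteredGaussian_of_mem_closure (fun _ => hB.isCenteredGaussian) (hY.mem_closure hH hα hB t i)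

lemma abs_covariance_le {X Z : Ω → ℝ} (hX : MemLp X 2 μ) (hZ : MemLp Z 2 μ) :
    |cov[X, Z; μ]| ≤ (Var[X; μ] + Var[Z; μ]) / 2 := by
  have h1 := variance_add hX hZ
  have h2 := variance_sub hX hZ
  have h3 := variance_nonneg (X + Z) μ
  have h4 := variance_nonneg (X - Z) μ
  rw [abs_le]
  constructor <;> linarith

/-- The covariance with a fixed element of the Gaussian closure is a continuous function of time,
because the paths are almost surely continuous and covariances pass to almost sure limits. -/
lemma IsMultivariateFBM.quadGrowth_covariance (hH : ∀ i, H i ∈ Set.Ioo (0 : ℝ) 1)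
    (hB : IsMultivariateFBM H B μ) {X : Ω → ℝ} (hX : X ∈ gaussianClosure (processSpan B) μ)
    (i : Fin d) : QuadGrowth fun u => cov[X, fun ω => B u ω i; μ] := by
  have hXG := isCenteredGaussian_of_mem_closure (fun _ => hB.isCenteredGaussian) hX
  refine ⟨?_, Var[X; μ] + 1, fun u => ?_⟩
  · rw [continuous_iff_seqContinuous]
    intro u v hu
    refine tendsto_covariance_of_mem_closure (fun _ => hB.isCenteredGaussian) hX
      (fun n => le_gaussianClosure _ (coord_mem_processSpan B (u n) i)) ?_
    filter_upwards [(hB.component i).continuous_paths] with ω hω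
    exact (hω.tendsto v).comp hu
  · have h1 := abs_covariance_le hXG.memLp (hB.memLp u i)
    have h2 : Var[fun ω => B u ω i; μ] = |u| ^ (2 * H i) := by
      rw [← covariance_self (hB.memLp u i).aemeasurable, (hB.component i).cov_eq, sub_self, abs_zero,
        Real.zero_rpow (by have := (hH i).1; positivity)]
      ring
    have h3 := abs_rpow_le_one_add_sq (by linarith [(hH i).1] : 0 ≤ 2 * H i)
      (by linarith [(hH i).2]) u
    rw [h2] at h1
    nlinarith [variance_nonneg X μ, sq_nonneg u]

/-- Covariances with the process are Ornstein-Uhlenbeck functionals of covariances with its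
driver. -/
lemma IsMultivariateFOU.covariance_eq (hH : ∀ i, H i ∈ Set.Ioo (0 : ℝ) 1) (hα : ∀ i, 0 < α i)
    (hB : IsMultivariateFBM H B μ) (hY : IsMultivariateFOU α ν B Y μ) {X : Ω → ℝ}
    (hX : X ∈ gaussianClosure (processSpan B) μ) (t : ℝ) (i : Fin d) :
    cov[X, fun ω => Y t ω i; μ] =
      ν i * ouFunctional (α i) t (fun u => cov[X, fun ω => B u ω i; μ]) := by
  rw [covariance_congr_ae_right (hY.ae_eq hH hα hB t i), covariance_const_mul_right]
  congr 1
  have hXG := isCenteredGaussian_of_mem_closure (fun _ => hB.isCenteredGaussian) hX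
  refine tendsto_nhds_unique (tendsto_covariance_of_mem_closure (fun _ => hB.isCenteredGaussian) hX
      (fun n => le_gaussianClosure _ (ouApprox_mem_processSpan B (α i) t n i))
      (hB.ae_tendsto_ouApprox hH hα t i)) ?_
  refine ((hB.quadGrowth_covariance hH hX i).tendsto_ouApprox (hα i) t).congr fun n => ?_
  simp only [ouApprox]
  have hm : ∀ u, MemLp (fun ω => B u ω i) 2 μ := fun u => hB.memLp u i
  rw [covariance_fun_sub_right hXG.memLp (hm t)
      ((memLp_finsetSum _ fun k _ => ((hm _).const_mul _).const_mul _).const_mul _),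
    covariance_const_mul_right, covariance_fun_sum_right'
      (fun k _ => ((hm _).const_mul _).const_mul _) hXG.memLp]
  simp only [covariance_const_mul_right]

/-- If the cross-covariance of two components of the driver is `p u + q v - k (v - u)`, then the
cross-covariance of the Ornstein-Uhlenbeck components depends only on the lag and is given by the
kernel `k`; the one-variable summands are annihilated because the functional kills constants. -/
lemma IsMultivariateFOU.covariance_eq_ouCov (hH : ∀ i, H i ∈ Set.Ioo (0 : ℝ) 1)
    (hα : ∀ i, 0 < α i) (hB : IsMultivariateFBM H B μ) (hY : IsMultivariateFOU α ν B Y μ)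
    {i j : Fin d} {p q k : ℝ → ℝ} (hp : QuadGrowth p) (hk : QuadGrowth k)
    (hC : ∀ u v, cov[fun ω => B u ω i, fun ω => B v ω j; μ] = p u + q v - k (v - u)) (t s : ℝ) :
    cov[fun ω => Y t ω i, fun ω => Y s ω j; μ] = ν i * ν j * ouCov (α i) (α j) k (t - s) := by
  have hYi := hY.mem_closure hH hα hB t i
  have h1 : ∀ v, cov[fun ω => Y t ω i, fun ω => B v ω j; μ] =
      ν i * (ouFunctional (α i) t p - ouFunctional (α i) t (fun u => k (v - u))) := by
    intro v
    rw [covariance_comm, hY.covariance_eq hH hα hB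
      (le_gaussianClosure _ (coord_mem_processSpan B v j)) t i]
    simp_rw [covariance_comm (fun ω => B v ω j), hC]
    have e : (fun u => p u + q v - k (v - u)) = fun u => (p u - (-q v)) - k (v - u) := by
      funext u; ring
    rw [e, ouFunctional_sub (hα i) t (hp.sub (.const _)) (hk.comp_sub_left v),
      ouFunctional_sub (hα i) t hp (.const _), ouFunctional_const (hα i), sub_zero]
  have hG : QuadGrowth fun v => ouFunctional (α i) t (fun u => k (v - u)) := by
    have h : (fun v => ouFunctional (α i) t (fun u => k (v - u))) = fun v =>
        (k (v - t) - α i * expForward (α i) (v - t) k) := by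
      funext v
      simp only [ouFunctional, _root_.expForward]
      congr 2
      congr with y
      congr 2
      ring
    rw [h]
    exact (hk.comp_sub_right t).sub (((hk.expForward (hα i)).comp_sub_right t).const_mul _)
  rw [hY.covariance_eq hH hα hB hYi s j]
  simp_rw [h1]
  rw [ouFunctional_const_mul, ouFunctional_sub (hα j) s (.const _) hG, ouFunctional_const (hα j),
    hk.ouFunctional_ouFunctional (hα i) (hα j)]
  ring

lemma IsMultivariateFOU.isGaussianProcess (hH : ∀ i, H i ∈ Set.Ioo (0 : ℝ) 1)
    (hα : ∀ i, 0 < α i) (hB : IsMultivariateFBM H B μ) (hY : IsMultivariateFOU α ν B Y μ) :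
    IsGaussianProcess Y μ := by
  have hm : ∀ t i, AEMeasurable (fun ω => Y t ω i) μ := fun t i =>
    (hY.isCenteredGaussian hH hα hB t i).gaussian.aemeasurable
  refine ⟨fun I => hasGaussianLaw_of_forall_dual (aemeasurable_pi_lambda _ fun t =>
    aemeasurable_pi_lambda _ fun i => hm t i) fun L => ?_⟩
  obtain ⟨c, hc⟩ := exists_dual_eq_sum_prod L
  simp_rw [hc, Finset.restrict]
  refine (isCenteredGaussian_of_mem_closure (V := processSpan B)
    (fun _ => hB.isCenteredGaussian) ?_).gaussian
  have h : (fun ω => ∑ p : I × Fin d, c p * Y p.1 ω p.2) =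
      ∑ p : I × Fin d, c p • fun ω => Y p.1 ω p.2 := by
    funext ω
    simp [Finset.sum_apply]
  rw [h]
  exact Submodule.sum_mem _ fun p _ => Submodule.smul_mem _ _ (hY.mem_closure hH hα hB _ _)

/-- A centered Gaussian process whose covariances depend only on the time lag is strongly
stationary. -/
lemma isStronglyStationary_of_covariance (hG : IsGaussianProcess Y μ)
    (hY : ∀ t i, IsCenteredGaussian (fun ω => Y t ω i) μ)
    (hcov : ∀ i j, ∃ R : ℝ → ℝ, ∀ t s, cov[fun ω => Y t ω i, fun ω => Y s ω j; μ] = R (t - s)) :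
    IsStronglyStationary Y μ := by
  choose R hR using hcov
  intro h S
  have hG' : HasGaussianLaw (fun ω => S.restrict (fun t => Y (t + h) ω)) μ :=
    (hG.comp_right (fun t => t + h)).hasGaussianLaw S
  refine identDistrib_of_hasGaussianLaw hG' (hG.hasGaussianLaw S) (fun L => ?_) (fun L => ?_) <;>
    obtain ⟨c, hc⟩ := exists_dual_eq_sum_prod L
  · simp_rw [hc, Finset.restrict]
    rw [integral_finsetSum _ fun p _ =>
        ((hY (p.1 + h) p.2).gaussian.integrable).const_mul _,
      integral_finsetSum _ fun p _ => ((hY p.1 p.2).gaussian.integrable).const_mul _]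
    simp [integral_const_mul, (hY _ _).mean]
  · simp_rw [hc, Finset.restrict]
    rw [variance_fun_sum fun p : S × Fin d => (hY (p.1 + h) p.2).memLp.const_mul _,
      variance_fun_sum fun p : S × Fin d => (hY p.1 p.2).memLp.const_mul _]
    simp only [covariance_const_mul_left, covariance_const_mul_right, hR, add_sub_add_right_eq_sub]

/-! ### Cross-covariances of the multivariate fractional Brownian motion -/

lemma IsMultivariateFBM.isSelfSimilarCov (hH : ∀ i, H i ∈ Set.Ioo (0 : ℝ) 1)
    (hB : IsMultivariateFBM H B μ) (i j : Fin d) :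
    IsSelfSimilarCov (H i + H j) fun t s => cov[fun ω => B t ω i, fun ω => B s ω j; μ] := by
  have hm := hB.memLp
  have hz : ∀ i, (fun ω => B 0 ω i) =ᵐ[μ] fun _ => 0 := by
    intro i
    have hv : Var[fun ω => B 0 ω i; μ] = 0 := by
      rw [← covariance_self (hm 0 i).aemeasurable, (hB.component i).cov_eq, sub_self, abs_zero,
        Real.zero_rpow (by have := (hH i).1; positivity)]
      ring
    have h2 := (variance_eq_integral (hm 0 i).aemeasurable).symm.trans hv
    rw [hB.centered 0 i] at h2
    rw [integral_eq_zero_iff_of_nonneg (fun ω => sq_nonneg _) (by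
      simpa using (hm 0 i).integrable_sq)] at h2
    filter_upwards [h2] with ω hω
    simpa using hω
  have h0r : ∀ (X : Ω → ℝ) i, cov[X, fun ω => B 0 ω i; μ] = 0 := fun X i => by
    rw [covariance_congr_ae_right (hz i)]; simp
  have h0l : ∀ (X : Ω → ℝ) i, cov[fun ω => B 0 ω i, X; μ] = 0 := fun X i => by
    rw [covariance_comm, h0r]
  refine ⟨fun s => h0l _ i, fun t => h0r _ j, fun r t s => ?_, fun c t s hc => ?_⟩
  · have h := (hB.stationary_increments r).covariance_eq t s i j
    rw [covariance_fun_sub_fun_sub (hm _ _) (hm _ _) (hm _ _) (hm _ _),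
      covariance_fun_sub_fun_sub (hm _ _) (hm _ _) (hm _ _) (hm _ _)] at h
    simp only [h0r, h0l, sub_zero, add_zero] at h
    linarith
  · have h := (hB.self_similar c hc).covariance_eq t s i j
    rw [covariance_const_mul_left, covariance_const_mul_right] at h
    rw [h, Real.rpow_add hc]
    ring

/-- The cross-covariance parameters exist: `ρ` is the covariance at time `1` and `η` is normalised
by the antisymmetric part of the covariance at `(2, 1)`. -/
lemma IsMultivariateFBM.exists_isCrossParam (hH : ∀ i, H i ∈ Set.Ioo (0 : ℝ) 1)
    (hB : IsMultivariateFBM H B μ) : ∃ ρ η : Fin d → Fin d → ℝ, IsCrossParam H B μ ρ η := by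
  obtain ⟨C, hC⟩ : ∃ C : Fin d → Fin d → ℝ → ℝ → ℝ, ∀ i j t s,
    C i j t s = cov[fun ω => B t ω i, fun ω => B s ω j; μ] := ⟨_, fun _ _ _ _ => rfl⟩
  have hsymm : ∀ i j t s, C i j t s = C j i s t := fun i j t s => by
    rw [hC, hC, covariance_comm]
  have hS : ∀ i j, IsSelfSimilarCov (H i + H j) (C i j) := fun i j => by
    have := hB.isSelfSimilarCov hH i j
    simp_rw [← hC] at this
    exact this
  have hpos : ∀ i j, 0 < H i + H j := fun i j => add_pos (hH i).1 (hH j).1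
  have hlt : ∀ i j, H i + H j < 2 := fun i j => by linarith [(hH i).2, (hH j).2]
  have hvar : ∀ i, Var[fun ω => B 1 ω i; μ] = 1 := by
    intro i
    rw [← covariance_self (hB.memLp 1 i).aemeasurable, (hB.component i).cov_eq, sub_self, abs_zero,
      Real.zero_rpow (by have := (hH i).1; positivity)]
    norm_num
  refine ⟨fun i j => C i j 1 1, fun i j => if H i + H j = 1 then
    -((C i j 2 1 - C i j 1 2) / (2 * Real.log 2)) else
    (C i j 2 1 - C i j 1 2) / (2 ^ (H i + H j) - 2), ?_, ?_, ?_, ?_, ?_, ?_⟩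
  · exact fun i j _ => hsymm i j 1 1
  · intro i j _
    have := abs_covariance_le (hB.memLp 1 i) (hB.memLp 1 j)
    rw [hvar, hvar] at this
    norm_num at this
    simp only [hC]
    exact abs_le.1 this
  · intro i j _
    rw [corr, hvar, hvar, hC]
    simp
  · intro i j _
    rw [hsymm j i, hsymm j i, add_comm (H j)]
    split_ifs <;> ring
  · intro i j _ h1 t s
    rw [← hC]
    simp only [if_neg h1]
    exact (hS i j).eq_of_ne (hpos i j) (hlt i j) h1 rfl rfl t s
  · intro i j _ h1 t s
    rw [← hC]
    simp only [if_pos h1]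
    refine IsSelfSimilarCov.eq_of_eq (h1 ▸ hS i j) ?_ rfl rfl t s
    -- By stationarity of increments the antisymmetric part only involves time `1` and time `-b`.
    have hdiff : (fun b => C i j (1 + b) b - C i j b (1 + b)) =
        fun b => C j i 1 (-b) - C i j 1 (-b) := by
      funext b
      have e1 := (hS i j).incr b 1 (-b)
      have e2 := (hS i j).incr b (-b) 1
      rw [neg_add_cancel, (hS i j).zero_right, (hS i j).zero_right] at e1
      rw [neg_add_cancel, (hS i j).zero_left, (hS i j).zero_left] at e2
      rw [hsymm j i]
      linarith
    have hcont : ∀ i j, Continuous fun b => C i j 1 (-b) := fun i j => by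
      simp_rw [hC]
      exact (hB.quadGrowth_covariance hH
        (le_gaussianClosure _ (coord_mem_processSpan B 1 i)) j).comp_neg.continuous
    rw [hdiff]
    exact (hcont j i).sub (hcont i j)

end FOU

/-! ### The double integral in the cross-covariance -/

lemma integrableOn_innerIntegrand {b h u : ℝ} (hb : 0 < b) (hh : h < 2) (hu : 0 < u) :
    IntegrableOn (innerIntegrand b h u) (Set.Iic 0) := by
  have hi := (integrableOn_exp_mul_Iic hb 0).mul_const (u ^ (h - 2))
  refine Integrable.mono' hi ?_ ?_
  · exact (by unfold innerIntegrand; fun_prop : Measurable (innerIntegrand b h u)).aestronglyMeasurable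
  · refine (ae_restrict_mem measurableSet_Iic).mono fun v (hv : v ≤ 0) => ?_
    have h1 : (u - v) ^ (h - 2) ≤ u ^ (h - 2) :=
      Real.rpow_le_rpow_of_nonpos hu (by linarith) (by linarith)
    have h2 : 0 ≤ (u - v) ^ (h - 2) := Real.rpow_nonneg (by linarith) _
    rw [innerIntegrand, norm_mul, Real.norm_of_nonneg (Real.exp_pos _).le, Real.norm_of_nonneg h2]
    gcongr

lemma integral_innerIntegrand (b h u : ℝ) :
    ∫ v in Set.Iic (0 : ℝ), innerIntegrand b h u v =
      ∫ x in Set.Ioi (0 : ℝ), Real.exp (-b * x) * (u + x) ^ (h - 2) := by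
  have := integral_comp_neg_Ioi 0 (innerIntegrand b h u)
  rw [neg_zero] at this
  rw [← this]
  congr with x
  simp [innerIntegrand]

/-- The outer integrand is `O(u ^ (h / 2 - 1))` at `0`, because
`(u + x) ^ (h - 2) ≤ (u x) ^ (h / 2 - 1)`. -/
lemma intervalIntegrable_outerIntegrand {a b h : ℝ} (hb : 0 < b) (h0 : 0 < h) (hh : h < 2)
    {τ : ℝ} (hτ : 0 < τ) : IntervalIntegrable (outerIntegrand a b h) volume 0 τ := by
  have hp := intervalIntegral.intervalIntegrable_rpow' (a := 0) (b := τ) (r := h / 2 - 1)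
    (by linarith)
  rw [intervalIntegrable_iff_integrableOn_Ioc_of_le hτ.le] at hp ⊢
  obtain ⟨M, hM⟩ : ∃ M : ℝ, ∀ u ∈ Set.Icc 0 τ, ‖Real.exp (a * u)‖ ≤ M :=
    isCompact_Icc.exists_bound_of_continuousOn (by fun_prop)
  have hM0 : 0 ≤ M := (norm_nonneg _).trans (hM 0 ⟨le_rfl, hτ.le⟩)
  obtain ⟨C, hC⟩ : ∃ C, C = ∫ x in Set.Ioi (0 : ℝ), Real.exp (-b * x) * x ^ (h / 2 - 1) := ⟨_, rfl⟩
  have hmeas : AEStronglyMeasurable (outerIntegrand a b h) (volume.restrict (Set.Ioc 0 τ)) := by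
    have h1 : StronglyMeasurable (Function.uncurry fun u v : ℝ => innerIntegrand b h u v) :=
      (by unfold innerIntegrand; fun_prop : Measurable
        (Function.uncurry fun u v : ℝ => innerIntegrand b h u v)).stronglyMeasurable
    have h2 := h1.integral_prod_right (ν := volume.restrict (Set.Iic (0 : ℝ)))
    exact ((by fun_prop : Measurable fun u : ℝ => Real.exp (a * u)).stronglyMeasurable.mul
      h2).aestronglyMeasurable
  refine Integrable.mono' (hp.const_mul (M * C)) hmeas ?_
  refine (ae_restrict_mem measurableSet_Ioc).mono fun u hu => ?_
  have hu0 : 0 < u := hu.1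
  have hint : IntegrableOn (fun x : ℝ => Real.exp (-b * x) * x ^ (h / 2 - 1)) (Set.Ioi 0) := by
    have := integrableOn_rpow_mul_exp_neg_mul_rpow (p := 1) (s := h / 2 - 1) (b := b)
      (by linarith) one_pos hb
    simpa only [Real.rpow_one, mul_comm] using this
  have h1 : ‖∫ v in Set.Iic (0 : ℝ), innerIntegrand b h u v‖ ≤ u ^ (h / 2 - 1) * C := by
    rw [integral_innerIntegrand, hC, ← integral_const_mul]
    refine norm_integral_le_of_norm_le (hint.const_mul _) ?_
    refine (ae_restrict_mem measurableSet_Ioi).mono fun x (hx : 0 < x) => ?_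
    have h2 : (u + x) ^ (h - 2) ≤ u ^ (h / 2 - 1) * x ^ (h / 2 - 1) := by
      have h3 : (u + x) ^ (h - 2) = ((u + x) ^ 2) ^ (h / 2 - 1) := by
        rw [← Real.rpow_natCast, ← Real.rpow_mul (by positivity)]
        congr 1
        push_cast
        ring
      rw [h3, ← Real.mul_rpow hu0.le hx.le]
      exact Real.rpow_le_rpow_of_nonpos (by positivity) (by nlinarith [mul_pos hu0 hx])
        (by linarith)
    rw [norm_mul, Real.norm_of_nonneg (Real.exp_pos _).le,
      Real.norm_of_nonneg (by positivity : 0 ≤ (u + x) ^ (h - 2))]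
    calc _ ≤ Real.exp (-b * x) * (u ^ (h / 2 - 1) * x ^ (h / 2 - 1)) := by gcongr
      _ = _ := by ring
  rw [outerIntegrand, norm_mul]
  calc _ ≤ M * (u ^ (h / 2 - 1) * C) :=
        mul_le_mul (hM u ⟨hu0.le, hu.2⟩) h1 (norm_nonneg _) hM0
    _ = _ := by ring

lemma expBackward_eq (b z : ℝ) (k : ℝ → ℝ) :
    expBackward b z k = expForward b (-z) (fun u => k (-u)) := by
  rw [expForward_eq]
  simp

/-- For a kernel whose reflection `κ x = k (-x)` satisfies `κ'' x = c x ^ (h - 2)` on `(0, ∞)`, the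
covariance `R` solves `R' + a R = c ∫_{-∞}^0 e^{b v} (τ - v)^{h - 2} dv` on `(0, ∞)`. The second
order term comes from two integrations by parts in the backward average. -/
lemma QuadGrowth.ouCov_eq_of_hasDerivAt {k : ℝ → ℝ} (hk : QuadGrowth k) {a b h c : ℝ} (ha : 0 < a)
    (hb : 0 < b) (h0 : 0 < h) (hh : h < 2) {κ' : ℝ → ℝ}
    (hκ : ∀ x, 0 < x → HasDerivAt (fun x => k (-x)) (κ' x) x)
    (hκ' : ∀ x, 0 < x → HasDerivAt κ' (c * x ^ (h - 2)) x)
    (hlim : Tendsto (fun x => Real.exp (-b * x) * κ' x) atTop (𝓝 0)) {τ : ℝ} (hτ : 0 < τ) :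
    ouCov a b k τ = Real.exp (-a * τ) * ouCov a b k 0
      + Real.exp (-a * τ) * c * crossI a b h τ := by
  have hk' := hk.comp_neg
  have hP : ∀ z, HasDerivAt (fun z => _root_.expForward a (-z) k)
      (-(a * _root_.expForward a (-z) k) + k (-z)) z := by
    intro z
    have := (hk.hasDerivAt_expForward ha (-z)).scomp z (hasDerivAt_neg z)
    refine this.congr_deriv ?_
    simp
    ring
  have hQ : ∀ z, HasDerivAt (fun z => expBackward b (-z) k) (b * expBackward b (-z) k - k (-z)) z := by
    intro z
    have := hk'.hasDerivAt_expForward hb z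
    simp_rw [expBackward_eq, neg_neg]
    exact this
  -- Integrating the reflected kernel by parts twice exhibits the inner integral.
  have hW : ∀ z, 0 < z → c * ∫ v in Set.Iic (0 : ℝ), innerIntegrand b h z v =
      b ^ 2 * expBackward b (-z) k - b * k (-z) - κ' z := by
    intro z hz
    have hd : ∀ x ∈ Set.Ici (0 : ℝ), HasDerivAt
        (fun x => Real.exp (-b * x) * (b * k (-(z + x))) + Real.exp (-b * x) * κ' (z + x))
        (-(b ^ 2) * (Real.exp (-b * x) * k (-(z + x))) +
          c * (Real.exp (-b * x) * (z + x) ^ (h - 2))) x := by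
      intro x hx
      have hx0 : 0 < z + x := by
        have : (0 : ℝ) ≤ x := hx
        linarith
      have e1 : HasDerivAt (fun x => Real.exp (-b * x)) (Real.exp (-b * x) * (-b)) x := by
        simpa using ((hasDerivAt_id x).const_mul (-b)).exp
      have e2 : HasDerivAt (fun x => k (-(z + x))) (κ' (z + x)) x :=
        (hκ (z + x) hx0).comp_const_add z x
      have e3 : HasDerivAt (fun x => κ' (z + x)) (c * (z + x) ^ (h - 2)) x :=
        (hκ' (z + x) hx0).comp_const_add z x
      exact ((e1.fun_mul (e2.const_mul b)).fun_add (e1.fun_mul e3)).congr_deriv (by ring)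
    have i1 : IntegrableOn (fun x => Real.exp (-b * x) * k (-(z + x))) (Set.Ioi 0) :=
      hk'.integrableOn_forward hb z
    have i2 : IntegrableOn (fun x => Real.exp (-b * x) * (z + x) ^ (h - 2)) (Set.Ioi 0) := by
      have h1 := (integrableOn_innerIntegrand hb hh hz)
      have h2 : (fun x => Real.exp (-b * x) * (z + x) ^ (h - 2)) =
          fun x => innerIntegrand b h z (-x) := by
        funext x
        simp [innerIntegrand]
      rw [h2, ← integrableOn_Ici_iff_integrableOn_Ioi]
      have := (Measure.measurePreserving_neg (volume : Measure ℝ)).integrableOn_comp_preimage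
        (MeasurableEquiv.neg ℝ).measurableEmbedding (f := innerIntegrand b h z) (s := Set.Iic 0)
      simpa [Function.comp_def] using this.2 h1
    have l1 : Tendsto (fun x => Real.exp (-b * x) * (b * k (-(z + x))) +
        Real.exp (-b * x) * κ' (z + x)) atTop (𝓝 0) := by
      have t1 := (hk.tendsto_exp hb (-z)).const_mul b
      have t2 := (hlim.comp (tendsto_atTop_add_const_left atTop z tendsto_id)).const_mul
        (Real.exp (b * z))
      have t3 := t1.add t2
      simp only [mul_zero, add_zero] at t3
      refine t3.congr fun x => ?_
      simp only [Function.comp, id]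
      rw [← mul_assoc (Real.exp (b * z)), ← Real.exp_add, show b * z + -b * (z + x) = -b * x by ring,
        show -z - x = -(z + x) by ring]
      ring
    have e := integral_Ioi_of_hasDerivAt_of_tendsto' hd ((i1.const_mul _).add (i2.const_mul _)) l1
    rw [integral_add (i1.const_mul _) (i2.const_mul _), integral_const_mul, integral_const_mul] at e
    simp only [mul_zero, Real.exp_zero, add_zero, one_mul, zero_sub] at e
    rw [integral_innerIntegrand, expBackward_eq, _root_.expForward, neg_neg]
    linarith
  have hab : a + b ≠ 0 := by positivity
  have hG : ∀ z, 0 < z → HasDerivAt (fun z => Real.exp (a * z) * ouCov a b k z)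
      (c * outerIntegrand a b h z) z := by
    intro z hz
    have e1 : HasDerivAt (fun z => Real.exp (a * z)) (Real.exp (a * z) * a) z := by
      simpa using ((hasDerivAt_id z).const_mul a).exp
    have e2 := (hκ z hz).fun_neg.fun_add
      ((((hP z).const_mul (a ^ 2)).fun_add ((hQ z).const_mul (b ^ 2))).div_const (a + b))
    refine (e1.fun_mul e2).congr_deriv ?_
    rw [outerIntegrand, mul_left_comm, hW z hz]
    field_simp
    ring
  have hcont : Continuous fun z => Real.exp (a * z) * ouCov a b k z := by
    have c1 := hk.continuous
    have c2 : Continuous fun z => _root_.expForward a (-z) k :=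
      continuous_iff_continuousAt.2 fun z => (hP z).continuousAt
    have c3 : Continuous fun z => expBackward b (-z) k :=
      continuous_iff_continuousAt.2 fun z => (hQ z).continuousAt
    unfold ouCov
    fun_prop
  have hI := intervalIntegral.integral_eq_sub_of_hasDerivAt_of_le hτ.le hcont.continuousOn
    (fun z hz => hG z hz.1)
    ((intervalIntegrable_outerIntegrand hb h0 hh hτ).const_mul c)
  rw [intervalIntegral.integral_const_mul] at hI
  rw [crossI, mul_assoc, hI, ← mul_add, mul_zero, Real.exp_zero, one_mul, add_sub_cancel,
    ← mul_assoc, ← Real.exp_add]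
  simp

/-! ### Power and logarithmic kernels -/

/-- The kernel `(ρ - sgn w η) |w| ^ h / 2`. -/
noncomputable def powKernel (ρ η h w : ℝ) : ℝ := (ρ - sgn w * η) * |w| ^ h / 2

/-- The kernel `(ρ |w| + η w log |w|) / 2`. -/
noncomputable def logKernel (ρ η w : ℝ) : ℝ := (ρ * |w| + η * (w * Real.log |w|)) / 2

lemma powKernel_of_nonneg (ρ η h : ℝ) {w : ℝ} (hw : 0 ≤ w) :
    powKernel ρ η h w = (ρ - η) / 2 * w ^ h := by
  rw [powKernel, sgn, if_pos hw, abs_of_nonneg hw]; ring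

lemma powKernel_neg (ρ η : ℝ) {h : ℝ} (h0 : 0 < h) (w : ℝ) :
    powKernel ρ η h (-w) = powKernel ρ (-η) h w := by
  have := sgn_mul_rpow_neg h0 w
  rw [abs_neg] at this
  rw [powKernel, powKernel, abs_neg]
  linear_combination (-η / 2) * this

lemma quadGrowth_powKernel (ρ η : ℝ) {h : ℝ} (h0 : 0 < h) (h2 : h ≤ 2) :
    QuadGrowth (powKernel ρ η h) := by
  refine ⟨?_, (|ρ| + |η|) / 2, fun w => ?_⟩
  · have e : powKernel ρ η h = fun w =>
        (ρ - η) / 2 * (max w 0) ^ h + (ρ + η) / 2 * (max (-w) 0) ^ h := by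
      funext w
      rcases le_total 0 w with hw | hw
      · rw [powKernel_of_nonneg _ _ _ hw, max_eq_left hw, max_eq_right (by linarith),
          Real.zero_rpow h0.ne']
        ring
      · have := powKernel_neg ρ η h0 (-w)
        rw [neg_neg] at this
        rw [this, powKernel_of_nonneg _ _ _ (by linarith : 0 ≤ -w), max_eq_right hw,
          max_eq_left (by linarith), Real.zero_rpow h0.ne']
        ring
    rw [e]
    have : ∀ f : ℝ → ℝ, Continuous f → Continuous fun w => f w ^ h := fun f hf =>
      hf.rpow_const fun _ => Or.inr h0.le
    exact ((this _ (by fun_prop)).const_mul _).add ((this _ (by fun_prop)).const_mul _)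
  · have h1 : |ρ - sgn w * η| ≤ |ρ| + |η| := by
      have : |sgn w| = 1 := by
        unfold sgn
        split_ifs <;> simp
      have h3 := abs_sub ρ (sgn w * η)
      rwa [abs_mul, this, one_mul] at h3
    have h3 := abs_rpow_le_one_add_sq h0.le h2 w
    have h4 : 0 ≤ |w| ^ h := by positivity
    rw [powKernel, abs_div, abs_mul, abs_of_nonneg h4, abs_of_pos (by norm_num : (0 : ℝ) < 2)]
    have := mul_le_mul h1 h3 h4 (by positivity)
    linarith

lemma logKernel_neg (ρ η w : ℝ) : logKernel ρ η (-w) = logKernel ρ (-η) w := by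
  rw [logKernel, logKernel, abs_neg]; ring

lemma quadGrowth_logKernel (ρ η : ℝ) : QuadGrowth (logKernel ρ η) := by
  refine ⟨?_, (|ρ| + |η|) / 2, fun w => ?_⟩
  · unfold logKernel
    simp only [Real.log_abs]
    have := Real.continuous_mul_log
    fun_prop
  · have h1 : |w| ≤ 1 + w ^ 2 := by nlinarith [sq_nonneg (|w| - 1), sq_abs w]
    have h2 : |w * Real.log w| ≤ 1 + w ^ 2 := by
      rcases eq_or_ne w 0 with rfl | hw
      · simp
      have hw' := abs_pos.2 hw
      rw [← Real.log_abs, abs_mul]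
      rcases le_total |w| 1 with h | h
      · have := (Real.abs_log_mul_self_lt |w| hw' h).le
        rw [abs_mul, abs_abs] at this
        nlinarith [sq_nonneg w]
      · have h3 := Real.log_le_self hw'.le
        have h4 := Real.log_nonneg h
        rw [abs_of_nonneg h4]
        nlinarith [sq_abs w]
    rw [logKernel, abs_div, abs_of_pos (by norm_num : (0 : ℝ) < 2), Real.log_abs]
    have h3 := abs_add_le (ρ * |w|) (η * (w * Real.log w))
    rw [abs_mul, abs_abs, abs_mul] at h3
    have h4 := mul_le_mul_of_nonneg_left h1 (abs_nonneg ρ)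
    have h5 := mul_le_mul_of_nonneg_left h2 (abs_nonneg η)
    linarith

lemma expForward_powKernel_zero (ρ η : ℝ) {a h : ℝ} (ha : 0 < a) (h0 : 0 < h) :
    expForward a 0 (powKernel ρ η h) = (ρ - η) / 2 * (Real.Gamma (h + 1) * a ^ (-(h + 1))) := by
  have e := Real.integral_rpow_mul_exp_neg_mul_Ioi (a := h + 1) (r := a) (by linarith) ha
  rw [one_div, Real.inv_rpow ha.le, ← Real.rpow_neg ha.le, mul_comm, add_sub_cancel_right] at e
  rw [← e, ← integral_const_mul, expForward]
  refine setIntegral_congr_fun measurableSet_Ioi fun x (hx : 0 < x) => ?_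
  simp only [zero_add]
  rw [powKernel_of_nonneg _ _ _ hx.le]
  ring_nf

lemma expBackward_powKernel_zero (ρ η : ℝ) {b h : ℝ} (hb : 0 < b) (h0 : 0 < h) :
    expBackward b 0 (powKernel ρ η h) = (ρ + η) / 2 * (Real.Gamma (h + 1) * b ^ (-(h + 1))) := by
  rw [expBackward_eq]
  simp_rw [powKernel_neg _ _ h0]
  rw [neg_zero, expForward_powKernel_zero _ _ hb h0, sub_neg_eq_add]

lemma ouCov_powKernel_zero (ρ η : ℝ) {a b h : ℝ} (ha : 0 < a) (hb : 0 < b) (h0 : 0 < h) :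
    ouCov a b (powKernel ρ η h) 0 = Real.Gamma (h + 1) / (2 * (a + b)) *
      ((a ^ (1 - h) + b ^ (1 - h)) * ρ + (b ^ (1 - h) - a ^ (1 - h)) * η) := by
  have hp : ∀ a : ℝ, 0 < a → a ^ (1 - h) = a ^ 2 * a ^ (-(h + 1)) := fun a ha => by
    rw [← Real.rpow_two, ← Real.rpow_add ha]
    congr 1
    ring
  rw [ouCov, neg_zero, expForward_powKernel_zero _ _ ha h0, expBackward_powKernel_zero _ _ hb h0,
    powKernel_of_nonneg _ _ _ le_rfl, Real.zero_rpow h0.ne', hp a ha, hp b hb]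
  have : a + b ≠ 0 := by positivity
  field_simp
  ring

lemma expForward_logKernel_zero (ρ η : ℝ) {a : ℝ} (ha : 0 < a) :
    expForward a 0 (logKernel ρ η) = (ρ + η * ((∫ x in Set.Ioi (0 : ℝ),
      Real.exp (-x) * (x * Real.log x)) - Real.log a)) / (2 * a ^ 2) := by
  have hg : ∀ r : ℝ, 0 < r → ∫ x in Set.Ioi (0 : ℝ), Real.exp (-r * x) * x = 1 / r ^ 2 := by
    intro r hr
    have e := Real.integral_rpow_mul_exp_neg_mul_Ioi (a := 2) (r := r) (by norm_num) hr
    rw [Real.Gamma_two, mul_one] at e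
    norm_num at e
    rw [one_div, ← e]
    congr with x
    rw [neg_mul, mul_comm]
  have q1 : QuadGrowth fun x : ℝ => x := ⟨continuous_id, 1, fun u => by
    nlinarith [sq_nonneg (|u| - 1), sq_abs u]⟩
  have q2 : QuadGrowth fun x : ℝ => x * Real.log x := by
    have := (quadGrowth_logKernel 0 2)
    convert this using 2 with x
    rw [logKernel, Real.log_abs]
    ring
  have hi1 : IntegrableOn (fun x => Real.exp (-a * x) * x) (Set.Ioi 0) := by
    simpa using q1.integrableOn_forward ha 0
  have hi2 : ∀ r : ℝ, 0 < r → IntegrableOn (fun x => Real.exp (-r * x) * (x * Real.log x))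
      (Set.Ioi 0) := fun r hr => by
    simpa using q2.integrableOn_forward hr 0
  have hlog : ∫ x in Set.Ioi (0 : ℝ), Real.exp (-a * x) * (x * Real.log x) =
      ((∫ x in Set.Ioi (0 : ℝ), Real.exp (-x) * (x * Real.log x)) - Real.log a) / a ^ 2 := by
    have e := integral_comp_mul_left_Ioi (fun x => Real.exp (-x) * (x * Real.log x)) 0 ha
    rw [mul_zero, smul_eq_mul] at e
    have e2 : ∫ x in Set.Ioi (0 : ℝ), Real.exp (-(a * x)) * (a * x * Real.log (a * x)) =
        ∫ x in Set.Ioi (0 : ℝ), (a * (Real.exp (-a * x) * (x * Real.log x)) +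
          a * Real.log a * (Real.exp (-a * x) * x)) := by
      refine setIntegral_congr_fun measurableSet_Ioi fun x (hx : 0 < x) => ?_
      rw [Real.log_mul ha.ne' hx.ne', neg_mul]
      ring
    rw [e2, integral_add ((hi2 a ha).const_mul _) (hi1.const_mul _), integral_const_mul,
      integral_const_mul, hg a ha] at e
    field_simp at e ⊢
    linarith
  have e : expForward a 0 (logKernel ρ η) = ∫ x in Set.Ioi (0 : ℝ),
      (ρ / 2 * (Real.exp (-a * x) * x) + η / 2 * (Real.exp (-a * x) * (x * Real.log x))) := by
    rw [expForward]
    refine setIntegral_congr_fun measurableSet_Ioi fun x (hx : 0 < x) => ?_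
    simp only [zero_add]
    rw [logKernel, abs_of_pos hx]
    ring
  rw [e, integral_add (hi1.const_mul _) ((hi2 a ha).const_mul _), integral_const_mul,
    integral_const_mul, hg a ha, hlog]
  field_simp

lemma ouCov_logKernel_zero (ρ η : ℝ) {a b : ℝ} (ha : 0 < a) (hb : 0 < b) :
    ouCov a b (logKernel ρ η) 0 =
      1 / (a + b) * (ρ + η / 2 * (Real.log b - Real.log a)) := by
  rw [ouCov, neg_zero, expBackward_eq]
  simp_rw [logKernel_neg]
  rw [neg_zero, expForward_logKernel_zero _ _ ha, expForward_logKernel_zero _ _ hb]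
  simp only [logKernel, abs_zero, zero_mul, mul_zero, add_zero, zero_div, neg_zero, zero_add]
  have : a + b ≠ 0 := by positivity
  field_simp
  ring

lemma ouCov_powKernel (ρ η : ℝ) {a b h τ : ℝ} (ha : 0 < a) (hb : 0 < b) (h0 : 0 < h) (h2 : h < 2)
    (hτ : 0 < τ) : ouCov a b (powKernel ρ η h) τ =
      Real.exp (-a * τ) * ouCov a b (powKernel ρ η h) 0 +
      Real.exp (-a * τ) * (h * (h - 1) * ((ρ + η) / 2)) * crossI a b h τ := by
  refine (quadGrowth_powKernel ρ η h0 h2.le).ouCov_eq_of_hasDerivAt ha hb h0 h2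
    (κ' := fun x => (ρ + η) / 2 * (h * x ^ (h - 1))) (fun x hx => ?_) (fun x hx => ?_) ?_ hτ
  · have e := (Real.hasDerivAt_rpow_const (p := h) (Or.inl hx.ne')).const_mul ((ρ + η) / 2)
    refine e.congr_of_eventuallyEq ?_
    filter_upwards [lt_mem_nhds hx] with y hy
    rw [powKernel_neg _ _ h0, powKernel_of_nonneg _ _ _ (le_of_lt hy), sub_neg_eq_add]
  · have e := ((Real.hasDerivAt_rpow_const (p := h - 1) (Or.inl hx.ne')).const_mul h).const_mul
      ((ρ + η) / 2)
    refine e.congr_deriv ?_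
    rw [show h - 1 - 1 = h - 2 by ring]
    ring
  · have := (tendsto_rpow_mul_exp_neg_mul_atTop_nhds_zero (h - 1) b hb).const_mul
      ((ρ + η) / 2 * h)
    rw [mul_zero] at this
    refine this.congr fun x => ?_
    ring

lemma ouCov_logKernel (ρ η : ℝ) {a b τ : ℝ} (ha : 0 < a) (hb : 0 < b)
    (hτ : 0 < τ) : ouCov a b (logKernel ρ η) τ =
      Real.exp (-a * τ) * ouCov a b (logKernel ρ η) 0 +
      Real.exp (-a * τ) * (-(η / 2)) * crossI a b 1 τ := by
  refine (quadGrowth_logKernel ρ η).ouCov_eq_of_hasDerivAt ha hb one_pos one_lt_two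
    (κ' := fun x => ρ / 2 - η / 2 * (Real.log x + 1)) (fun x hx => ?_) (fun x hx => ?_) ?_ hτ
  · have e := ((hasDerivAt_id x).const_mul (ρ / 2)).fun_sub
      ((Real.hasDerivAt_mul_log hx.ne').const_mul (η / 2))
    rw [mul_one] at e
    refine e.congr_of_eventuallyEq ?_
    filter_upwards [lt_mem_nhds hx] with y hy
    rw [logKernel_neg, logKernel, abs_of_pos hy]
    simp only [id]
    ring
  · have e := (((Real.hasDerivAt_log hx.ne').add_const 1).const_mul (η / 2)).const_sub (ρ / 2)
    refine e.congr_deriv ?_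
    rw [show (1 : ℝ) - 2 = -1 by norm_num, Real.rpow_neg_one]
    ring
  · have t1 := tendsto_rpow_mul_exp_neg_mul_atTop_nhds_zero 1 b hb
    have t0 := tendsto_rpow_mul_exp_neg_mul_atTop_nhds_zero 0 b hb
    simp only [Real.rpow_one, Real.rpow_zero, one_mul] at t1 t0
    have t2 : Tendsto (fun x => Real.log x * Real.exp (-b * x)) atTop (𝓝 0) := by
      refine squeeze_zero' (g := fun x => x * Real.exp (-b * x)) ?_ ?_ t1
      · filter_upwards [eventually_ge_atTop 1] with x hx
        exact mul_nonneg (Real.log_nonneg hx) (Real.exp_pos _).le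
      · filter_upwards [eventually_ge_atTop 1] with x hx
        exact mul_le_mul_of_nonneg_right (Real.log_le_self (by linarith)) (Real.exp_pos _).le
    have t3 := (t0.const_mul (ρ / 2 - η / 2)).sub (t2.const_mul (η / 2))
    simp only [mul_zero, sub_zero] at t3
    refine t3.congr fun x => ?_
    ring

/-! ### Spectral representation -/

/-- The constant `∫_0^∞ (1 - cos x) x^{-1 - 2H} dx`. -/
noncomputable def cosConst (H : ℝ) : ℝ :=
  ∫ x in Set.Ioi (0 : ℝ), (1 - Real.cos x) * x ^ (-1 - 2 * H)

lemma integrableOn_one_sub_cos {H : ℝ} (hH : H ∈ Set.Ioo (0 : ℝ) 1) :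
    IntegrableOn (fun x : ℝ => (1 - Real.cos x) * x ^ (-1 - 2 * H)) (Set.Ioi 0) := by
  have hm : Measurable fun x : ℝ => (1 - Real.cos x) * x ^ (-1 - 2 * H) := by fun_prop
  rw [← Set.Ioc_union_Ioi_eq_Ioi zero_le_one]
  refine IntegrableOn.union ?_ ?_
  · have h1 := intervalIntegral.intervalIntegrable_rpow' (a := 0) (b := 1) (r := 1 - 2 * H)
      (by linarith [hH.2])
    rw [intervalIntegrable_iff_integrableOn_Ioc_of_le zero_le_one] at h1
    refine Integrable.mono' h1 hm.aestronglyMeasurable ?_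
    refine (ae_restrict_mem measurableSet_Ioc).mono fun x hx => ?_
    have hx0 : 0 < x := hx.1
    have h2 : 1 - Real.cos x ≤ x ^ 2 := by
      nlinarith [Real.one_sub_sq_div_two_le_cos (x := x), sq_nonneg x]
    have h3 : 0 ≤ 1 - Real.cos x := by linarith [Real.cos_le_one x]
    rw [Real.norm_of_nonneg (mul_nonneg h3 (by positivity))]
    calc _ ≤ x ^ 2 * x ^ (-1 - 2 * H) := by gcongr
      _ = x ^ (1 - 2 * H) := by
        rw [← Real.rpow_two, ← Real.rpow_add hx0]
        congr 1
        ring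
  · have h1 := (integrableOn_Ioi_rpow_of_lt (a := -1 - 2 * H) (by linarith [hH.1])
      one_pos).const_mul 2
    refine Integrable.mono' h1 hm.aestronglyMeasurable ?_
    refine (ae_restrict_mem measurableSet_Ioi).mono fun x (hx : 1 < x) => ?_
    have h3 : 0 ≤ 1 - Real.cos x := by linarith [Real.cos_le_one x]
    rw [Real.norm_of_nonneg (mul_nonneg h3 (by positivity))]
    have : 1 - Real.cos x ≤ 2 := by linarith [Real.neg_one_le_cos x]
    gcongr

lemma integrableOn_one_sub_cos_mul {H : ℝ} (hH : H ∈ Set.Ioo (0 : ℝ) 1) (w : ℝ) :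
    IntegrableOn (fun x : ℝ => (1 - Real.cos (w * x)) * x ^ (-1 - 2 * H)) (Set.Ioi 0) := by
  rcases eq_or_ne w 0 with rfl | hw
  · simp
  have hw' := abs_pos.2 hw
  have h1 := (integrableOn_Ioi_comp_mul_left_iff
    (fun x : ℝ => (1 - Real.cos x) * x ^ (-1 - 2 * H)) 0 hw').2 (by
      rw [mul_zero]; exact integrableOn_one_sub_cos hH)
  have h2 := h1.const_mul (|w| ^ (1 + 2 * H))
  refine IntegrableOn.congr_fun (s := Set.Ioi 0) h2 (fun x (hx : 0 < x) => ?_) measurableSet_Ioi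
  rw [Real.mul_rpow hw'.le hx.le, show |w| * x = |w * x| by rw [abs_mul, abs_of_pos hx],
    Real.cos_abs, mul_left_comm, ← mul_assoc (|w| ^ (1 + 2 * H)), ← Real.rpow_add hw']
  norm_num

lemma integral_one_sub_cos_mul {H : ℝ} (hH : H ∈ Set.Ioo (0 : ℝ) 1) (w : ℝ) :
    ∫ x in Set.Ioi (0 : ℝ), (1 - Real.cos (w * x)) * x ^ (-1 - 2 * H) =
      |w| ^ (2 * H) * cosConst H := by
  rcases eq_or_ne w 0 with rfl | hw
  · have : 2 * H ≠ 0 := by have := hH.1; positivity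
    simp [Real.zero_rpow this]
  have hw' := abs_pos.2 hw
  have h1 := integral_comp_mul_left_Ioi
    (fun x : ℝ => (1 - Real.cos x) * x ^ (-1 - 2 * H)) 0 hw'
  rw [mul_zero, smul_eq_mul] at h1
  rw [cosConst, show |w| ^ (2 * H) = |w| ^ (1 + 2 * H) * |w|⁻¹ by
    rw [← Real.rpow_neg_one, ← Real.rpow_add hw']; congr 1; ring, mul_assoc, ← h1,
    ← integral_const_mul]
  refine setIntegral_congr_fun measurableSet_Ioi fun x (hx : 0 < x) => ?_
  rw [Real.mul_rpow hw'.le hx.le, show |w| * x = |w * x| by rw [abs_mul, abs_of_pos hx],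
    Real.cos_abs, mul_left_comm, ← mul_assoc (|w| ^ (1 + 2 * H)), ← Real.rpow_add hw']
  norm_num

lemma integral_exp_mul_cos {a : ℝ} (ha : 0 < a) (x : ℝ) :
    IntegrableOn (fun y => Real.exp (-a * y) * Real.cos (y * x)) (Set.Ioi 0) ∧
    ∫ y in Set.Ioi (0 : ℝ), Real.exp (-a * y) * Real.cos (y * x) = a / (a ^ 2 + x ^ 2) := by
  have hi : IntegrableOn (fun y => Real.exp (-a * y) * Real.cos (y * x)) (Set.Ioi 0) := by
    refine Integrable.mono' (integrableOn_exp_mul_Ioi (by linarith : -a < 0) 0)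
      (by fun_prop : Continuous _).aestronglyMeasurable (ae_of_all _ fun y => ?_)
    rw [norm_mul, Real.norm_of_nonneg (Real.exp_pos _).le]
    exact mul_le_of_le_one_right (Real.exp_pos _).le (Real.abs_cos_le_one _)
  refine ⟨hi, ?_⟩
  have hpos : 0 < a ^ 2 + x ^ 2 := by positivity
  have hd : ∀ y ∈ Set.Ici (0 : ℝ), HasDerivAt
      (fun y => Real.exp (-a * y) * ((-a * Real.cos (y * x) + x * Real.sin (y * x)) /
        (a ^ 2 + x ^ 2))) (Real.exp (-a * y) * Real.cos (y * x)) y := by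
    intro y _
    have e1 : HasDerivAt (fun y => Real.exp (-a * y)) (Real.exp (-a * y) * (-a)) y := by
      simpa using ((hasDerivAt_id y).const_mul (-a)).exp
    have e2 : HasDerivAt (fun y => y * x) x y := by simpa using (hasDerivAt_id y).mul_const x
    have e3 := ((e2.cos.const_mul (-a)).fun_add (e2.sin.const_mul x)).div_const (a ^ 2 + x ^ 2)
    refine (e1.fun_mul e3).congr_deriv ?_
    field_simp
    ring
  have hl : Tendsto (fun y => Real.exp (-a * y) * ((-a * Real.cos (y * x) + x * Real.sin (y * x)) /
        (a ^ 2 + x ^ 2))) atTop (𝓝 0) := by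
    have t0 : Tendsto (fun y => Real.exp (-a * y)) atTop (𝓝 0) :=
      Real.tendsto_exp_atBot.comp (tendsto_id.const_mul_atTop_of_neg (by linarith : -a < 0))
    refine t0.zero_mul_isBoundedUnder_le ?_
    refine isBoundedUnder_of ⟨(a + |x|) / (a ^ 2 + x ^ 2), fun y => ?_⟩
    simp only [Function.comp, Real.norm_eq_abs, abs_div, abs_of_pos hpos]
    gcongr
    refine (abs_add_le _ _).trans ?_
    rw [abs_mul, abs_mul, abs_neg, abs_of_pos ha]
    have c1 := Real.abs_cos_le_one (y * x)
    have c2 := Real.abs_sin_le_one (y * x)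
    have := abs_nonneg x
    nlinarith
  rw [integral_Ioi_of_hasDerivAt_of_tendsto' hd hi hl]
  simp
  ring

/-- Exchanging the order of integration in the average of
`|w| ^ (2H) cosConst H = ∫_0^∞ (1 - cos (w x)) x^{-1 - 2H} dx` over `w = y ± τ` with weight
`e^{-a y}`. -/
lemma integral_exp_mul_abs_rpow {H : ℝ} (hH : H ∈ Set.Ioo (0 : ℝ) 1) {a : ℝ} (ha : 0 < a) (τ : ℝ) :
    IntegrableOn (fun x : ℝ => (1 - a ^ 2 / (a ^ 2 + x ^ 2) * Real.cos (τ * x)) *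
      x ^ (-1 - 2 * H)) (Set.Ioi 0) ∧
    a * ((∫ y in Set.Ioi (0 : ℝ), Real.exp (-a * y) * ((|y - τ| ^ (2 * H) + |y + τ| ^ (2 * H)) / 2))
      * cosConst H) =
    ∫ x in Set.Ioi (0 : ℝ), (1 - a ^ 2 / (a ^ 2 + x ^ 2) * Real.cos (τ * x)) *
      x ^ (-1 - 2 * H) := by
  obtain ⟨f, hf⟩ : ∃ f : ℝ → ℝ → ℝ, ∀ y x, f y x =
      Real.exp (-a * y) * ((1 - Real.cos (y * x) * Real.cos (τ * x)) * x ^ (-1 - 2 * H)) :=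
    ⟨_, fun _ _ => rfl⟩
  have hsplit : ∀ y x, f y x = Real.exp (-a * y) / 2 *
      ((1 - Real.cos ((y - τ) * x)) * x ^ (-1 - 2 * H) +
        (1 - Real.cos ((y + τ) * x)) * x ^ (-1 - 2 * H)) := by
    intro y x
    rw [hf, sub_mul y, add_mul y, Real.cos_sub, Real.cos_add]
    ring
  have hxint : ∀ y, IntegrableOn (f y) (Set.Ioi 0) := fun y => by
    have e : f y = fun x => Real.exp (-a * y) / 2 *
      ((1 - Real.cos ((y - τ) * x)) * x ^ (-1 - 2 * H) +
        (1 - Real.cos ((y + τ) * x)) * x ^ (-1 - 2 * H)) := funext (hsplit y)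
    rw [e]
    exact ((integrableOn_one_sub_cos_mul hH _).add (integrableOn_one_sub_cos_mul hH _)).const_mul _
  have hxval : ∀ y, ∫ x in Set.Ioi (0 : ℝ), f y x =
      Real.exp (-a * y) * ((|y - τ| ^ (2 * H) + |y + τ| ^ (2 * H)) / 2) * cosConst H := by
    intro y
    simp_rw [hsplit]
    rw [integral_const_mul, integral_add (integrableOn_one_sub_cos_mul hH _)
      (integrableOn_one_sub_cos_mul hH _), integral_one_sub_cos_mul hH, integral_one_sub_cos_mul hH]
    ring
  -- The integrand is nonnegative, so iterated integrability gives joint integrability.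
  have hnn : ∀ y x, 0 < x → 0 ≤ f y x := by
    intro y x hx
    rw [hsplit]
    have c1 := Real.cos_le_one ((y - τ) * x)
    have c2 := Real.cos_le_one ((y + τ) * x)
    have : 0 ≤ x ^ (-1 - 2 * H) := by positivity
    exact mul_nonneg (by positivity) (add_nonneg (mul_nonneg (by linarith) this)
      (mul_nonneg (by linarith) this))
  have hmeas : Measurable (Function.uncurry f) := by
    have e : Function.uncurry f = fun p : ℝ × ℝ => Real.exp (-a * p.1) *
        ((1 - Real.cos (p.1 * p.2) * Real.cos (τ * p.2)) * p.2 ^ (-1 - 2 * H)) := by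
      funext p
      exact hf p.1 p.2
    rw [e]
    fun_prop
  have hq : QuadGrowth fun y : ℝ => |y| ^ (2 * H) := by
    have := quadGrowth_powKernel 2 0 (h := 2 * H) (by linarith [hH.1]) (by linarith [hH.2])
    convert this using 2 with y
    rw [powKernel]
    ring
  have hyint : IntegrableOn (fun y => ∫ x in Set.Ioi (0 : ℝ), f y x) (Set.Ioi 0) := by
    simp_rw [hxval]
    have i1 := hq.integrableOn_forward ha (-τ)
    have i2 := hq.integrableOn_forward ha τ
    have i3 := ((i1.add i2).div_const 2).mul_const (cosConst H)
    refine IntegrableOn.congr_fun (s := Set.Ioi 0) i3 (fun y _ => ?_) measurableSet_Ioi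
    simp only [Pi.add_apply]
    rw [show -τ + y = y - τ by ring, add_comm τ y]
    ring
  have hprod : Integrable (Function.uncurry f)
      ((volume.restrict (Set.Ioi 0)).prod (volume.restrict (Set.Ioi 0))) := by
    rw [integrable_prod_iff hmeas.aestronglyMeasurable]
    refine ⟨ae_of_all _ fun y => hxint y, hyint.congr (ae_of_all _ fun y => ?_)⟩
    refine setIntegral_congr_fun measurableSet_Ioi fun x hx => ?_
    exact (Real.norm_of_nonneg (hnn y x hx)).symm
  have hyval : ∀ x, ∫ y in Set.Ioi (0 : ℝ), f y x =
      a⁻¹ * ((1 - a ^ 2 / (a ^ 2 + x ^ 2) * Real.cos (τ * x)) * x ^ (-1 - 2 * H)) := by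
    intro x
    obtain ⟨i1, e1⟩ := integral_exp_mul_cos ha x
    have i0 := integrableOn_exp_mul_Ioi (by linarith : -a < 0) 0
    have e0 : ∫ y in Set.Ioi (0 : ℝ), Real.exp (-a * y) = 1 / a := by
      rw [integral_exp_mul_Ioi (by linarith)]
      simp
    have e : ∀ y, f y x = x ^ (-1 - 2 * H) * (Real.exp (-a * y) -
        Real.cos (τ * x) * (Real.exp (-a * y) * Real.cos (y * x))) := fun y => by
      rw [hf]; ring
    simp_rw [e]
    rw [integral_const_mul, integral_sub i0 (i1.const_mul _), integral_const_mul, e0, e1]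
    have : a ^ 2 + x ^ 2 ≠ 0 := by positivity
    field_simp
  have hint2 := hprod.integral_prod_right
  have hswap := integral_integral_swap hprod
  simp only [Function.uncurry] at hint2
  simp_rw [hyval] at hint2 hswap
  simp_rw [hxval] at hswap
  rw [integral_mul_const, integral_const_mul] at hswap
  refine ⟨?_, ?_⟩
  · have := hint2.const_mul a
    refine this.congr (ae_of_all _ fun x => ?_)
    simp only
    rw [mul_inv_cancel_left₀ ha.ne']
  · rw [hswap, mul_inv_cancel_left₀ ha.ne']

/-- Writing `1 / (1 + x ^ 2) = ∫_0^∞ e^{-z (1 + x ^ 2)} dz` reduces the integral to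
`Γ(H) Γ(1 - H) / 2`. -/
lemma integral_rpow_div_one_add_sq {H : ℝ} (hH : H ∈ Set.Ioo (0 : ℝ) 1) :
    ∫ x in Set.Ioi (0 : ℝ), x ^ (1 - 2 * H) / (1 + x ^ 2) =
      Real.pi / (2 * Real.sin (Real.pi * H)) := by
  obtain ⟨f, hf⟩ : ∃ f : ℝ → ℝ → ℝ, ∀ z x, f z x =
      Real.exp (-z) * (x ^ (1 - 2 * H) * Real.exp (-z * x ^ (2 : ℝ))) := ⟨_, fun _ _ => rfl⟩
  have hxval : ∀ z : ℝ, 0 < z → ∫ x in Set.Ioi (0 : ℝ), f z x =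
      Real.exp (-z) * z ^ (H - 1) * (Real.Gamma (1 - H) / 2) := by
    intro z hz
    simp_rw [hf]
    rw [integral_const_mul, integral_rpow_mul_exp_neg_mul_rpow (by norm_num)
      (by linarith [hH.2]) hz, show -(1 - 2 * H + 1) / 2 = H - 1 by ring,
      show (1 - 2 * H + 1) / 2 = 1 - H by ring]
    ring
  have hyint : IntegrableOn (fun z => ∫ x in Set.Ioi (0 : ℝ), f z x) (Set.Ioi 0) :=
    IntegrableOn.congr_fun (s := Set.Ioi 0)
      ((Real.GammaIntegral_convergent hH.1).mul_const (Real.Gamma (1 - H) / 2))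
      (fun z hz => (hxval z hz).symm) measurableSet_Ioi
  have hprod : Integrable (Function.uncurry f)
      ((volume.restrict (Set.Ioi 0)).prod (volume.restrict (Set.Ioi 0))) := by
    have hmeas : Measurable (Function.uncurry f) := by
      have e : Function.uncurry f = fun p : ℝ × ℝ => Real.exp (-p.1) *
          (p.2 ^ (1 - 2 * H) * Real.exp (-p.1 * p.2 ^ (2 : ℝ))) := funext fun p => hf p.1 p.2
      rw [e]
      fun_prop
    rw [integrable_prod_iff hmeas.aestronglyMeasurable]
    refine ⟨(ae_restrict_mem measurableSet_Ioi).mono fun z (hz : 0 < z) => ?_,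
      hyint.congr (ae_of_all _ fun z => ?_)⟩
    · simp only [Function.uncurry, hf]
      exact (integrableOn_rpow_mul_exp_neg_mul_rpow (by linarith [hH.2]) (by norm_num) hz).const_mul _
    · refine setIntegral_congr_fun measurableSet_Ioi fun x (hx : 0 < x) => ?_
      simp only [Function.uncurry, hf]
      rw [Real.norm_of_nonneg (by positivity)]
  have hyval : ∀ x : ℝ, 0 < x → ∫ z in Set.Ioi (0 : ℝ), f z x = x ^ (1 - 2 * H) / (1 + x ^ 2) := by
    intro x hx
    have e : ∀ z, f z x = x ^ (1 - 2 * H) * Real.exp (-(1 + x ^ 2) * z) := fun z => by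
      rw [hf, mul_left_comm, ← Real.exp_add, Real.rpow_two]
      congr 2
      ring
    simp_rw [e]
    rw [integral_const_mul, integral_exp_mul_Ioi (by nlinarith [sq_nonneg x])]
    rw [mul_zero, Real.exp_zero, neg_div_neg_eq, mul_one_div]
  have hswap := integral_integral_swap hprod
  rw [setIntegral_congr_fun measurableSet_Ioi (fun z hz => hxval z hz),
    setIntegral_congr_fun measurableSet_Ioi (fun x hx => hyval x hx), integral_mul_const,
    ← Real.Gamma_eq_integral hH.1] at hswap
  rw [← hswap, ← mul_div_assoc, Real.Gamma_mul_Gamma_one_sub, div_div, mul_comm 2]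

/-- The Laplace transform at `1` of both sides of
`|w| ^ (2H) cosConst H = ∫_0^∞ (1 - cos (w x)) x^{-1 - 2H} dx` evaluates the constant. -/
lemma gamma_mul_cosConst {H : ℝ} (hH : H ∈ Set.Ioo (0 : ℝ) 1) :
    Real.Gamma (2 * H + 1) * cosConst H = Real.pi / (2 * Real.sin (Real.pi * H)) := by
  have h := (integral_exp_mul_abs_rpow hH one_pos 0).2
  rw [← integral_rpow_div_one_add_sq hH]
  have e1 : ∫ y in Set.Ioi (0 : ℝ), Real.exp (-1 * y) *
      ((|y - 0| ^ (2 * H) + |y + 0| ^ (2 * H)) / 2) = Real.Gamma (2 * H + 1) := by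
    rw [Real.Gamma_eq_integral (by linarith [hH.1])]
    refine setIntegral_congr_fun measurableSet_Ioi fun y (hy : 0 < y) => ?_
    simp only [sub_zero, add_zero, abs_of_pos hy, add_sub_cancel_right]
    ring_nf
  rw [e1, one_mul] at h
  rw [h]
  refine setIntegral_congr_fun measurableSet_Ioi fun x (hx : 0 < x) => ?_
  simp only [zero_mul, Real.cos_zero, mul_one, one_pow]
  rw [show (1 : ℝ) - 2 * H = 2 + (-1 - 2 * H) by ring, Real.rpow_add hx, Real.rpow_two]
  have : 1 + x ^ 2 ≠ 0 := by positivity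
  field_simp
  ring

lemma integrable_spectral_density {H : ℝ} (hH : H ∈ Set.Ioo (0 : ℝ) 1) {a : ℝ} (ha : 0 < a) :
    Integrable fun x : ℝ => |x| ^ (1 - 2 * H) / (a ^ 2 + x ^ 2) := by
  have hm : Measurable fun x : ℝ => |x| ^ (1 - 2 * H) / (a ^ 2 + x ^ 2) := by fun_prop
  have h0 : IntegrableOn (fun x : ℝ => |x| ^ (1 - 2 * H) / (a ^ 2 + x ^ 2)) (Set.Ioi 0) := by
    rw [← Set.Ioc_union_Ioi_eq_Ioi zero_le_one]
    refine IntegrableOn.union ?_ ?_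
    · have h1 := intervalIntegral.intervalIntegrable_rpow' (a := 0) (b := 1) (r := 1 - 2 * H)
        (by linarith [hH.2])
      rw [intervalIntegrable_iff_integrableOn_Ioc_of_le zero_le_one] at h1
      refine Integrable.mono' (h1.div_const (a ^ 2)) hm.aestronglyMeasurable ?_
      refine (ae_restrict_mem measurableSet_Ioc).mono fun x hx => ?_
      rw [Real.norm_of_nonneg (by positivity), abs_of_pos hx.1]
      have := hx.1
      gcongr
      nlinarith
    · have h1 := integrableOn_Ioi_rpow_of_lt (a := -1 - 2 * H) (by linarith [hH.1]) one_pos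
      refine Integrable.mono' h1 hm.aestronglyMeasurable ?_
      refine (ae_restrict_mem measurableSet_Ioi).mono fun x (hx : 1 < x) => ?_
      have hx0 : 0 < x := by linarith
      rw [Real.norm_of_nonneg (by positivity), abs_of_pos hx0, div_le_iff₀ (by positivity),
        show (1 : ℝ) - 2 * H = (-1 - 2 * H) + 2 by ring, Real.rpow_add hx0, Real.rpow_two]
      gcongr
      nlinarith
  rw [← integrableOn_univ, ← Set.Iic_union_Ioi (a := (0 : ℝ))]
  refine IntegrableOn.union ?_ h0
  rw [← integrableOn_Ici_iff_integrableOn_Ioi] at h0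
  have := (Measure.measurePreserving_neg (volume : Measure ℝ)).integrableOn_comp_preimage
    (MeasurableEquiv.neg ℝ).measurableEmbedding
    (f := fun x : ℝ => |x| ^ (1 - 2 * H) / (a ^ 2 + x ^ 2)) (s := Set.Ici 0)
  simpa [Function.comp_def] using this.2 h0

lemma integrable_spectralIntegrand {H : ℝ} (hH : H ∈ Set.Ioo (0 : ℝ) 1) {a : ℝ} (ha : 0 < a)
    (τ : ℝ) : Integrable (spectralIntegrand a H τ) := by
  refine (integrable_spectral_density hH ha).mono (by unfold spectralIntegrand; fun_prop :
    Measurable (spectralIntegrand a H τ)).aestronglyMeasurable (ae_of_all _ fun x => ?_)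
  rw [spectralIntegrand, norm_mul, mul_comm Complex.I, Complex.norm_exp_ofReal_mul_I, one_mul,
    Complex.norm_real]

/-- The imaginary part of the spectral integrand is odd and the real part is even. -/
lemma integral_spectralIntegrand {H : ℝ} (hH : H ∈ Set.Ioo (0 : ℝ) 1) {a : ℝ} (ha : 0 < a)
    (τ : ℝ) : ∫ x, spectralIntegrand a H τ x =
      ((2 * ∫ x in Set.Ioi (0 : ℝ), Real.cos (τ * x) * (x ^ (1 - 2 * H) / (a ^ 2 + x ^ 2)) : ℝ) :
        ℂ) := by
  have hi := integrable_spectralIntegrand hH ha τ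
  have h1 := integral_neg_eq_self (spectralIntegrand a H τ) volume
  have h2 : ∀ x, spectralIntegrand a H τ x + spectralIntegrand a H τ (-x) =
      ((2 * (Real.cos (τ * |x|) * (|x| ^ (1 - 2 * H) / (a ^ 2 + |x| ^ 2))) : ℝ) : ℂ) := by
    intro x
    have hcos : Real.cos (τ * |x|) = Real.cos (τ * x) := by
      rcases abs_choice x with h | h <;> rw [h]
      rw [mul_neg, Real.cos_neg]
    simp only [spectralIntegrand]
    rw [abs_neg, neg_sq, sq_abs, hcos, ← add_mul, mul_neg, Complex.ofReal_neg, mul_neg]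
    push_cast
    rw [mul_comm Complex.I, ← neg_mul, ← Complex.two_cos]
    ring
  have h3 : ∫ x, (spectralIntegrand a H τ x + spectralIntegrand a H τ (-x)) =
      2 * ∫ x, spectralIntegrand a H τ x := by
    rw [integral_add hi hi.comp_neg, h1]; ring
  simp_rw [h2] at h3
  rw [integral_complex_ofReal, integral_const_mul,
    integral_comp_abs (f := fun x => Real.cos (τ * x) * (x ^ (1 - 2 * H) / (a ^ 2 + x ^ 2)))] at h3
  have h4 : (2 : ℂ) ≠ 0 := two_ne_zero
  apply mul_left_cancel₀ h4
  rw [← h3]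
  push_cast
  ring

/-- The spectral representation of the autocovariance of the Ornstein-Uhlenbeck functional of
fractional Brownian motion. -/
lemma ouCov_eq_spectral {H : ℝ} (hH : H ∈ Set.Ioo (0 : ℝ) 1) {a : ℝ} (ha : 0 < a) (τ : ℝ) :
    ((ouCov a a (powKernel 1 0 (2 * H)) τ : ℝ) : ℂ) =
      ((Real.Gamma (2 * H + 1) * Real.sin (Real.pi * H) / (2 * Real.pi) : ℝ) : ℂ) *
        ∫ x, spectralIntegrand a H τ x := by
  rw [integral_spectralIntegrand hH ha]
  have hk : powKernel 1 0 (2 * H) = fun w => |w| ^ (2 * H) / 2 := by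
    funext w
    rw [powKernel]
    ring
  have hq : QuadGrowth (powKernel 1 0 (2 * H)) :=
    quadGrowth_powKernel 1 0 (by linarith [hH.1]) (by linarith [hH.2])
  obtain ⟨i1, e1⟩ := integral_exp_mul_abs_rpow hH ha τ
  have hsum : expForward a (-τ) (powKernel 1 0 (2 * H)) +
      expBackward a (-τ) (powKernel 1 0 (2 * H)) =
      ∫ y in Set.Ioi (0 : ℝ), Real.exp (-a * y) * ((|y - τ| ^ (2 * H) + |y + τ| ^ (2 * H)) / 2) := by
    rw [expForward, expBackward, ← integral_add (hq.integrableOn_forward ha _)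
      (hq.integrableOn ha _)]
    congr with y
    simp only [hk]
    rw [show -τ + y = y - τ by ring, show -τ - y = -(y + τ) by ring, abs_neg]
    ring
  have e2 := integral_one_sub_cos_mul hH τ
  have e3 : (∫ x in Set.Ioi (0 : ℝ), (1 - a ^ 2 / (a ^ 2 + x ^ 2) * Real.cos (τ * x)) *
      x ^ (-1 - 2 * H)) - ∫ x in Set.Ioi (0 : ℝ), (1 - Real.cos (τ * x)) * x ^ (-1 - 2 * H) =
      ∫ x in Set.Ioi (0 : ℝ), Real.cos (τ * x) * (x ^ (1 - 2 * H) / (a ^ 2 + x ^ 2)) := by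
    rw [← integral_sub i1 (integrableOn_one_sub_cos_mul hH τ)]
    refine setIntegral_congr_fun measurableSet_Ioi fun x (hx : 0 < x) => ?_
    rw [show (1 : ℝ) - 2 * H = 2 + (-1 - 2 * H) by ring, Real.rpow_add hx, Real.rpow_two]
    have : a ^ 2 + x ^ 2 ≠ 0 := by positivity
    field_simp
    ring
  have hsin : 0 < Real.sin (Real.pi * H) :=
    Real.sin_pos_of_pos_of_lt_pi (mul_pos Real.pi_pos hH.1) (by nlinarith [Real.pi_pos, hH.2])
  have hD := gamma_mul_cosConst hH
  rw [← Complex.ofReal_mul]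
  congr 1
  -- The singular parts of the two cosine representations cancel.
  have key : 2 * ouCov a a (powKernel 1 0 (2 * H)) τ * cosConst H =
      ∫ x in Set.Ioi (0 : ℝ), Real.cos (τ * x) * (x ^ (1 - 2 * H) / (a ^ 2 + x ^ 2)) := by
    rw [← e3, ← e1, e2, ouCov, ← mul_add, hsum, hk]
    simp only [abs_neg]
    field_simp
    ring
  rw [← key]
  rw [eq_div_iff (by positivity)] at hD
  rw [div_mul_eq_mul_div, eq_div_iff (by positivity)]
  linear_combination (-2 * ouCov a a (powKernel 1 0 (2 * H)) τ) * hD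

/-! ### Covariances and correlations of the Ornstein-Uhlenbeck process -/

section Moments

variable {Ω : Type*} [MeasurableSpace Ω] {μ : Measure Ω} [IsProbabilityMeasure μ] {d : ℕ}
  {H α ν : Fin d → ℝ} {B Y : ℝ → Ω → Fin d → ℝ} {ρ η : Fin d → Fin d → ℝ}

lemma IsMultivariateFOU.autocovariance (hH : ∀ i, H i ∈ Set.Ioo (0 : ℝ) 1) (hα : ∀ i, 0 < α i)
    (hB : IsMultivariateFBM H B μ) (hY : IsMultivariateFOU α ν B Y μ) (i : Fin d) (t s : ℝ) :
    cov[fun ω => Y t ω i, fun ω => Y s ω i; μ] =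
      ν i * ν i * ouCov (α i) (α i) (powKernel 1 0 (2 * H i)) (t - s) := by
  have hq := quadGrowth_powKernel 1 0 (h := 2 * H i) (by linarith [(hH i).1])
    (by linarith [(hH i).2])
  refine hY.covariance_eq_ouCov hH hα hB hq (q := powKernel 1 0 (2 * H i)) hq (fun u v => ?_) t s
  rw [(hB.component i).cov_eq, abs_sub_comm]
  simp only [powKernel]
  ring

lemma IsMultivariateFOU.crossCovariance_of_ne (hH : ∀ i, H i ∈ Set.Ioo (0 : ℝ) 1)
    (hα : ∀ i, 0 < α i) (hB : IsMultivariateFBM H B μ) (hY : IsMultivariateFOU α ν B Y μ)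
    (hP : IsCrossParam H B μ ρ η) {i j : Fin d} (hij : i ≠ j) (h1 : H i + H j ≠ 1) (t s : ℝ) :
    cov[fun ω => Y t ω i, fun ω => Y s ω j; μ] =
      ν i * ν j * ouCov (α i) (α j) (powKernel (ρ i j) (η i j) (H i + H j)) (t - s) := by
  have h0 : 0 < H i + H j := add_pos (hH i).1 (hH j).1
  have h2 : H i + H j ≤ 2 := by linarith [(hH i).2, (hH j).2]
  refine hY.covariance_eq_ouCov hH hα hB (quadGrowth_powKernel (ρ i j) (-η i j) h0 h2)
    (q := powKernel (ρ i j) (η i j) (H i + H j)) (quadGrowth_powKernel _ _ h0 h2)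
    (fun u v => ?_) t s
  rw [hP.cov_of_ne i j hij h1]
  simp only [powKernel]
  ring

lemma IsMultivariateFOU.crossCovariance_of_eq (hH : ∀ i, H i ∈ Set.Ioo (0 : ℝ) 1)
    (hα : ∀ i, 0 < α i) (hB : IsMultivariateFBM H B μ) (hY : IsMultivariateFOU α ν B Y μ)
    (hP : IsCrossParam H B μ ρ η) {i j : Fin d} (hij : i ≠ j) (h1 : H i + H j = 1) (t s : ℝ) :
    cov[fun ω => Y t ω i, fun ω => Y s ω j; μ] =
      ν i * ν j * ouCov (α i) (α j) (logKernel (ρ i j) (η i j)) (t - s) := by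
  refine hY.covariance_eq_ouCov hH hα hB (quadGrowth_logKernel (ρ i j) (-η i j))
    (q := logKernel (ρ i j) (η i j)) (quadGrowth_logKernel _ _) (fun u v => ?_) t s
  rw [hP.cov_of_eq i j hij h1]
  simp only [logKernel]
  ring

lemma IsMultivariateFOU.isStronglyStationary (hH : ∀ i, H i ∈ Set.Ioo (0 : ℝ) 1)
    (hα : ∀ i, 0 < α i) (hB : IsMultivariateFBM H B μ) (hY : IsMultivariateFOU α ν B Y μ) :
    IsStronglyStationary Y μ := by
  obtain ⟨ρ, η, hP⟩ := hB.exists_isCrossParam hH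
  refine isStronglyStationary_of_covariance (hY.isGaussianProcess hH hα hB)
    (hY.isCenteredGaussian hH hα hB) fun i j => ?_
  rcases eq_or_ne i j with rfl | hij
  · exact ⟨fun w => ν i * ν i * ouCov (α i) (α i) (powKernel 1 0 (2 * H i)) w,
      hY.autocovariance hH hα hB i⟩
  · by_cases h1 : H i + H j = 1
    · exact ⟨fun w => ν i * ν j * ouCov (α i) (α j) (logKernel (ρ i j) (η i j)) w,
        hY.crossCovariance_of_eq hH hα hB hP hij h1⟩
    · exact ⟨fun w => ν i * ν j * ouCov (α i) (α j) (powKernel (ρ i j) (η i j) (H i + H j)) w,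
        hY.crossCovariance_of_ne hH hα hB hP hij h1⟩

lemma IsMultivariateFOU.variance_eq (hH : ∀ i, H i ∈ Set.Ioo (0 : ℝ) 1) (hα : ∀ i, 0 < α i)
    (hB : IsMultivariateFBM H B μ) (hY : IsMultivariateFOU α ν B Y μ) (t : ℝ) (i : Fin d) :
    Var[fun ω => Y t ω i; μ] =
      (ν i / α i ^ H i) ^ 2 * (Real.Gamma (2 * H i + 1) / 2) := by
  have ha := hα i
  rw [← covariance_self (hY.isCenteredGaussian hH hα hB t i).gaussian.aemeasurable,
    hY.autocovariance hH hα hB, sub_self,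
    ouCov_powKernel_zero 1 0 ha ha (by linarith [(hH i).1]),
    show (1 : ℝ) - 2 * H i = 1 - H i - H i by ring, Real.rpow_sub ha, Real.rpow_sub ha,
    Real.rpow_one]
  have : α i ^ H i ≠ 0 := (Real.rpow_pos_of_pos ha _).ne'
  field_simp
  ring

lemma IsMultivariateFOU.variance_pos (hH : ∀ i, H i ∈ Set.Ioo (0 : ℝ) 1) (hα : ∀ i, 0 < α i)
    (hν : ∀ i, 0 < ν i) (hB : IsMultivariateFBM H B μ) (hY : IsMultivariateFOU α ν B Y μ) (t : ℝ)
    (i : Fin d) : 0 < Var[fun ω => Y t ω i; μ] := by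
  rw [hY.variance_eq hH hα hB]
  have h1 := Real.rpow_pos_of_pos (hα i) (H i)
  have h2 := Real.Gamma_pos_of_pos (s := 2 * H i + 1) (by linarith [(hH i).1])
  have h3 := hν i
  positivity

lemma IsMultivariateFOU.corr_eq (hH : ∀ i, H i ∈ Set.Ioo (0 : ℝ) 1) (hα : ∀ i, 0 < α i)
    (hν : ∀ i, 0 < ν i) (hB : IsMultivariateFBM H B μ) (hY : IsMultivariateFOU α ν B Y μ)
    {i j : Fin d} {t R : ℝ} (hR : cov[fun ω => Y t ω i, fun ω => Y t ω j; μ] = ν i * ν j * R) :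
    corr (fun ω => Y t ω i) (fun ω => Y t ω j) μ =
      1 / √(Real.Gamma (2 * H i + 1) * Real.Gamma (2 * H j + 1)) *
        (2 * α i ^ H i * α j ^ H j) * R := by
  have hi := Real.rpow_pos_of_pos (hα i) (H i)
  have hj := Real.rpow_pos_of_pos (hα j) (H j)
  have gi := Real.Gamma_pos_of_pos (s := 2 * H i + 1) (by linarith [(hH i).1])
  have gj := Real.Gamma_pos_of_pos (s := 2 * H j + 1) (by linarith [(hH j).1])
  have ni := hν i
  have nj := hν j
  have hs : √(Var[fun ω => Y t ω i; μ] * Var[fun ω => Y t ω j; μ]) =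
      ν i * ν j / (2 * α i ^ H i * α j ^ H j) *
        √(Real.Gamma (2 * H i + 1) * Real.Gamma (2 * H j + 1)) := by
    rw [hY.variance_eq hH hα hB, hY.variance_eq hH hα hB, ← Real.sqrt_sq
      (show 0 ≤ ν i * ν j / (2 * α i ^ H i * α j ^ H j) by positivity),
      ← Real.sqrt_mul (by positivity)]
    congr 1
    field_simp
  have hg : √(Real.Gamma (2 * H i + 1) * Real.Gamma (2 * H j + 1)) ≠ 0 :=
    (Real.sqrt_pos.2 (mul_pos gi gj)).ne'
  rw [corr, hR, hs]
  field_simp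

end Moments

theorem theorem2p2 {Ω : Type*} [MeasurableSpace Ω] (μ : Measure Ω) [IsProbabilityMeasure μ]
    (d : ℕ) (H α ν : Fin d → ℝ)
    (hH : ∀ i, H i ∈ Set.Ioo (0 : ℝ) 1 ∧ H i ≠ 1 / 2) (hα : ∀ i, 0 < α i) (hν : ∀ i, 0 < ν i)
    (B : ℝ → Ω → Fin d → ℝ) (hB : IsMultivariateFBM H B μ) :
    -- the cross-covariance parameters of `B` exist
    (∃ ρ η : Fin d → Fin d → ℝ, IsCrossParam H B μ ρ η) ∧
    -- almost surely, all the pathwise integrals defining the process exist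
    (∀ᵐ ω ∂μ, ∀ t i, ∃ J : ℝ,
      HasImproperRSIntegral (fun s => Real.exp (-α i * (t - s))) (fun s => B s ω i) t J) ∧
    ∀ Y : ℝ → Ω → Fin d → ℝ, IsMultivariateFOU α ν B Y μ →
      -- Gaussian, strongly stationary, centered, nondegenerate
      IsGaussianProcess Y μ ∧
      IsStronglyStationary Y μ ∧
      (∀ t i, Integrable (fun ω => Y t ω i) μ ∧ ∫ ω, Y t ω i ∂μ = 0) ∧
      (∀ t i, 0 < Var[fun ω => Y t ω i; μ]) ∧
      -- autocovariances
      (∀ i, ∀ t s : ℝ, s < t →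
        Integrable (spectralIntegrand (α i) (H i) (t - s)) ∧
        ((cov[fun ω => Y t ω i, fun ω => Y s ω i; μ] : ℝ) : ℂ) =
          ((ν i ^ 2 * (Real.Gamma (2 * H i + 1) * Real.sin (Real.pi * H i) / (2 * Real.pi)) : ℝ) : ℂ)
            * ∫ x : ℝ, spectralIntegrand (α i) (H i) (t - s) x) ∧
      -- the double integrals `I_{ij}` converge
      (∀ i j, i ≠ j →
        (∀ u : ℝ, 0 < u → IntegrableOn (innerIntegrand (α j) (H i + H j) u) (Set.Iic 0)) ∧
        (∀ τ : ℝ, 0 < τ →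
          IntervalIntegrable (outerIntegrand (α i) (α j) (H i + H j)) volume 0 τ)) ∧
      -- cross-covariances and correlations
      ∀ ρ η : Fin d → Fin d → ℝ, IsCrossParam H B μ ρ η → ∀ i j, i ≠ j →
        (H i + H j ≠ 1 →
          (∀ t s : ℝ, s < t →
            cov[fun ω => Y t ω i, fun ω => Y s ω j; μ] =
              Real.exp (-α i * (t - s)) * cov[fun ω => Y 0 ω i, fun ω => Y 0 ω j; μ]
              + ν i * ν j * Real.exp (-α i * (t - s)) * ((H i + H j) * (H i + H j - 1))
                * ((ρ i j + η i j) / 2) * crossI (α i) (α j) (H i + H j) (t - s)) ∧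
          cov[fun ω => Y 0 ω i, fun ω => Y 0 ω j; μ] =
            Real.Gamma (H i + H j + 1) * ν i * ν j / (2 * (α i + α j))
              * ((α i ^ (1 - (H i + H j)) + α j ^ (1 - (H i + H j))) * ρ i j
                + (α j ^ (1 - (H i + H j)) - α i ^ (1 - (H i + H j))) * η i j) ∧
          ∀ t : ℝ, corr (fun ω => Y t ω i) (fun ω => Y t ω j) μ =
            Real.Gamma (H i + H j + 1)
                / √(Real.Gamma (2 * H i + 1) * Real.Gamma (2 * H j + 1))
              * (α i ^ H i * α j ^ H j / (α i + α j))
              * ((α i ^ (1 - (H i + H j)) + α j ^ (1 - (H i + H j))) * ρ i j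
                + (α j ^ (1 - (H i + H j)) - α i ^ (1 - (H i + H j))) * η i j)) ∧
        (H i + H j = 1 →
          (∀ t s : ℝ, s < t →
            cov[fun ω => Y t ω i, fun ω => Y s ω j; μ] =
              Real.exp (-α i * (t - s)) * cov[fun ω => Y 0 ω i, fun ω => Y 0 ω j; μ]
              - ν i * ν j * Real.exp (-α i * (t - s)) * (η i j / 2)
                * crossI (α i) (α j) (H i + H j) (t - s)) ∧
          cov[fun ω => Y 0 ω i, fun ω => Y 0 ω j; μ] =
            ν i * ν j / (α i + α j)
              * (ρ i j + η i j / 2 * (Real.log (α j) - Real.log (α i))) ∧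
          ∀ t : ℝ, corr (fun ω => Y t ω i) (fun ω => Y t ω j) μ =
            1 / √(Real.Gamma (2 * H i + 1) * Real.Gamma (2 * H j + 1))
              * (2 * α i ^ H i * α j ^ H j / (α i + α j))
              * (ρ i j + η i j / 2 * (Real.log (α j) - Real.log (α i)))) := by
  have hH' : ∀ i, H i ∈ Set.Ioo (0 : ℝ) 1 := fun i => (hH i).1
  refine ⟨hB.exists_isCrossParam hH', ?_, fun Y hY => ?_⟩
  · filter_upwards [hB.ae_quadGrowth hH'] with ω hω t i
    exact ⟨_, (hω i).hasImproperRSIntegral (hα i) t⟩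
  have hc := hY.isCenteredGaussian hH' hα hB
  refine ⟨hY.isGaussianProcess hH' hα hB, hY.isStronglyStationary hH' hα hB,
    fun t i => ⟨(hc t i).gaussian.integrable, (hc t i).mean⟩, hY.variance_pos hH' hα hν hB,
    fun i t s _ => ⟨integrable_spectralIntegrand (hH' i) (hα i) _, ?_⟩,
    fun i j _ => ⟨fun u hu => integrableOn_innerIntegrand (hα j) ?_ hu,
      fun τ hτ => intervalIntegrable_outerIntegrand (hα j) ?_ ?_ hτ⟩,
    fun ρ η hP i j hij => ⟨fun h1 => ?_, fun h1 => ?_⟩⟩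
  · rw [hY.autocovariance hH' hα hB, Complex.ofReal_mul, ouCov_eq_spectral (hH' i) (hα i),
      ← mul_assoc, ← Complex.ofReal_mul, ← sq]
  · linarith [(hH' i).2, (hH' j).2]
  · linarith [(hH' i).1, (hH' j).1]
  · linarith [(hH' i).2, (hH' j).2]
  · have h0 : 0 < H i + H j := add_pos (hH' i).1 (hH' j).1
    have h2 : H i + H j < 2 := by linarith [(hH' i).2, (hH' j).2]
    have hcov := hY.crossCovariance_of_ne hH' hα hB hP hij h1
    have hz := ouCov_powKernel_zero (ρ i j) (η i j) (hα i) (hα j) h0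
    refine ⟨fun t s hts => ?_, ?_, fun t => ?_⟩
    · rw [hcov, hcov, sub_zero, ouCov_powKernel _ _ (hα i) (hα j) h0 h2 (sub_pos.2 hts)]
      ring
    · rw [hcov, sub_zero, hz]
      ring
    · rw [hY.corr_eq hH' hα hν hB (hcov t t), sub_self, hz]
      have := hα i
      have := hα j
      field_simp
  · have hcov := hY.crossCovariance_of_eq hH' hα hB hP hij h1
    have hz := ouCov_logKernel_zero (ρ i j) (η i j) (hα i) (hα j)
    refine ⟨fun t s hts => ?_, ?_, fun t => ?_⟩
    · rw [hcov, hcov, sub_zero, ouCov_logKernel _ _ (hα i) (hα j) (sub_pos.2 hts), h1]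
      ring
    · rw [hcov, sub_zero, hz]
      ring
    · rw [hY.corr_eq hH' hα hν hB (hcov t t), sub_self, hz]
      ring
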